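/- **Setting.** Fix $m\in\mathbb N$ and probabilities $s\in[0,1]$, $l\in(0,1]$. The preferential attachment multigraph $G_n^m$ is defined inductively: $G_1^m$ is one node with $m$ self-loops; $G_n^m$ is built from $G_{n-1}^m$ by adding a new node $u$ together with $m$ edges at $u$, inserted one after the other, where, if $M$ is the sum of all current degrees, the other endpoint of the next edge is a node $v\neq u$ with probability $\deg(v)/(M+1)$ and is $u$ itself with probability $(\deg(u)+1)/(M+1)$. (Degrees count parallel edges with multiplicity and self-loops twice.) Given $G=G_n^m$ with node set $V$, two copies $G_1,G_2$ on $V$ are formed by keeping, in each copy independently, every edge of $G$ independently with probability $s$; the set of seed links $L_0$ contains $(v,v)$ for each $v\in V$ independently with probability $l$. **Algorithm User-Matching** with input $G_1,G_2,L_0$, minimum matching score $T$ and number of iterations $k$. Start with $L=L_0$. Repeat $k$ times: for $j=\lfloor\log_2 D\rfloor,\dots,2,1$, where $D$ is the maximum degree in the two copies, consider all pairs $(u,v)\in V\times V$ with $\deg_{G_1}(u)\ge 2^j$ and $\deg_{G_2}(v)\ge 2^j$; the score of $(u,v)$ is the number of its similarity witnesses, i.e. of links $(a,b)\in L$ with $a$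 adjacent to $u$ in $G_1$ and $b$ adjacent to $v$ in $G_2$; then add to $L$ every considered pair $(u,v)$ whose score is at least $T$ and is strictly larger than the score of every other considered pair $(u,v')$ or $(u',v)$. The output is the final $L$. **Lemma.** Let $m,s,l$ be fixed with $l>0$ and $ms^2\ge 22$, and let $T=9$. Then, with probability tending to $1$ as $n\to\infty$, both of the following hold: 1. for every number of iterations $k$, the output of User-Matching contains no mismatch, i.e. no pair $(u,v)$ with $u\ne v$; 2. for every number of iterations $k\ge n^{3/4}$, User-Matching correctly identifies at least $97\%$ of the nodes, i.e. $(v,v)$ is in the output for at least $0.97\,n$ of the $n$ nodes $v$. -/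

import Mathlib

open Filter Topology
open scoped ENNReal unitInterval

namespace UserMatching

/-! ### Undirected multigraphs on a fixed vertex set -/

/-- An undirected multigraph on the vertex set `V`, given by the list of its edges. The entry
`(a, b)` is an edge joining `a` and `b` (in either direction); repeated entries are parallel edges
and `(a, a)` is a self-loop. -/
abbrev EdgeList (V : Type) := List (V × V)

/-- The degree of `v`: the number of edge ends at `v`. Parallel edges count with multiplicity
and a self-loop counts twice. -/
def degree {V : Type} [DecidableEq V] (E : EdgeList V) (v : V) : ℕ :=
  E.countP (fun e => e.1 = v) + E.countP (fun e => e.2 = v)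

/-- The neighborhood of `v`: the set of nodes joined to `v` by at least one edge. -/
def neighbors {V : Type} [Fintype V] [DecidableEq V] (E : EdgeList V) (v : V) : Finset V :=
  Finset.univ.filter (fun u => (u, v) ∈ E ∨ (v, u) ∈ E)

/-! ### The preferential attachment graph -/

/-- The distribution of the second endpoint of an edge issued by the newly arriving node `u`, when
`E` is the list of all edges present so far (including the earlier edges of `u`). With `M` the sum
of all degrees, a node `v ≠ u` is chosen with probability `deg v / (M + 1)` and `u` itself with
probability `(deg u + 1) / (M + 1)`. Nodes that have not arrived yet have degree `0`. -/
noncomputable def attach {V : Type} [Fintype V] [DecidableEq V] (E : EdgeList V) (u : V) :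
    PMF V :=
  PMF.ofFintype
    (fun v => ((degree E v + (if v = u then 1 else 0) : ℕ) : ℝ≥0∞) /
      (((∑ w, degree E w) + 1 : ℕ) : ℝ≥0∞))
    (by
      simp_rw [div_eq_mul_inv]
      rw [← Finset.sum_mul, ← Nat.cast_sum, Finset.sum_add_distrib, Finset.sum_ite_eq']
      simp only [Finset.mem_univ, if_true]
      exact ENNReal.mul_inv_cancel (by simp) (ENNReal.natCast_ne_top _))

/-- The new node `u` issues `i` edges one after the other, each with an endpoint drawn from
`attach` for the edges present at that moment. -/
noncomputable def addEdges {V : Type} [Fintype V] [DecidableEq V] (u : V) :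
    ℕ → EdgeList V → PMF (EdgeList V)
  | 0, E => PMF.pure E
  | i + 1, E => (attach E u).bind fun v => addEdges u i ((u, v) :: E)

/-- The preferential attachment graph `G_n^m` on the nodes `0, …, n - 1` in order of arrival:
`G_1^m` is a single node with `m` self-loops, and `G_{n+1}^m` is built from `G_n^m` by adding
one new node with `m` edges. -/
noncomputable def paGraph (m : ℕ) : (n : ℕ) → PMF (EdgeList (Fin n))
  | 0 => PMF.pure []
  | 1 => PMF.pure (List.replicate m (0, 0))
  | n + 2 => (paGraph m (n + 1)).bind fun E =>
      addEdges (Fin.last (n + 1)) m (E.map fun e => (e.1.castSucc, e.2.castSucc))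

/-! ### The two copies and the seed links -/

/-- A coin showing `true` with probability `p`. -/
noncomputable def coin (p : I) : PMF Bool :=
  PMF.ofFintype
    (fun b => if b then (unitInterval.toNNReal p : ℝ≥0∞)
      else (unitInterval.toNNReal (unitInterval.symm p) : ℝ≥0∞))
    (by
      rw [Fintype.sum_bool]
      simp [← ENNReal.coe_add])

/-- Keep each entry of a list independently with probability `p`. -/
noncomputable def thin {α : Type} (p : I) : List α → PMF (List α)
  | [] => PMF.pure []
  | a :: as => (coin p).bind fun b =>
      (thin p as).bind fun bs => PMF.pure (if b then a :: bs else bs)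

/-- The input of the algorithm: the two copies of the underlying graph and the set of initial
identification links. -/
structure Instance (V : Type) where
  G₁ : EdgeList V
  G₂ : EdgeList V
  seeds : Finset (V × V)

/-- The random input: draw `G = G_n^m`, let each of the two copies keep every edge of `G`
independently with probability `s`, and link every node to itself across the copies independently
with probability `l`. -/
noncomputable def randomInstance (m n : ℕ) (s l : I) : PMF (Instance (Fin n)) :=
  (paGraph m n).bind fun G =>
    (thin s G).bind fun G₁ =>
      (thin s G).bind fun G₂ =>
        (thin l (List.finRange n)).bind fun S =>
          PMF.pure ⟨G₁, G₂, (S.map fun v => (v, v)).toFinset⟩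

/-! ### The algorithm -/

section Algorithm

variable {V : Type} [Fintype V] [DecidableEq V]

/-- The number of similarity witnesses of `(v₁, v₂)`: the links `(u₁, u₂)` in `L` with `u₁` a
neighbor of `v₁` in the first copy and `u₂` a neighbor of `v₂` in the second. -/
def score (G₁ G₂ : EdgeList V) (L : Finset (V × V)) (p : V × V) : ℕ :=
  (L.filter fun q => q.1 ∈ neighbors G₁ p.1 ∧ q.2 ∈ neighbors G₂ p.2).card

/-- The pairs considered at level `j`: both degrees are at least `2 ^ j`. -/
def candidates (G₁ G₂ : EdgeList V) (j : ℕ) : Finset (V × V) :=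
  Finset.univ.filter fun p => 2 ^ j ≤ degree G₁ p.1 ∧ 2 ^ j ≤ degree G₂ p.2

/-- The inner loop body at level `j`: every candidate pair `(u, v)` whose score reaches the minimum
matching score `T` and exceeds the score of every other candidate pair containing `u` on the first
side or `v` on the second side is added to the links. All scores use the links `L` present at the
start of the phase. -/
def phase (G₁ G₂ : EdgeList V) (T : ℕ) (L : Finset (V × V)) (j : ℕ) : Finset (V × V) :=
  L ∪ (candidates G₁ G₂ j).filter fun p =>
    T ≤ score G₁ G₂ L p ∧
      ∀ q ∈ candidates G₁ G₂ j, q ≠ p → (q.1 = p.1 ∨ q.2 = p.2) →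
        score G₁ G₂ L q < score G₁ G₂ L p

/-- The maximum degree occurring in the two copies. -/
def maxDegree (G₁ G₂ : EdgeList V) : ℕ :=
  Finset.univ.sup fun v => max (degree G₁ v) (degree G₂ v)

/-- One pass of the outer loop: the levels `j = ⌊log₂ D⌋, …, 2, 1` in this order. -/
def iteration (G₁ G₂ : EdgeList V) (T : ℕ) (L : Finset (V × V)) : Finset (V × V) :=
  ((List.range' 1 (Nat.log 2 (maxDegree G₁ G₂))).reverse).foldl (phase G₁ G₂ T) L

/-- The output of User-Matching with minimum matching score `T` and `k` iterations. -/
def userMatching (T k : ℕ) (x : Instance V) : Finset (V × V) :=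
  (iteration x.G₁ x.G₂ T)^[k] x.seeds

/-- The nodes that are correctly identified by a set of links. -/
def identified (L : Finset (V × V)) : Finset V :=
  Finset.univ.filter fun v => (v, v) ∈ L

end Algorithm

end UserMatching

/-! Fix a threshold `U`, a small power of `n`; call the nodes below `U` early and the others late.
The argument isolates a list of properties, `Typical`, that hold with high probability, and is
deterministic from there on.

No mismatch. While all links are correct, the score of `(u, v)` is at most the number of common
neighbours of `u` and `v` in the underlying graph, plus two. An edge between `a` and `u` has
probability of order `1/√(a u)`, and such bounds multiply, up to constants, over any fixed number of
prescribed edges (`Ex_forall_mem_le`). Hence four common neighbours have probability at most of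
order `(log n)^4 / (u v)^2` (indices shifted by one), which sums to `(log n)^4 / U` over the pairs
with a late node: such pairs have at most five witnesses, below the threshold nine. Two early nodes
have fewer than `w = U^3` common neighbours by Markov's inequality. An early node `u`, however, has
a large degree, because no single value of its degree is likely (`Ex_degree_eq_le`), so `(u, u)` has
at least `w + 9` witnesses among the seeds alone and defeats `(u, v)`, provided that both are
considered at the same level. This could fail only if a power of two separated the degrees of `u` in
the two copies, which Chebyshev's inequality and the same anti-concentration exclude.

Coverage. Early nodes are identified from the seeds in the first pass. A late node is identified
once nine older identified nodes are joined to it in both copies by edges it issued; `Reached`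
records the nodes obtained in this way. A new node fails only if fewer than nine of its `m` edges
survive in both copies towards distinct reached, substantially older nodes. As `m s^2 ≥ 22`, this
has probability at most `0.0094` while the total degree of the unreached nodes is at most `0.03 m n`
and no degree is huge. Then the bad weight has drift below `0.03 m`, and a truncated exponential
potential (`Ex_expPotential_step`) keeps it under `0.03 m n` from time `U` on. Every node has degree
at least `m`, so at most three percent are unreached. Along a chain of witnesses the index falls by
the factor `100/101`, so the depth is logarithmic in `n`; a crude bound below `n^(3/4)` is enough.

The joint edge probabilities rest on one algebraic fact: products of rising factorials of degrees
are eigenfunctions of the attachment step (`Ex_attachN_riseProd`). -/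

namespace UserMatching

/-! ### Expectations with respect to a probability mass function -/

/-- The expectation of `f` under `μ`. -/
noncomputable def Ex {α : Type} (μ : PMF α) (f : α → ℝ≥0∞) : ℝ≥0∞ := ∑' a, μ a * f a

section Expectation

variable {α β : Type}

theorem Ex_pure (a : α) (f : α → ℝ≥0∞) : Ex (PMF.pure a) f = f a := by
  classical
  unfold Ex
  rw [tsum_eq_single a]
  · simp
  · intro b hb
    simp [PMF.pure_apply, hb]

theorem Ex_bind (μ : PMF α) (k : α → PMF β) (f : β → ℝ≥0∞) :
    Ex (μ.bind k) f = Ex μ fun a => Ex (k a) f := by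
  unfold Ex
  simp only [PMF.bind_apply, ← ENNReal.tsum_mul_left, ← ENNReal.tsum_mul_right]
  rw [ENNReal.tsum_comm]
  simp only [mul_assoc]

theorem Ex_map (μ : PMF α) (g : α → β) (f : β → ℝ≥0∞) :
    Ex (μ.map g) f = Ex μ (f ∘ g) := by
  unfold PMF.map
  rw [Ex_bind]
  simp only [Function.comp_apply, Ex_pure, Function.comp_def]

theorem Ex_mono_support {μ : PMF α} {f g : α → ℝ≥0∞} (h : ∀ a ∈ μ.support, f a ≤ g a) :
    Ex μ f ≤ Ex μ g := by
  unfold Ex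
  refine ENNReal.tsum_le_tsum fun a => ?_
  by_cases ha : a ∈ μ.support
  · exact mul_le_mul_right (h a ha) _
  · rw [PMF.mem_support_iff, not_not] at ha
    simp [ha]

theorem Ex_mono {μ : PMF α} {f g : α → ℝ≥0∞} (h : ∀ a, f a ≤ g a) : Ex μ f ≤ Ex μ g :=
  Ex_mono_support fun a _ => h a

theorem Ex_congr_support {μ : PMF α} {f g : α → ℝ≥0∞} (h : ∀ a ∈ μ.support, f a = g a) :
    Ex μ f = Ex μ g :=
  le_antisymm (Ex_mono_support fun a ha => (h a ha).le) (Ex_mono_support fun a ha => (h a ha).ge)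

theorem Ex_add (μ : PMF α) (f g : α → ℝ≥0∞) :
    (Ex μ fun a => f a + g a) = Ex μ f + Ex μ g := by
  unfold Ex
  simp only [mul_add]
  exact ENNReal.tsum_add

theorem Ex_const_mul (μ : PMF α) (c : ℝ≥0∞) (f : α → ℝ≥0∞) :
    (Ex μ fun a => c * f a) = c * Ex μ f := by
  unfold Ex
  rw [← ENNReal.tsum_mul_left]
  exact tsum_congr fun a => by ring

theorem Ex_mul_const (μ : PMF α) (c : ℝ≥0∞) (f : α → ℝ≥0∞) :
    (Ex μ fun a => f a * c) = Ex μ f * c := by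
  rw [mul_comm, ← Ex_const_mul]
  simp only [mul_comm]

theorem Ex_const (μ : PMF α) (c : ℝ≥0∞) : (Ex μ fun _ => c) = c := by
  unfold Ex
  rw [ENNReal.tsum_mul_right, μ.tsum_coe, one_mul]

theorem Ex_le_const {μ : PMF α} {f : α → ℝ≥0∞} {c : ℝ≥0∞} (h : ∀ a ∈ μ.support, f a ≤ c) :
    Ex μ f ≤ c :=
  (Ex_mono_support h).trans (Ex_const μ c).le

theorem Ex_finset_sum {ι : Type} (μ : PMF α) (s : Finset ι) (f : ι → α → ℝ≥0∞) :
    (Ex μ fun a => ∑ i ∈ s, f i a) = ∑ i ∈ s, Ex μ (f i) := by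
  classical
  induction s using Finset.induction_on with
  | empty => simp [Ex]
  | insert i s hi ih => simp only [Finset.sum_insert hi, Ex_add, ih]

theorem Ex_comm (μ : PMF α) (ν : PMF β) (f : α → β → ℝ≥0∞) :
    (Ex μ fun a => Ex ν fun b => f a b) = Ex ν fun b => Ex μ fun a => f a b := by
  unfold Ex
  simp only [← ENNReal.tsum_mul_left]
  rw [ENNReal.tsum_comm]
  exact tsum_congr fun b => tsum_congr fun a => by ring

theorem toOuterMeasure_eq_Ex (μ : PMF α) (s : Set α) :
    μ.toOuterMeasure s = Ex μ (s.indicator 1) := by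
  rw [PMF.toOuterMeasure_apply]
  unfold Ex
  refine tsum_congr fun a => ?_
  by_cases h : a ∈ s <;> simp [h]

end Expectation

/-- The numerical indicator of a proposition. -/
noncomputable def ind (p : Prop) : ℝ≥0∞ := open Classical in if p then 1 else 0

theorem ind_true {p : Prop} (h : p) : ind p = 1 := by simp [ind, h]

theorem ind_false {p : Prop} (h : ¬p) : ind p = 0 := by simp [ind, h]

theorem ind_le_one (p : Prop) : ind p ≤ 1 := by
  by_cases h : p <;> simp [ind, h]

theorem ind_mono {p q : Prop} (h : p → q) : ind p ≤ ind q := by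
  by_cases hp : p
  · rw [ind_true hp, ind_true (h hp)]
  · rw [ind_false hp]; exact zero_le

theorem ind_le_of {p : Prop} {c : ℝ≥0∞} (h : p → 1 ≤ c) : ind p ≤ c := by
  by_cases hp : p
  · rw [ind_true hp]; exact h hp
  · rw [ind_false hp]; exact zero_le

theorem ind_or_le (p q : Prop) : ind (p ∨ q) ≤ ind p + ind q := by
  by_cases hp : p <;> by_cases hq : q <;> simp [ind, hp, hq]

theorem ind_and (p q : Prop) : ind (p ∧ q) = ind p * ind q := by
  by_cases hp : p <;> by_cases hq : q <;> simp [ind, hp, hq]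

theorem ind_exists_mem_le {ι : Type} (s : Finset ι) (p : ι → Prop) :
    ind (∃ i ∈ s, p i) ≤ ∑ i ∈ s, ind (p i) := by
  refine ind_le_of fun ⟨i, hi, hp⟩ => ?_
  rw [← ind_true hp]
  exact Finset.single_le_sum (f := fun i => ind (p i)) (fun _ _ => zero_le) hi

/-! ### Coins and thinning -/

theorem Ex_coin (p : I) (f : Bool → ℝ≥0∞) :
    Ex (coin p) f = ENNReal.ofReal p * f true + ENNReal.ofReal (1 - p) * f false := by
  unfold Ex
  rw [tsum_fintype, Fintype.sum_bool]
  have h1 : (coin p) true = ENNReal.ofReal p := by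
    simp only [coin, PMF.ofFintype_apply, if_true]
    rw [ENNReal.ofReal, ENNReal.coe_inj]
    ext
    simp [Real.coe_toNNReal _ p.2.1]
  have h2 : (coin p) false = ENNReal.ofReal (1 - p) := by
    simp only [coin, PMF.ofFintype_apply]
    rw [ENNReal.ofReal]
    simp only [Bool.false_eq_true, if_false]
    rw [ENNReal.coe_inj]
    ext
    simp [Real.coe_toNNReal _ (sub_nonneg.2 p.2.2)]
  rw [h1, h2]

theorem Ex_thin_nil {α : Type} (p : I) (f : List α → ℝ≥0∞) : Ex (thin p []) f = f [] := by
  rw [thin, Ex_pure]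

theorem Ex_thin_cons {α : Type} (p : I) (a : α) (as : List α) (f : List α → ℝ≥0∞) :
    Ex (thin p (a :: as)) f =
      Ex (coin p) fun b => Ex (thin p as) fun bs => f (if b then a :: bs else bs) := by
  simp only [thin, Ex_bind, Ex_pure]

theorem Ex_thin_map {α β : Type} (p : I) (g : α → β) (as : List α) (f : List β → ℝ≥0∞) :
    Ex (thin p (as.map g)) f = Ex (thin p as) fun bs => f (bs.map g) := by
  induction as generalizing f with
  | nil => simp [Ex_thin_nil]
  | cons a as ih =>
    rw [List.map_cons, Ex_thin_cons, Ex_thin_cons]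
    simp only [ih]
    congr 1
    ext b
    cases b <;> simp

theorem sublist_of_mem_support_thin {α : Type} {p : I} {as bs : List α}
    (h : bs ∈ (thin p as).support) : bs.Sublist as := by
  induction as generalizing bs with
  | nil =>
    simp only [thin, PMF.support_pure, Set.mem_singleton_iff] at h
    simp [h]
  | cons a as ih =>
    simp only [thin, PMF.mem_support_bind_iff, PMF.mem_support_pure_iff] at h
    obtain ⟨b, -, cs, hcs, rfl⟩ := h
    cases b
    · simpa using (ih hcs).cons a
    · simpa using (ih hcs).cons_cons a

/-! ### Degrees -/

section Degree

variable {V : Type} [DecidableEq V]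

@[simp] theorem degree_nil (v : V) : degree ([] : EdgeList V) v = 0 := rfl

theorem degree_cons (e : V × V) (E : EdgeList V) (v : V) :
    degree (e :: E) v =
      degree E v + ((if e.1 = v then 1 else 0) + (if e.2 = v then 1 else 0)) := by
  unfold degree
  simp only [List.countP_cons, decide_eq_true_eq]
  omega

theorem degree_append (E F : EdgeList V) (v : V) :
    degree (E ++ F) v = degree E v + degree F v := by
  unfold degree
  simp only [List.countP_append]
  omega

theorem degree_mono {E F : EdgeList V} (h : E.Sublist F) (v : V) : degree E v ≤ degree F v :=
  Nat.add_le_add (h.countP_le) (h.countP_le)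

theorem degree_map {W : Type} [DecidableEq W] (g : V → W) (hg : Function.Injective g)
    (E : EdgeList V) (v : V) : degree (E.map (Prod.map g g)) (g v) = degree E v := by
  induction E with
  | nil => rfl
  | cons e E ih => simp only [List.map_cons, degree_cons, ih, Prod.map_fst, Prod.map_snd, hg.eq_iff]

theorem sum_degree_mul {s : Finset V} {E : EdgeList V} (hE : ∀ e ∈ E, e.1 ∈ s ∧ e.2 ∈ s)
    (f : V → ℝ≥0∞) :
    ∑ v ∈ s, (degree E v : ℝ≥0∞) * f v = (E.map fun e => f e.1 + f e.2).sum := by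
  induction E with
  | nil => simp
  | cons e E ih =>
    have h1 := hE e (by simp)
    simp only [degree_cons, Nat.cast_add, add_mul, Finset.sum_add_distrib, List.map_cons,
      List.sum_cons]
    rw [ih fun e' he' => hE e' (by simp [he'])]
    simp [h1.1, h1.2]
    ring

/-- Weighted handshake identity: each edge end contributes once. It turns expectations under
attachment into sums over edges, which do not see the vertex type. -/
theorem tsum_degree_mul (E : EdgeList V) (f : V → ℝ≥0∞) :
    ∑' v, (degree E v : ℝ≥0∞) * f v = (E.map fun e => f e.1 + f e.2).sum := by
  induction E with
  | nil => simp
  | cons e E ih =>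
    simp only [degree_cons, Nat.cast_add, add_mul, List.map_cons, List.sum_cons]
    rw [ENNReal.tsum_add, ih, ENNReal.tsum_add]
    have : ∀ x : V, ∑' v, (((if x = v then 1 else 0 : ℕ) : ℝ≥0∞)) * f v = f x := by
      intro x
      rw [tsum_eq_single x]
      · simp
      · intro b hb
        simp [hb.symm]
    rw [this, this, add_comm]

theorem sum_degree [Fintype V] (E : EdgeList V) : ∑ w, degree E w = 2 * E.length := by
  induction E with
  | nil => simp
  | cons e E ih =>
    simp only [degree_cons, Finset.sum_add_distrib, ih]
    simp
    ring

end Degree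

/-! ### The preferential attachment process on the natural numbers -/

/-- The law of the second endpoint of an edge issued by `u`, on the node set `ℕ`. -/
noncomputable def attachN (E : EdgeList ℕ) (u : ℕ) : PMF ℕ :=
  ⟨fun v => ((degree E v + (if v = u then 1 else 0) : ℕ) : ℝ≥0∞) / ((2 * E.length + 1 : ℕ) : ℝ≥0∞),
    by
      have h : ∑' v, ((degree E v + (if v = u then 1 else 0) : ℕ) : ℝ≥0∞) =
          ((2 * E.length + 1 : ℕ) : ℝ≥0∞) := by
        have h1 := tsum_degree_mul E (fun _ => 1)
        simp only [mul_one] at h1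
        simp only [Nat.cast_add]
        rw [ENNReal.tsum_add, h1, tsum_eq_single u]
        · simp
          rw [two_mul]
        · intro b hb
          simp [hb]
      simp_rw [div_eq_mul_inv]
      convert ENNReal.summable.hasSum using 1
      rw [ENNReal.tsum_mul_right, h]
      exact (ENNReal.mul_inv_cancel (by simp) (ENNReal.natCast_ne_top _)).symm⟩

theorem attachN_apply (E : EdgeList ℕ) (u v : ℕ) :
    attachN E u v =
      ((degree E v + (if v = u then 1 else 0) : ℕ) : ℝ≥0∞) / ((2 * E.length + 1 : ℕ) : ℝ≥0∞) :=
  rfl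

theorem Ex_attachN (E : EdgeList ℕ) (u : ℕ) (f : ℕ → ℝ≥0∞) :
    Ex (attachN E u) f =
      ((E.map fun e => f e.1 + f e.2).sum + f u) / ((2 * E.length + 1 : ℕ) : ℝ≥0∞) := by
  unfold Ex
  simp only [attachN_apply, div_eq_mul_inv, mul_right_comm _ _ (f _)]
  rw [ENNReal.tsum_mul_right]
  congr 1
  simp only [Nat.cast_add, add_mul]
  rw [ENNReal.tsum_add, tsum_degree_mul, tsum_eq_single u]
  · simp
  · intro b hb
    simp [hb]

theorem Ex_attach {V : Type} [Fintype V] [DecidableEq V] (E : EdgeList V) (u : V)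
    (f : V → ℝ≥0∞) :
    Ex (attach E u) f =
      ((E.map fun e => f e.1 + f e.2).sum + f u) / ((2 * E.length + 1 : ℕ) : ℝ≥0∞) := by
  unfold Ex
  simp only [attach, PMF.ofFintype_apply, div_eq_mul_inv, mul_right_comm _ _ (f _), sum_degree]
  rw [ENNReal.tsum_mul_right]
  congr 1
  simp only [Nat.cast_add, add_mul]
  rw [ENNReal.tsum_add, tsum_degree_mul, tsum_eq_single u]
  · simp
  · intro b hb
    simp [hb]

/-- The node `u` issues `i` edges, on the node set `ℕ`. -/
noncomputable def addEdgesN (u : ℕ) : ℕ → EdgeList ℕ → PMF (EdgeList ℕ)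
  | 0, E => PMF.pure E
  | i + 1, E => (attachN E u).bind fun v => addEdgesN u i ((u, v) :: E)

/-- The preferential attachment graph with nodes `0, …, n - 1` as a multigraph on `ℕ`. -/
noncomputable def natGraph (m : ℕ) : ℕ → PMF (EdgeList ℕ)
  | 0 => PMF.pure []
  | 1 => PMF.pure (List.replicate m (0, 0))
  | n + 2 => (natGraph m (n + 1)).bind fun E => addEdgesN (n + 1) m E

theorem Ex_addEdgesN_zero (u : ℕ) (E : EdgeList ℕ) (f : EdgeList ℕ → ℝ≥0∞) :
    Ex (addEdgesN u 0 E) f = f E := by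
  rw [addEdgesN, Ex_pure]

theorem Ex_addEdgesN_succ (u i : ℕ) (E : EdgeList ℕ) (f : EdgeList ℕ → ℝ≥0∞) :
    Ex (addEdgesN u (i + 1) E) f =
      Ex (attachN E u) fun v => Ex (addEdgesN u i ((u, v) :: E)) f := by
  rw [addEdgesN, Ex_bind]

theorem Ex_natGraph_one (m : ℕ) (f : EdgeList ℕ → ℝ≥0∞) :
    Ex (natGraph m 1) f = f (List.replicate m (0, 0)) := by
  rw [natGraph, Ex_pure]

theorem Ex_natGraph_succ (m : ℕ) {n : ℕ} (hn : 1 ≤ n) (f : EdgeList ℕ → ℝ≥0∞) :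
    Ex (natGraph m (n + 1)) f = Ex (natGraph m n) fun E => Ex (addEdgesN n m E) f := by
  obtain ⟨n, rfl⟩ := Nat.exists_eq_add_of_le' hn
  rw [natGraph, Ex_bind]

/-- Forget the bounds of the nodes. -/
def valEdges {n : ℕ} (E : EdgeList (Fin n)) : EdgeList ℕ := E.map (Prod.map Fin.val Fin.val)

/-- The attachment expectation reads the graph only through its edge list, so relabelling by
`Fin.val` commutes with each draw. On `ℕ` the graphs of different sizes share one vertex type. -/
theorem Ex_addEdges_val {n : ℕ} (u : Fin n) (i : ℕ) (E : EdgeList (Fin n))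
    (f : EdgeList ℕ → ℝ≥0∞) :
    Ex (addEdges u i E) (fun E' => f (valEdges E')) = Ex (addEdgesN u i (valEdges E)) f := by
  induction i generalizing E with
  | zero => rw [addEdges, Ex_pure, Ex_addEdgesN_zero]
  | succ i ih =>
    rw [addEdges, Ex_bind, Ex_addEdgesN_succ]
    simp only [ih]
    rw [Ex_attach, Ex_attachN]
    simp [valEdges, Function.comp_def]

theorem Ex_paGraph_val (m n : ℕ) (f : EdgeList ℕ → ℝ≥0∞) :
    Ex (paGraph m n) (fun E => f (valEdges E)) = Ex (natGraph m n) f := by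
  induction n generalizing f with
  | zero => simp [paGraph, natGraph, Ex_pure, valEdges]
  | succ n ih =>
    cases n with
    | zero => simp [paGraph, natGraph, Ex_pure, valEdges]
    | succ n =>
      rw [paGraph, Ex_bind, Ex_natGraph_succ m (by omega), ← ih]
      congr 1
      ext E
      rw [Ex_addEdges_val]
      simp only [valEdges, List.map_map]
      rfl

/-! ### Structure of the sampled graphs -/

theorem mem_support_addEdgesN {u i : ℕ} {E E' : EdgeList ℕ}
    (h : E' ∈ (addEdgesN u i E).support) :
    ∃ F : EdgeList ℕ, E' = F ++ E ∧ F.length = i ∧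
      ∀ e ∈ F, e.1 = u ∧ (e.2 = u ∨ 0 < degree E e.2) := by
  induction i generalizing E with
  | zero =>
    rw [addEdgesN, PMF.mem_support_pure_iff] at h
    exact ⟨[], by simp [h]⟩
  | succ i ih =>
    rw [addEdgesN, PMF.mem_support_bind_iff] at h
    obtain ⟨v, hv, h⟩ := h
    obtain ⟨F, rfl, hF, hF'⟩ := ih h
    have hv' : v = u ∨ 0 < degree E v := by
      by_contra hcon
      push Not at hcon
      apply (PMF.mem_support_iff _ _).1 hv
      rw [attachN_apply]
      simp [hcon.1, Nat.le_zero.1 hcon.2]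
    refine ⟨F ++ [(u, v)], by simp, by simp [hF], ?_⟩
    intro e he
    rw [List.mem_append] at he
    rcases he with he | he
    · refine ⟨(hF' e he).1, ?_⟩
      rcases (hF' e he).2 with h2 | h2
      · exact Or.inl h2
      · rw [degree_cons] at h2
        by_cases h3 : u = e.2
        · exact Or.inl h3.symm
        · by_cases h4 : v = e.2
          · rw [← h4]; exact hv'
          · right
            simpa [h3, h4] using h2
    · simp only [List.mem_singleton] at he
      subst he
      exact ⟨rfl, hv'⟩

/-- The structural properties of the graph on the first `n` nodes: every node issues `m` edges,
each to a node which is not younger. -/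
structure IsGrown (m n : ℕ) (E : EdgeList ℕ) : Prop where
  length_eq : E.length = m * n
  target_le : ∀ e ∈ E, e.2 ≤ e.1
  source_lt : ∀ e ∈ E, e.1 < n
  count_source : ∀ a < n, E.countP (fun e => e.1 = a) = m

theorem degree_pos_iff {V : Type} [DecidableEq V] {E : EdgeList V} {v : V} :
    0 < degree E v ↔ ∃ e ∈ E, e.1 = v ∨ e.2 = v := by
  unfold degree
  rw [Nat.add_pos_iff_pos_or_pos, List.countP_pos_iff, List.countP_pos_iff]
  simp only [decide_eq_true_eq]
  constructor
  · rintro (⟨e, he, h⟩ | ⟨e, he, h⟩)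
    exacts [⟨e, he, Or.inl h⟩, ⟨e, he, Or.inr h⟩]
  · rintro ⟨e, he, h | h⟩
    exacts [Or.inl ⟨e, he, h⟩, Or.inr ⟨e, he, h⟩]

theorem IsGrown.lt_of_degree_pos {m n : ℕ} {E : EdgeList ℕ} (h : IsGrown m n E) {v : ℕ}
    (hv : 0 < degree E v) : v < n := by
  obtain ⟨e, he, h1 | h1⟩ := degree_pos_iff.1 hv
  · rw [← h1]; exact h.source_lt e he
  · rw [← h1]; exact (h.target_le e he).trans_lt (h.source_lt e he)

theorem IsGrown.addEdgesN {m n : ℕ} {E E' : EdgeList ℕ} (h : IsGrown m n E)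
    (h' : E' ∈ (UserMatching.addEdgesN n m E).support) : IsGrown m (n + 1) E' := by
  obtain ⟨F, rfl, hF, hF'⟩ := mem_support_addEdgesN h'
  have hE0 : ∀ a < n, F.countP (fun e => e.1 = a) = 0 := by
    intro a ha
    rw [List.countP_eq_zero]
    intro e he
    simp only [decide_eq_true_eq]
    have := (hF' e he).1
    omega
  refine ⟨?_, ?_, ?_, ?_⟩
  · rw [List.length_append, hF, h.length_eq]; ring
  · intro e he
    rcases List.mem_append.1 he with he | he
    · obtain ⟨h1, h2 | h2⟩ := hF' e he
      · omega
      · have := h.lt_of_degree_pos h2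
        omega
    · exact h.target_le e he
  · intro e he
    rcases List.mem_append.1 he with he | he
    · rw [(hF' e he).1]; omega
    · have := h.source_lt e he
      omega
  · intro a ha
    rw [List.countP_append]
    rcases Nat.lt_succ_iff_lt_or_eq.1 ha with ha | rfl
    · rw [hE0 a ha, h.count_source a ha, zero_add]
    · have h1 : F.countP (fun e => e.1 = a) = F.length := by
        rw [List.countP_eq_length]
        intro e he
        simp [(hF' e he).1]
      have h2 : E.countP (fun e => e.1 = a) = 0 := by
        rw [List.countP_eq_zero]
        intro e he
        have := h.source_lt e he
        simp only [decide_eq_true_eq]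
        omega
      rw [h1, h2, hF, add_zero]

theorem isGrown_of_mem_support {m n : ℕ} (hn : 1 ≤ n) {E : EdgeList ℕ}
    (hE : E ∈ (natGraph m n).support) : IsGrown m n E := by
  induction n, hn using Nat.le_induction generalizing E with
  | base =>
    rw [natGraph, PMF.mem_support_pure_iff] at hE
    subst hE
    refine ⟨by simp, ?_, ?_, ?_⟩
    · intro e he
      rw [List.eq_of_mem_replicate he]
    · intro e he
      rw [List.eq_of_mem_replicate he]
      exact Nat.one_pos
    · intro a ha
      obtain rfl : a = 0 := by omega
      simp [List.countP_replicate]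
  | succ n hn ih =>
    obtain ⟨n, rfl⟩ := Nat.exists_eq_add_of_le' hn
    rw [natGraph, PMF.mem_support_bind_iff] at hE
    obtain ⟨E₀, h0, h1⟩ := hE
    exact (ih h0).addEdgesN h1

/-! ### Rising factorial moments of the degrees -/

/-- The product of rising factorials of the degrees of the nodes below `u`. -/
def riseProd (u : ℕ) (k : ℕ → ℕ) (E : EdgeList ℕ) : ℕ :=
  ∏ x ∈ Finset.range u, (degree E x).ascFactorial (k x)

theorem degree_cons_source {u v x : ℕ} (E : EdgeList ℕ) (hx : x < u) :
    degree ((u, v) :: E) x = degree E x + if v = x then 1 else 0 := by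
  rw [degree_cons, if_neg (by simp; omega), zero_add]

theorem riseProd_cons_of_le {u v : ℕ} (k : ℕ → ℕ) (E : EdgeList ℕ) (hv : u ≤ v) :
    riseProd u k ((u, v) :: E) = riseProd u k E := by
  refine Finset.prod_congr rfl fun x hx => ?_
  rw [Finset.mem_range] at hx
  rw [degree_cons_source E hx, if_neg (by omega), add_zero]

theorem riseProd_cons_of_lt {u v : ℕ} (k : ℕ → ℕ) (E : EdgeList ℕ) (hv : v < u) :
    riseProd u k ((u, v) :: E) = (degree E v + 1).ascFactorial (k v) *
      ∏ x ∈ (Finset.range u).erase v, (degree E x).ascFactorial (k x) := by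
  unfold riseProd
  rw [← Finset.mul_prod_erase _ _ (Finset.mem_range.2 hv)]
  congr 1
  · rw [degree_cons_source E hv, if_pos rfl]
  · refine Finset.prod_congr rfl fun x hx => ?_
    rw [Finset.mem_erase, Finset.mem_range] at hx
    rw [degree_cons_source E hx.2, if_neg (Ne.symm hx.1), add_zero]

/-- With `d` the degree and `k` the exponent at `v`, both sides contain `d (d+1) … (d+k)`: the
weight of the new end times the raised factor is the old factor times `d + k`. This exactness is the
reason for rising factorials instead of powers. -/
theorem weight_mul_riseProd_cons (u v : ℕ) (k : ℕ → ℕ) (E : EdgeList ℕ) :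
    (degree E v + if v = u then 1 else 0) * riseProd u k ((u, v) :: E) =
      riseProd u k E * ((degree E v + if v = u then 1 else 0) + if v < u then k v else 0) := by
  by_cases hv : v < u
  · rw [riseProd_cons_of_lt k E hv, if_neg (by omega), if_pos hv, add_zero, ← mul_assoc,
      Nat.succ_ascFactorial]
    unfold riseProd
    rw [← Finset.mul_prod_erase _ _ (Finset.mem_range.2 hv)]
    ring
  · rw [riseProd_cons_of_le k E (by omega), if_neg hv, add_zero, mul_comm]

/-- The same product read as a rising factorial of order `k + 1`: the weight of hitting `v` is
absorbed as one more unit in the exponent of `v`. -/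
theorem degree_mul_riseProd_cons {u v : ℕ} {k k' : ℕ → ℕ} (E : EdgeList ℕ) (hv : v < u)
    (h1 : k' v = k v + 1) (h2 : ∀ x, x ≠ v → k' x = k x) :
    degree E v * riseProd u k ((u, v) :: E) = riseProd u k' E := by
  rw [riseProd_cons_of_lt k E hv, ← mul_assoc, Nat.succ_ascFactorial]
  unfold riseProd
  rw [← Finset.mul_prod_erase _ _ (Finset.mem_range.2 hv), h1, Nat.ascFactorial_succ]
  congr 1
  refine Finset.prod_congr rfl fun x hx => ?_
  rw [h2 x (Finset.ne_of_mem_erase hx)]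

/-- The eigenfunction property: the eigenvalue depends only on the total exponent and on the number
of edges. -/
theorem Ex_attachN_riseProd (u : ℕ) (k : ℕ → ℕ) (E : EdgeList ℕ) :
    Ex (attachN E u) (fun v => (riseProd u k ((u, v) :: E) : ℝ≥0∞)) =
      riseProd u k E * (1 + ((∑ x ∈ Finset.range u, k x : ℕ) : ℝ≥0∞) /
        ((2 * E.length + 1 : ℕ) : ℝ≥0∞)) := by
  have h0 : ((2 * E.length + 1 : ℕ) : ℝ≥0∞) ≠ 0 := by simp
  have h1 : ((2 * E.length + 1 : ℕ) : ℝ≥0∞) ≠ ⊤ := ENNReal.natCast_ne_top _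
  have hterm : ∀ v, attachN E u v * (riseProd u k ((u, v) :: E) : ℝ≥0∞) =
      riseProd u k E * (attachN E u v + ((if v < u then k v else 0 : ℕ) : ℝ≥0∞) /
        ((2 * E.length + 1 : ℕ) : ℝ≥0∞)) := by
    intro v
    rw [attachN_apply, ← ENNReal.add_div, ← mul_div_assoc, ENNReal.mul_comm_div, mul_div_assoc',
      ← Nat.cast_mul, weight_mul_riseProd_cons]
    push_cast
    rfl
  unfold Ex
  simp only [hterm]
  rw [ENNReal.tsum_mul_left, ENNReal.tsum_add, PMF.tsum_coe]
  congr 2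
  simp only [div_eq_mul_inv]
  rw [ENNReal.tsum_mul_right]
  congr 1
  rw [tsum_eq_sum (s := Finset.range u)]
  · push_cast
    refine Finset.sum_congr rfl fun x hx => ?_
    rw [if_pos (Finset.mem_range.1 hx)]
  · intro b hb
    rw [Finset.mem_range] at hb
    simp [hb]

theorem Ex_attachN_ind_mul (u x : ℕ) (E : EdgeList ℕ) (f : ℕ → ℝ≥0∞) :
    Ex (attachN E u) (fun v => ind (v = x) * f v) = attachN E u x * f x := by
  unfold Ex
  rw [tsum_eq_single x]
  · simp only [ind_true, one_mul]
  · intro b hb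
    simp only [ind_false hb, zero_mul, mul_zero]

/-- The exponent function `k` raised by one on `H`. -/
def raise (k : ℕ → ℕ) (H : Finset ℕ) : ℕ → ℕ := fun x => k x + if x ∈ H then 1 else 0

theorem sum_raise {u : ℕ} (k : ℕ → ℕ) {H : Finset ℕ} (hH : H ⊆ Finset.range u) :
    ∑ x ∈ Finset.range u, raise k H x = ∑ x ∈ Finset.range u, k x + H.card := by
  unfold raise
  rw [Finset.sum_add_distrib, Finset.sum_ite_mem, Finset.inter_eq_right.2 hH]
  simp

/-- Condition on the next edge. Either it hits some `x ∈ H`, and its weight raises the exponent of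
`x`, or all of `H` remains to be hit. In `β` the term with `Q` is the growth of the product and the
final `h` counts the targets the edge may hit; `β` is uniform over subsets of `H` so that the
induction closes. -/
theorem Ex_addEdgesN_hit {u : ℕ} (k : ℕ → ℕ) {Q : ℝ≥0∞} {β : ℝ≥0∞} {h e₀ : ℕ}
    (hQ : Q = ((2 * e₀ + 1 : ℕ) : ℝ≥0∞)⁻¹)
    (hβ : 1 + ((∑ x ∈ Finset.range u, k x + h : ℕ) : ℝ≥0∞) * Q + (h : ℝ≥0∞) ≤ β)
    (i : ℕ) (H : Finset ℕ) (hH : H ⊆ Finset.range u) (hh : H.card ≤ h) (E : EdgeList ℕ)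
    (hE : e₀ ≤ E.length) (hHE : ∀ x ∈ H, (u, x) ∉ E) :
    Ex (addEdgesN u i E) (fun E' => ind (∀ x ∈ H, (u, x) ∈ E') * (riseProd u k E' : ℝ≥0∞)) ≤
      riseProd u (raise k H) E * Q ^ H.card * β ^ i := by
  induction i generalizing H E with
  | zero =>
    rw [Ex_addEdgesN_zero, pow_zero, mul_one]
    rcases H.eq_empty_or_nonempty with rfl | ⟨x, hx⟩
    · rw [show raise k ∅ = k by ext; simp [raise]]
      simp [ind]
    -- No edge from `u` to `H` exists at the start, so a nonempty `H` cannot have been hit.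
    · rw [ind_false fun hcon => hHE x hx (hcon x hx), zero_mul]
      exact zero_le
  | succ i ih =>
    rw [Ex_addEdgesN_succ]
    have hlen : ((2 * E.length + 1 : ℕ) : ℝ≥0∞)⁻¹ ≤ Q := by
      rw [hQ, ENNReal.inv_le_inv]
      exact_mod_cast (by omega : 2 * e₀ + 1 ≤ 2 * E.length + 1)
    have hstep : ∀ v, Ex (addEdgesN u i ((u, v) :: E))
        (fun E' => ind (∀ x ∈ H, (u, x) ∈ E') * (riseProd u k E' : ℝ≥0∞)) ≤
        (riseProd u (raise k H) ((u, v) :: E) : ℝ≥0∞) * (Q ^ H.card * β ^ i) +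
        ∑ x ∈ H, ind (v = x) * ((riseProd u (raise k (H.erase x)) ((u, v) :: E) : ℝ≥0∞) *
          (Q ^ (H.card - 1) * β ^ i)) := by
      intro v
      by_cases hv : v ∈ H
      · refine le_trans ?_ (le_add_left le_rfl)
        refine le_trans ?_ (Finset.single_le_sum (fun _ _ => zero_le) hv)
        rw [ind_true rfl, one_mul]
        refine le_trans (Ex_mono fun E' => ?_) ((ih (H.erase v)
          ((Finset.erase_subset _ _).trans hH) ((Finset.card_erase_le).trans hh)
          ((u, v) :: E) (by simp; omega) ?_).trans (le_of_eq ?_))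
        · exact mul_le_mul_left (ind_mono fun hx x hxe => hx x (Finset.mem_of_mem_erase hxe)) _
        · intro x hx
          rw [Finset.mem_erase] at hx
          simp only [List.mem_cons, Prod.mk.injEq, true_and, not_or]
          exact ⟨hx.1, hHE x hx.2⟩
        · rw [Finset.card_erase_of_mem hv, mul_assoc]
      · refine le_trans ?_ (le_add_right le_rfl)
        refine (ih H hH hh ((u, v) :: E) (by simp; omega) ?_).trans (le_of_eq (mul_assoc _ _ _))
        intro x hx
        simp only [List.mem_cons, Prod.mk.injEq, true_and, not_or]
        exact ⟨fun hxv => hv (hxv ▸ hx), hHE x hx⟩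
    refine (Ex_mono hstep).trans ?_
    rw [Ex_add, Ex_finset_sum, Ex_mul_const, Ex_attachN_riseProd, sum_raise k hH]
    have hsum : ∀ x ∈ H, Ex (attachN E u) (fun v => ind (v = x) *
        ((riseProd u (raise k (H.erase x)) ((u, v) :: E) : ℝ≥0∞) * (Q ^ (H.card - 1) * β ^ i))) ≤
        (riseProd u (raise k H) E : ℝ≥0∞) * Q ^ H.card * β ^ i := by
      intro x hx
      have hxu : x < u := Finset.mem_range.1 (hH hx)
      have h1 := degree_mul_riseProd_cons (k := raise k (H.erase x)) (k' := raise k H) E hxu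
        (by simp [raise, hx]) (by intro y hy; simp [raise, hy])
      rw [Ex_attachN_ind_mul, attachN_apply, if_neg (by omega), add_zero, div_eq_mul_inv,
        ← h1]
      have hcard : Q ^ H.card = Q * Q ^ (H.card - 1) := by
        rw [← pow_succ', Nat.sub_add_cancel (Finset.card_pos.2 ⟨x, hx⟩)]
      rw [hcard]
      push_cast
      calc (degree E x : ℝ≥0∞) * ((2 * (E.length : ℝ≥0∞) + 1))⁻¹ *
            ((riseProd u (raise k (H.erase x)) ((u, x) :: E) : ℝ≥0∞) *
              (Q ^ (H.card - 1) * β ^ i))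
          ≤ (degree E x : ℝ≥0∞) * Q * ((riseProd u (raise k (H.erase x)) ((u, x) :: E) : ℝ≥0∞) *
              (Q ^ (H.card - 1) * β ^ i)) := by
            push_cast at hlen
            gcongr
        _ = _ := by ring
    refine (add_le_add_right (Finset.sum_le_sum hsum) _).trans ?_
    rw [Finset.sum_const, nsmul_eq_mul, div_eq_mul_inv]
    calc (riseProd u (raise k H) E : ℝ≥0∞) * (1 + ((∑ x ∈ Finset.range u, k x + H.card : ℕ) : ℝ≥0∞)
            * ((2 * E.length + 1 : ℕ) : ℝ≥0∞)⁻¹) * (Q ^ H.card * β ^ i) +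
            (H.card : ℝ≥0∞) * ((riseProd u (raise k H) E : ℝ≥0∞) * Q ^ H.card * β ^ i)
        = (riseProd u (raise k H) E : ℝ≥0∞) * Q ^ H.card * β ^ i *
            (1 + ((∑ x ∈ Finset.range u, k x + H.card : ℕ) : ℝ≥0∞)
            * ((2 * E.length + 1 : ℕ) : ℝ≥0∞)⁻¹ + (H.card : ℝ≥0∞)) := by ring
      _ ≤ (riseProd u (raise k H) E : ℝ≥0∞) * Q ^ H.card * β ^ i * β := by
          gcongr
          refine le_trans ?_ hβ
          have hh' : (H.card : ℝ≥0∞) ≤ h := by exact_mod_cast hh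
          gcongr
      _ = _ := by ring

/-! ### The growth rate of the degrees -/

/-- The rate at which degrees grow; it is of the order of `√t`. -/
noncomputable def growth (t : ℕ) : ℝ := Real.exp ((harmonic (t - 1) : ℝ) / 2)

theorem growth_pos (t : ℕ) : 0 < growth t := Real.exp_pos _

/-- This factor is what one arrival of `m` edges costs per unit of exponent: `(1 + K/(2mn+1))^m ≤
exp(K/(2n))`. -/
theorem growth_succ {n : ℕ} (hn : 1 ≤ n) :
    growth (n + 1) = growth n * Real.exp (1 / (2 * (n : ℝ))) := by
  unfold growth
  rw [← Real.exp_add]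
  congr 1
  obtain ⟨n, rfl⟩ := Nat.exists_eq_add_of_le' hn
  simp only [Nat.add_sub_cancel, harmonic_succ]
  push_cast
  field_simp

theorem sqrt_le_growth {t : ℕ} (ht : 1 ≤ t) : √(t : ℝ) ≤ growth t := by
  obtain ⟨t, rfl⟩ := Nat.exists_eq_add_of_le' ht
  have h := log_add_one_le_harmonic t
  unfold growth
  rw [Real.sqrt_le_left (Real.exp_pos _).le, ← Real.exp_nat_mul]
  rw [Nat.add_sub_cancel]
  have h0 : (0 : ℝ) < ((t + 1 : ℕ) : ℝ) := by positivity
  rw [← Real.log_le_iff_le_exp h0]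
  push_cast at h ⊢
  linarith

theorem growth_le {t : ℕ} (ht : 1 ≤ t) : growth t ≤ 2 * √(t : ℝ) := by
  obtain ⟨t, rfl⟩ := Nat.exists_eq_add_of_le' ht
  have h := harmonic_le_one_add_log (t + 1)
  have h0 : (0 : ℝ) < ((t + 1 : ℕ) : ℝ) := by positivity
  have h2 : (harmonic t : ℝ) ≤ harmonic (t + 1) := by
    rw [harmonic_succ]
    push_cast
    have : (0 : ℝ) ≤ ((t : ℝ) + 1)⁻¹ := by positivity
    linarith
  unfold growth
  rw [Nat.add_sub_cancel]
  have h3 : (2 : ℝ) * √((t + 1 : ℕ) : ℝ) = √(4 * ((t + 1 : ℕ) : ℝ)) := by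
    rw [Real.sqrt_mul (by norm_num), show (4 : ℝ) = 2 ^ 2 by norm_num, Real.sqrt_sq (by norm_num)]
  rw [h3]
  apply Real.le_sqrt_of_sq_le
  rw [← Real.exp_nat_mul]
  calc Real.exp (((2 : ℕ) : ℝ) * ((harmonic t : ℝ) / 2))
      ≤ Real.exp (1 + Real.log ((t + 1 : ℕ) : ℝ)) := by
        apply Real.exp_le_exp.2
        push_cast at h h2 ⊢
        linarith
    _ = Real.exp 1 * ((t + 1 : ℕ) : ℝ) := by rw [Real.exp_add, Real.exp_log h0]
    _ ≤ 4 * ((t + 1 : ℕ) : ℝ) := by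
        have := Real.exp_one_lt_d9
        gcongr
        linarith

/-! ### Probability that a given set of edges is present -/

/-- The number of edges of `F` towards `x` whose source has not arrived among the first `n`
nodes. -/
def pending (F : Finset (ℕ × ℕ)) (n x : ℕ) : ℕ := (F.filter fun p => n ≤ p.1 ∧ p.2 = x).card

/-- The indicator that the edges of `F` due by time `n` are present, times the rising factorials
of the degrees prescribed by the pending edges. -/
noncomputable def edgePotential (F : Finset (ℕ × ℕ)) (n : ℕ) (E : EdgeList ℕ) : ℝ≥0∞ :=
  ind (∀ p ∈ F, p.1 < n → p ∈ E) * (riseProd n (pending F n) E : ℝ≥0∞)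

/-- The contribution of one edge to the bound on the expected potential. -/
noncomputable def edgeFactor (B c : ℝ) (n : ℕ) (p : ℕ × ℕ) : ℝ :=
  (if p.2 < n then B * growth (min n p.1) / growth (p.2 + 1) else 1) *
    (if p.1 < n then c / p.1 else 1)

/-- The ratio of consecutive edge factors. -/
noncomputable def edgeRatio (B c : ℝ) (n : ℕ) (p : ℕ × ℕ) : ℝ :=
  (if p.1 = n then c / n else 1) * (if n + 1 ≤ p.1 ∧ p.2 < n then Real.exp (1 / (2 * (n : ℝ))) else 1)
    * (if n + 1 ≤ p.1 ∧ p.2 = n then B else 1)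

/-- The factor of an edge changes when its target arrives (`B`), at every arrival strictly between
target and source (growth), and when its source arrives (`c / n`). These are the three factors of
`edgeRatio`. -/
theorem edgeFactor_succ {B c : ℝ} {n : ℕ} (hn : 1 ≤ n) {p : ℕ × ℕ} (hp : p.2 < p.1) :
    edgeFactor B c (n + 1) p = edgeFactor B c n p * edgeRatio B c n p := by
  obtain ⟨t, x⟩ := p
  simp only at hp
  unfold edgeFactor edgeRatio
  simp only
  have hg := (growth_pos (x + 1)).ne'
  rcases lt_trichotomy t n with h | rfl | h
  · have e1 : min (n + 1) t = t := by omega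
    have e2 : min n t = t := by omega
    rw [e1, e2]
    simp [show x < n + 1 by omega, show x < n by omega, show t < n + 1 by omega, h,
      show t ≠ n by omega, show ¬ (n + 1 ≤ t) by omega]
  · have e1 : min (t + 1) t = t := by omega
    rw [e1]
    simp [show x < t + 1 by omega, hp]
  · have e1 : min (n + 1) t = n + 1 := by omega
    have e2 : min n t = n := by omega
    rw [e1, e2]
    rcases lt_trichotomy x n with h' | rfl | h'
    · simp only [show x < n + 1 by omega, h', show ¬ (t < n + 1) by omega,
        show t ≠ n by omega, show n + 1 ≤ t by omega, show ¬ (t < n) by omega, show x ≠ n by omega,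
        if_true, if_false, true_and, and_false, mul_one, one_mul, growth_succ hn]
      field_simp
    · simp only [show x < x + 1 by omega, lt_irrefl, show ¬ (t < x + 1) by omega,
        show t ≠ x by omega, show x + 1 ≤ t by omega, show ¬ (t < x) by omega,
        if_true, if_false, true_and, and_false, mul_one, one_mul]
      field_simp
    · simp [show ¬ (x < n + 1) by omega, show ¬ (x < n) by omega, show ¬ (t < n + 1) by omega,
        show ¬ (t < n) by omega, show t ≠ n by omega, show x ≠ n by omega]

theorem ascFactorial_le_pow (n k : ℕ) : n.ascFactorial k ≤ (n + k) ^ k := by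
  induction k with
  | zero => simp
  | succ k ih =>
    rw [Nat.ascFactorial_succ, pow_succ, mul_comm]
    refine Nat.mul_le_mul (ih.trans (Nat.pow_le_pow_left (by omega) _)) (by omega)

/-- Targets are not younger than sources, so every edge touching the youngest node was issued by it.
-/
theorem IsGrown.degree_last_le {m n : ℕ} {E : EdgeList ℕ} (h : IsGrown m (n + 1) E) :
    degree E n ≤ 2 * m := by
  have h1 : E.countP (fun e => e.2 = n) ≤ E.countP (fun e => e.1 = n) := by
    apply List.countP_mono_left
    intro e he
    simp only [decide_eq_true_eq]
    intro h2
    have := h.target_le e he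
    have := h.source_lt e he
    omega
  have h2 := h.count_source n (by omega)
  unfold degree
  omega

/-- The targets of the edges of `F` with source `n`. -/
def targetsAt (F : Finset (ℕ × ℕ)) (n : ℕ) : Finset ℕ := (F.filter fun p => p.1 = n).image Prod.snd

theorem mem_targetsAt {F : Finset (ℕ × ℕ)} {n x : ℕ} : x ∈ targetsAt F n ↔ (n, x) ∈ F := by
  unfold targetsAt
  simp

theorem card_targetsAt (F : Finset (ℕ × ℕ)) (n : ℕ) :
    (targetsAt F n).card = (F.filter fun p => p.1 = n).card := by
  apply Finset.card_image_of_injOn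
  intro p hp q hq hpq
  simp only [Finset.coe_filter, Set.mem_ofPred_eq] at hp hq
  exact Prod.ext (hp.2.trans hq.2.symm) hpq

/-- When `n` arrives, its edges cease to be pending. As `F` is a set, each of their targets loses
exactly one unit of exponent. -/
theorem pending_eq_raise (F : Finset (ℕ × ℕ)) (n : ℕ) :
    pending F n = raise (pending F (n + 1)) (targetsAt F n) := by
  ext x
  unfold pending raise
  have h1 : F.filter (fun p => n ≤ p.1 ∧ p.2 = x) =
      F.filter (fun p => n + 1 ≤ p.1 ∧ p.2 = x) ∪ F.filter (fun p => p = (n, x)) := by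
    ext ⟨t, y⟩
    simp only [Finset.mem_filter, Finset.mem_union, Prod.mk.injEq]
    constructor
    · rintro ⟨h, h1, h2⟩
      rcases h1.eq_or_lt with h3 | h3
      · exact Or.inr ⟨h, h3.symm, h2⟩
      · exact Or.inl ⟨h, h3, h2⟩
    · rintro (⟨h, h1, h2⟩ | ⟨h, h1, h2⟩)
      · exact ⟨h, by omega, h2⟩
      · exact ⟨h, by omega, h2⟩
  have h2 : Disjoint (F.filter (fun p => n + 1 ≤ p.1 ∧ p.2 = x)) (F.filter (fun p => p = (n, x))) := by
    rw [Finset.disjoint_filter]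
    rintro p - hp rfl
    simp at hp
  rw [h1, Finset.card_union_of_disjoint h2]
  congr 1
  rw [Finset.filter_eq']
  simp only [mem_targetsAt]
  split_ifs <;> simp

theorem sum_pending (F : Finset (ℕ × ℕ)) (n u : ℕ) :
    ∑ x ∈ Finset.range u, pending F n x = (F.filter fun p => n ≤ p.1 ∧ p.2 < u).card := by
  unfold pending
  rw [Finset.card_eq_sum_card_fiberwise (f := Prod.snd) (t := Finset.range u)]
  · refine Finset.sum_congr rfl fun x hx => ?_
    rw [Finset.mem_range] at hx
    congr 1
    ext p
    simp only [Finset.mem_filter]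
    constructor
    · rintro ⟨a, b, rfl⟩; exact ⟨⟨a, b, hx⟩, rfl⟩
    · rintro ⟨⟨a, b, _⟩, c⟩; exact ⟨a, b, c⟩
  · intro p hp
    simp only [Finset.coe_filter, Set.mem_ofPred_eq] at hp
    simpa using hp.2.2

theorem prod_edgeRatio (F : Finset (ℕ × ℕ)) (B c : ℝ) (n : ℕ) :
    ∏ p ∈ F, edgeRatio B c n p = (c / n) ^ (targetsAt F n).card *
      Real.exp (1 / (2 * (n : ℝ))) ^ (∑ x ∈ Finset.range n, pending F (n + 1) x) *
      B ^ pending F (n + 1) n := by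
  unfold edgeRatio
  rw [Finset.prod_mul_distrib, Finset.prod_mul_distrib, ← Finset.prod_filter, ← Finset.prod_filter,
    ← Finset.prod_filter, Finset.prod_const, Finset.prod_const, Finset.prod_const, card_targetsAt,
    sum_pending]
  rfl

/-- `Ex_addEdgesN_hit` pays for the edges of `F` issued by `n`. The new rising factorial, that of
`n` itself, is bounded by a constant power because the degree of `n` is at most `2 m`. -/
theorem Ex_edgePotential_step {m n : ℕ} {F : Finset (ℕ × ℕ)}
    (hF : ∀ p ∈ F, p.2 < p.1) {E : EdgeList ℕ} (hE : IsGrown m n E) {β Q : ℝ≥0∞}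
    (hQ : Q = ((2 * (m * n) + 1 : ℕ) : ℝ≥0∞)⁻¹)
    (hβ : 1 + ((∑ x ∈ Finset.range n, pending F (n + 1) x + (targetsAt F n).card : ℕ) : ℝ≥0∞) * Q
      + ((targetsAt F n).card : ℝ≥0∞) ≤ β) :
    Ex (addEdgesN n m E) (edgePotential F (n + 1)) ≤
      ((2 * m + F.card : ℕ) : ℝ≥0∞) ^ pending F (n + 1) n *
        (edgePotential F n E * Q ^ (targetsAt F n).card * β ^ m) := by
  set H := targetsAt F n with hH
  have hHn : H ⊆ Finset.range n := by
    intro x hx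
    rw [Finset.mem_range]
    exact hF _ (mem_targetsAt.1 hx)
  have hEn : ∀ x ∈ H, (n, x) ∉ E := fun x _ hcon => lt_irrefl _ (hE.source_lt _ hcon)
  have hmain := Ex_addEdgesN_hit (pending F (n + 1)) hQ hβ m H hHn le_rfl E hE.length_eq.ge hEn
  rw [← pending_eq_raise] at hmain
  have hpt : ∀ E' ∈ (addEdgesN n m E).support, edgePotential F (n + 1) E' ≤
      ((2 * m + F.card : ℕ) : ℝ≥0∞) ^ pending F (n + 1) n * ind (∀ p ∈ F, p.1 < n → p ∈ E) *
        (ind (∀ x ∈ H, (n, x) ∈ E') * (riseProd n (pending F (n + 1)) E' : ℝ≥0∞)) := by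
    intro E' hE'
    have hG := hE.addEdgesN hE'
    obtain ⟨A, rfl, -, hA⟩ := mem_support_addEdgesN hE'
    unfold edgePotential
    have h1 : ind (∀ p ∈ F, p.1 < n + 1 → p ∈ A ++ E) ≤
        ind (∀ p ∈ F, p.1 < n → p ∈ E) * ind (∀ x ∈ H, (n, x) ∈ A ++ E) := by
      rw [← ind_and]
      refine ind_mono fun h => ⟨fun p hp hpn => ?_, fun x hx => ?_⟩
      · rcases List.mem_append.1 (h p hp (by omega)) with h2 | h2
        · have := (hA p h2).1
          omega
        · exact h2
      · exact h _ (mem_targetsAt.1 hx) (by simp)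
    have h2 : riseProd (n + 1) (pending F (n + 1)) (A ++ E) ≤
        (2 * m + F.card) ^ pending F (n + 1) n * riseProd n (pending F (n + 1)) (A ++ E) := by
      unfold riseProd
      rw [Finset.prod_range_succ, mul_comm]
      gcongr
      refine (ascFactorial_le_pow _ _).trans (Nat.pow_le_pow_left ?_ _)
      refine Nat.add_le_add hG.degree_last_le (Finset.card_filter_le _ _)
    calc _ ≤ (ind (∀ p ∈ F, p.1 < n → p ∈ E) * ind (∀ x ∈ H, (n, x) ∈ A ++ E)) *
          (((2 * m + F.card) ^ pending F (n + 1) n * riseProd n (pending F (n + 1)) (A ++ E) : ℕ)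
            : ℝ≥0∞) := by
          gcongr
      _ = _ := by push_cast; ring
  refine (Ex_mono_support hpt).trans ?_
  rw [Ex_const_mul]
  refine (mul_le_mul_right hmain _).trans (le_of_eq ?_)
  unfold edgePotential
  ring

/-- The constant by which a prescribed edge may exceed its typical probability. -/
noncomputable def edgeConst (m : ℕ) (F : Finset (ℕ × ℕ)) : ℝ := (1 + 2 * (F.card : ℝ)) ^ m

theorem one_le_edgeConst (m : ℕ) (F : Finset (ℕ × ℕ)) : 1 ≤ edgeConst m F :=
  one_le_pow₀ (by linarith [(Nat.cast_nonneg F.card : (0 : ℝ) ≤ F.card)])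

theorem edgeFactor_pos {B c : ℝ} (hB : 0 < B) (hc : 0 < c) (n : ℕ) {p : ℕ × ℕ} (hp : p.2 < p.1) :
    0 < edgeFactor B c n p := by
  unfold edgeFactor
  have h1 := growth_pos (min n p.1)
  have h2 := growth_pos (p.2 + 1)
  have h3 : (0 : ℝ) < p.1 := by exact_mod_cast (by omega : 0 < p.1)
  split_ifs <;> positivity

/-- The expected potential of a set of prescribed edges. -/
theorem Ex_edgePotential_le {m : ℕ} (hm : 1 ≤ m) {F : Finset (ℕ × ℕ)}
    (hF : ∀ p ∈ F, p.2 < p.1) {n : ℕ} (hn : 1 ≤ n) :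
    Ex (natGraph m n) (edgePotential F n) ≤
      ENNReal.ofReal (∏ p ∈ F, edgeFactor ((2 * m + F.card : ℕ) : ℝ) (edgeConst m F) n p) := by
  set B : ℝ := ((2 * m + F.card : ℕ) : ℝ) with hB
  set c := edgeConst m F with hc
  have hB1 : 1 ≤ B := by rw [hB]; exact_mod_cast (by omega : 1 ≤ 2 * m + F.card)
  have hc1 : 1 ≤ c := one_le_edgeConst m F
  induction n, hn using Nat.le_induction with
  | base =>
    rw [Ex_natGraph_one]
    unfold edgePotential
    have h1 : riseProd 1 (pending F 1) (List.replicate m (0, 0)) ≤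
        (2 * m + F.card) ^ pending F 1 0 := by
      unfold riseProd
      rw [Finset.prod_range_one]
      refine (ascFactorial_le_pow _ _).trans (Nat.pow_le_pow_left ?_ _)
      refine Nat.add_le_add ?_ (Finset.card_filter_le _ _)
      unfold degree
      simp [List.countP_replicate]
      omega
    have h2 : ∏ p ∈ F, edgeFactor B c 1 p = B ^ pending F 1 0 := by
      have h3 : ∀ p ∈ F, edgeFactor B c 1 p = if 1 ≤ p.1 ∧ p.2 = 0 then B else 1 := by
        intro p hp
        have hp' := hF p hp
        unfold edgeFactor
        have e1 : min 1 p.1 = 1 := by omega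
        rw [if_neg (show ¬ p.1 < 1 by omega), mul_one, e1]
        by_cases hp0 : p.2 = 0
        · have := (growth_pos 1).ne'
          rw [if_pos (by omega), if_pos ⟨by omega, hp0⟩, hp0, zero_add]
          field_simp
        · rw [if_neg (by omega), if_neg (by tauto)]
      rw [Finset.prod_congr rfl h3, ← Finset.prod_filter, Finset.prod_const]
      rfl
    rw [h2, ENNReal.ofReal_pow (by linarith), hB, ENNReal.ofReal_natCast]
    calc _ ≤ 1 * ((riseProd 1 (pending F 1) (List.replicate m (0, 0)) : ℕ) : ℝ≥0∞) := by
          gcongr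
          exact ind_le_one _
      _ ≤ _ := by
          rw [one_mul]
          exact_mod_cast h1
  | succ n hn ih =>
    rw [Ex_natGraph_succ m hn]
    set H := targetsAt F n with hH
    set K := ∑ x ∈ Finset.range n, pending F (n + 1) x with hK
    have hn0 : (0 : ℝ) < n := by exact_mod_cast hn
    have hm0 : (0 : ℝ) < m := by exact_mod_cast hm
    set q : ℝ := ((2 * (m * n) + 1 : ℕ) : ℝ)⁻¹ with hq
    have hq0 : 0 < q := by positivity
    set b : ℝ := 1 + ((K + H.card : ℕ) : ℝ) * q + (H.card : ℝ) with hb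
    have hb0 : 0 < b := by positivity
    have hstep : ∀ E ∈ (natGraph m n).support, Ex (addEdgesN n m E) (edgePotential F (n + 1)) ≤
        edgePotential F n E * ENNReal.ofReal (B ^ pending F (n + 1) n * q ^ H.card * b ^ m) := by
      intro E hE
      refine (Ex_edgePotential_step (β := ENNReal.ofReal b) (Q := ENNReal.ofReal q) hF
        (isGrown_of_mem_support hn hE) ?_ ?_).trans (le_of_eq ?_)
      · rw [hq, ENNReal.ofReal_inv_of_pos (by positivity), ENNReal.ofReal_natCast]
      · rw [hb, ENNReal.ofReal_add (by positivity) (by positivity),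
          ENNReal.ofReal_add (by positivity) (by positivity), ENNReal.ofReal_mul (by positivity),
          ENNReal.ofReal_natCast, ENNReal.ofReal_natCast, ENNReal.ofReal_one]
      · rw [ENNReal.ofReal_mul (by positivity), ENNReal.ofReal_mul (by positivity),
          ENNReal.ofReal_pow (by positivity), ENNReal.ofReal_pow (by positivity),
          ENNReal.ofReal_pow (by positivity), hB, ENNReal.ofReal_natCast]
        ring
    refine (Ex_mono_support hstep).trans ?_
    rw [Ex_mul_const]
    refine (mul_le_mul_left ih _).trans ?_
    have hpos : 0 ≤ ∏ p ∈ F, edgeFactor B c n p :=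
      Finset.prod_nonneg fun p hp => (edgeFactor_pos (by linarith) (by linarith) n (hF p hp)).le
    rw [← ENNReal.ofReal_mul hpos]
    apply ENNReal.ofReal_le_ofReal
    rw [Finset.prod_congr rfl fun p hp => edgeFactor_succ (B := B) (c := c) hn (hF p hp),
      Finset.prod_mul_distrib, prod_edgeRatio]
    gcongr ?_ * ?_
    have hkey : q ^ H.card * b ^ m ≤ (c / n) ^ H.card * Real.exp (1 / (2 * (n : ℝ))) ^ K := by
      -- Steps without prescribed edges occur at almost all times and must grow at the sharp rate. A
      -- step with prescribed edges may lose the constant `c`, which is charged to those edges.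
      rcases Nat.eq_zero_or_pos H.card with h0 | h0
      · rw [hb, h0, pow_zero, pow_zero, one_mul, one_mul, add_zero, Nat.cast_zero, add_zero]
        have h1 : 1 + (K : ℝ) * q ≤ Real.exp ((K : ℝ) * q) := by
          rw [add_comm]; exact Real.add_one_le_exp _
        calc (1 + (K : ℝ) * q) ^ m ≤ Real.exp ((K : ℝ) * q) ^ m := by gcongr
          _ = Real.exp ((K : ℝ) * (m * q)) := by rw [← Real.exp_nat_mul]; congr 1; ring
          _ ≤ Real.exp ((K : ℝ) * (1 / (2 * n))) := by
              gcongr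
              rw [hq, ← div_eq_mul_inv, div_le_div_iff₀ (by positivity) (by positivity)]
              push_cast
              nlinarith
          _ = _ := by rw [← Real.exp_nat_mul]
      · have hHF : H.card ≤ F.card := by rw [hH, card_targetsAt]; exact Finset.card_filter_le _ _
        have hKF : K + H.card ≤ 2 * F.card := by
          rw [hK, sum_pending]
          have := Finset.card_filter_le F (fun p => n + 1 ≤ p.1 ∧ p.2 < n)
          omega
        have hKH : K + H.card ≤ F.card := by
          rw [hK, sum_pending, hH, card_targetsAt, ← Finset.card_union_of_disjoint]
          · exact Finset.card_le_card (Finset.union_subset (Finset.filter_subset _ _)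
              (Finset.filter_subset _ _))
          · rw [Finset.disjoint_filter]
            rintro p - h1 h2
            omega
        have hq1 : q ≤ 1 / n := by
          rw [hq, ← one_div]
          apply one_div_le_one_div_of_le hn0
          exact_mod_cast (by nlinarith : n ≤ 2 * (m * n) + 1)
        have hq2 : q ≤ 1 := by
          rw [hq]
          apply inv_le_one_of_one_le₀
          exact_mod_cast (by omega : 1 ≤ 2 * (m * n) + 1)
        have hbc : b ^ m ≤ c := by
          rw [hc, edgeConst]
          gcongr
          have h1 : ((K + H.card : ℕ) : ℝ) ≤ F.card := by exact_mod_cast hKH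
          have h2 : (H.card : ℝ) ≤ F.card := by exact_mod_cast hHF
          rw [hb]
          nlinarith
        have hcc : c ≤ c ^ H.card := le_self_pow₀ hc1 (by omega)
        have he : 1 ≤ Real.exp (1 / (2 * (n : ℝ))) ^ K :=
          one_le_pow₀ (Real.one_le_exp (by positivity))
        calc q ^ H.card * b ^ m ≤ (1 / n) ^ H.card * c ^ H.card := by
              gcongr
              exact hbc.trans hcc
          _ = (c / n) ^ H.card * 1 := by rw [← mul_pow, mul_one]; congr 1; ring
          _ ≤ _ := by gcongr
    calc B ^ pending F (n + 1) n * q ^ H.card * b ^ m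
        = (q ^ H.card * b ^ m) * B ^ pending F (n + 1) n := by ring
      _ ≤ _ := by gcongr

/-- The constant in the bound on the probability that `k` prescribed edges are present. -/
noncomputable def edgeBound (m k : ℕ) : ℝ := 4 * ((2 * m + k : ℕ) : ℝ) * (1 + 2 * (k : ℝ)) ^ m

/-- Once both ends have arrived the factor is `B c · growth t / (t · growth (x + 1))`, and `growth`
is of the order of the square root. The `4` in `edgeBound` pays for `growth t ≤ 2√t` and `√(t+1) ≤
2√t`. -/
theorem edgeFactor_le {m : ℕ} {F : Finset (ℕ × ℕ)} {n : ℕ} {p : ℕ × ℕ} (hp : p.2 < p.1)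
    (hpn : p.1 < n) :
    edgeFactor ((2 * m + F.card : ℕ) : ℝ) (edgeConst m F) n p ≤
      edgeBound m F.card / (√((p.1 : ℝ) + 1) * √((p.2 : ℝ) + 1)) := by
  obtain ⟨t, x⟩ := p
  simp only at hp hpn ⊢
  unfold edgeFactor
  simp only
  rw [if_pos (by omega), if_pos hpn, show min n t = t by omega]
  have ht : 1 ≤ t := by omega
  have ht0 : (0 : ℝ) < t := by exact_mod_cast ht
  have hx := sqrt_le_growth (t := x + 1) (by omega)
  have hx0 : 0 < √(((x + 1 : ℕ)) : ℝ) := Real.sqrt_pos.2 (by positivity)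
  have hst : 0 < √(t : ℝ) := Real.sqrt_pos.2 ht0
  have hB : (0 : ℝ) ≤ ((2 * m + F.card : ℕ) : ℝ) := Nat.cast_nonneg _
  have hc : 0 ≤ edgeConst m F := zero_le_one.trans (one_le_edgeConst m F)
  have hs : √((t : ℝ) + 1) ≤ 2 * √(t : ℝ) := by
    rw [Real.sqrt_le_left (by positivity), mul_pow, Real.sq_sqrt ht0.le]
    have : (1 : ℝ) ≤ t := by exact_mod_cast ht
    linarith
  have hs0 : 0 < √((t : ℝ) + 1) := Real.sqrt_pos.2 (by positivity)
  have hsq : √(t : ℝ) * √(t : ℝ) = t := Real.mul_self_sqrt ht0.le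
  calc ((2 * m + F.card : ℕ) : ℝ) * growth t / growth (x + 1) * (edgeConst m F / t)
      ≤ ((2 * m + F.card : ℕ) : ℝ) * (2 * √(t : ℝ)) / √(((x + 1 : ℕ)) : ℝ) * (edgeConst m F / t) := by
        gcongr
        exact growth_le ht
    _ = 2 * ((2 * m + F.card : ℕ) : ℝ) * edgeConst m F / √(((x + 1 : ℕ)) : ℝ) / √(t : ℝ) := by
        rw [div_mul_div_comm, div_div, div_eq_div_iff (by positivity) (by positivity)]
        linear_combination (2 * ((2 * m + F.card : ℕ) : ℝ) * edgeConst m F *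
          √(((x + 1 : ℕ)) : ℝ)) * hsq
    _ ≤ 2 * ((2 * m + F.card : ℕ) : ℝ) * edgeConst m F / √(((x + 1 : ℕ)) : ℝ)
          / (√((t : ℝ) + 1) / 2) := by
        gcongr
        linarith
    _ = edgeBound m F.card / (√((t : ℝ) + 1) * √((x : ℝ) + 1)) := by
        unfold edgeBound edgeConst
        push_cast
        field_simp
        ring

/-- At time `n` nothing in `F` is pending, so the potential is the bare indicator. -/
theorem Ex_forall_mem_le {m : ℕ} (hm : 1 ≤ m) {F : Finset (ℕ × ℕ)} {n : ℕ} (hn : 1 ≤ n)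
    (hF : ∀ p ∈ F, p.2 < p.1) (hFn : ∀ p ∈ F, p.1 < n) :
    Ex (natGraph m n) (fun E => ind (∀ p ∈ F, p ∈ E)) ≤
      ENNReal.ofReal (∏ p ∈ F, edgeBound m F.card / (√((p.1 : ℝ) + 1) * √((p.2 : ℝ) + 1))) := by
  have h1 : ∀ E, ind (∀ p ∈ F, p ∈ E) = edgePotential F n E := by
    intro E
    unfold edgePotential riseProd
    have h2 : ∀ x, pending F n x = 0 := by
      intro x
      unfold pending
      rw [Finset.card_eq_zero, Finset.filter_eq_empty_iff]
      rintro p hp ⟨h, -⟩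
      have := hFn p hp
      omega
    simp only [h2, Nat.ascFactorial_zero, Finset.prod_const_one, Nat.cast_one, mul_one]
    congr 1
    refine propext ⟨fun h p hp _ => h p hp, fun h p hp => h p hp (hFn p hp)⟩
  simp only [h1]
  refine (Ex_edgePotential_le hm hF hn).trans (ENNReal.ofReal_le_ofReal ?_)
  refine Finset.prod_le_prod (fun p hp => ?_) fun p hp => edgeFactor_le (hF p hp) (hFn p hp)
  exact (edgeFactor_pos (by exact_mod_cast (by omega : 0 < 2 * m + F.card))
    (zero_lt_one.trans_le (one_le_edgeConst m F)) n (hF p hp)).le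

/-! ### Degree moments -/

theorem pow_le_ascFactorial (n k : ℕ) : n ^ k ≤ n.ascFactorial k := by
  induction k with
  | zero => simp
  | succ k ih =>
    rw [Nat.ascFactorial_succ, pow_succ, mul_comm]
    exact Nat.mul_le_mul (by omega) ih

/-- Moments of the degree of a node. -/
theorem Ex_degree_pow_le {m : ℕ} (hm : 1 ≤ m) (k : ℕ) {n x : ℕ} (hx : x < n) :
    Ex (natGraph m n) (fun E => (degree E x : ℝ≥0∞) ^ k) ≤
      ENNReal.ofReal ((2 * ((2 * m + k : ℕ) : ℝ) * √((n : ℝ) / ((x : ℝ) + 1))) ^ k) := by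
  -- Fictitious edges due after time `n`: they never have to appear, and while pending they turn the
  -- potential into the `k`-th rising factorial of the degree of `x`.
  set F : Finset (ℕ × ℕ) := (Finset.range k).image fun i => (n + i, x) with hF
  have hinj : Function.Injective fun i : ℕ => (n + i, x) := by
    intro i j hij
    simpa using hij
  have hcard : F.card = k := by
    rw [hF, Finset.card_image_of_injective _ hinj, Finset.card_range]
  have hFlt : ∀ p ∈ F, p.2 < p.1 := by
    intro p hp
    simp only [hF, Finset.mem_image] at hp
    obtain ⟨i, -, rfl⟩ := hp
    simp only
    omega
  have h1 : ∀ E, (degree E x : ℝ≥0∞) ^ k ≤ edgePotential F n E := by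
    intro E
    unfold edgePotential
    rw [ind_true, one_mul]
    · have hp : pending F n x = k := by
        rw [← hcard]
        unfold pending
        congr 1
        rw [Finset.filter_eq_self]
        intro p hp
        simp only [hF, Finset.mem_image] at hp
        obtain ⟨i, -, rfl⟩ := hp
        simp
      have hp' : ∀ y, y ≠ x → pending F n y = 0 := by
        intro y hy
        unfold pending
        rw [Finset.card_eq_zero, Finset.filter_eq_empty_iff]
        intro p hp
        simp only [hF, Finset.mem_image] at hp
        obtain ⟨i, -, rfl⟩ := hp
        simp [Ne.symm hy]
      have hr : riseProd n (pending F n) E = (degree E x).ascFactorial k := by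
        unfold riseProd
        rw [Finset.prod_eq_single_of_mem x (Finset.mem_range.2 hx), hp]
        intro y _ hy
        rw [hp' y hy, Nat.ascFactorial_zero]
      rw [hr]
      exact_mod_cast pow_le_ascFactorial _ _
    · intro p hp hpn
      simp only [hF, Finset.mem_image] at hp
      obtain ⟨i, -, rfl⟩ := hp
      simp only at hpn
      omega
  refine (Ex_mono h1).trans ((Ex_edgePotential_le hm hFlt (by omega)).trans
    (ENNReal.ofReal_le_ofReal ?_))
  rw [hF, Finset.prod_image fun i _ j _ h => hinj h, ← hF, hcard]
  have h2 : ∀ i ∈ Finset.range k, edgeFactor ((2 * m + k : ℕ) : ℝ) (edgeConst m F) n (n + i, x) ≤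
      2 * ((2 * m + k : ℕ) : ℝ) * √((n : ℝ) / ((x : ℝ) + 1)) := by
    intro i _
    unfold edgeFactor
    simp only
    rw [if_pos hx, if_neg (by omega), mul_one, show min n (n + i) = n by omega]
    have h3 := sqrt_le_growth (t := x + 1) (by omega)
    have h4 : 0 < √(((x + 1 : ℕ)) : ℝ) := Real.sqrt_pos.2 (by positivity)
    calc ((2 * m + k : ℕ) : ℝ) * growth n / growth (x + 1)
        ≤ ((2 * m + k : ℕ) : ℝ) * (2 * √(n : ℝ)) / √(((x + 1 : ℕ)) : ℝ) := by
          gcongr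
          exact growth_le (by omega)
      _ = _ := by
          rw [Real.sqrt_div (Nat.cast_nonneg n)]
          push_cast
          ring
  calc ∏ i ∈ Finset.range k, edgeFactor ((2 * m + k : ℕ) : ℝ) (edgeConst m F) n (n + i, x)
      ≤ ∏ _i ∈ Finset.range k, 2 * ((2 * m + k : ℕ) : ℝ) * √((n : ℝ) / ((x : ℝ) + 1)) := by
        refine Finset.prod_le_prod (fun i _ => ?_) h2
        exact (edgeFactor_pos (by exact_mod_cast (by omega : 0 < 2 * m + k))
          (zero_lt_one.trans_le (one_le_edgeConst m F)) n (show x < n + i by omega)).le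
    _ = _ := by rw [Finset.prod_const, Finset.card_range]

/-! ### Common neighbours -/

/-- Adjacency in a multigraph on `ℕ`. -/
def Adj (E : EdgeList ℕ) (a b : ℕ) : Prop := (a, b) ∈ E ∨ (b, a) ∈ E

theorem IsGrown.mem_of_adj {m n : ℕ} {E : EdgeList ℕ} (h : IsGrown m n E) {a b : ℕ}
    (hab : Adj E a b) : (max a b, min a b) ∈ E := by
  rcases hab with h1 | h1
  · have := h.target_le _ h1
    simp only at this
    rwa [max_eq_left this, min_eq_right this]
  · have := h.target_le _ h1
    simp only at this
    rwa [max_eq_right this, min_eq_left this]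

instance (E : EdgeList ℕ) (a b : ℕ) : Decidable (Adj E a b) :=
  inferInstanceAs (Decidable (_ ∨ _))

/-- The common neighbours of `u` and `v` among the first `n` nodes, other than `u` and `v`. -/
def commonNbrs (n : ℕ) (E : EdgeList ℕ) (u v : ℕ) : Finset ℕ :=
  (((Finset.range n).erase u).erase v).filter fun a => Adj E a u ∧ Adj E a v

/-- Every product over a `k`-set occurs in the expansion of the power, whose other terms are
nonnegative. -/
theorem sum_powersetCard_prod_le {ι : Type} [DecidableEq ι] (w : ι → ℝ) (hw : ∀ a, 0 ≤ w a)
    (k : ℕ) (s : Finset ι) :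
    ∑ A ∈ s.powersetCard k, ∏ a ∈ A, w a ≤ (∑ a ∈ s, w a) ^ k := by
  induction s using Finset.induction_on generalizing k with
  | empty =>
    cases k with
    | zero => simp
    | succ k => rw [Finset.powersetCard_eq_empty.2 (by simp)]; simp
  | insert a s ha ih =>
    cases k with
    | zero => simp
    | succ k =>
      rw [Finset.powersetCard_succ_insert ha, Finset.sum_union, Finset.sum_image, Finset.sum_insert ha]
      · have h1 : ∀ A ∈ s.powersetCard k, ∏ b ∈ insert a A, w b = w a * ∏ b ∈ A, w b := by
          intro A hA
          rw [Finset.prod_insert fun h => ha ((Finset.mem_powersetCard.1 hA).1 h)]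
        rw [Finset.sum_congr rfl h1, ← Finset.mul_sum]
        have hs : 0 ≤ ∑ b ∈ s, w b := Finset.sum_nonneg fun b _ => hw b
        have h2 := ih (k + 1)
        have h3 := ih k
        have h4 : (∑ b ∈ s, w b) ^ k ≤ (w a + ∑ b ∈ s, w b) ^ k := by
          gcongr
          linarith [hw a]
        calc _ ≤ (∑ b ∈ s, w b) ^ (k + 1) + w a * (∑ b ∈ s, w b) ^ k := by
              gcongr
              exact hw a
          _ = (∑ b ∈ s, w b) ^ k * (w a + ∑ b ∈ s, w b) := by ring
          _ ≤ (w a + ∑ b ∈ s, w b) ^ k * (w a + ∑ b ∈ s, w b) := by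
              have := hw a
              gcongr
          _ = _ := by ring
      · intro A hA B hB hAB
        rw [Finset.mem_coe, Finset.mem_powersetCard] at hA hB
        rw [← Finset.erase_insert (fun h => ha (hA.1 h)), hAB,
          Finset.erase_insert (fun h => ha (hB.1 h))]
      · rw [Finset.disjoint_left]
        intro A hA hA'
        rw [Finset.mem_image] at hA'
        obtain ⟨B, -, rfl⟩ := hA'
        exact ha ((Finset.mem_powersetCard.1 hA).1 (Finset.mem_insert_self _ _))

/-- As `A` avoids both nodes, the edges joining it to `u` and to `v` are `2 |A|` distinct prescribed
edges. Each `a` lies on two of them, which makes its square roots combine to `a + 1`. -/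
theorem Ex_subset_commonNbrs_le {m : ℕ} (hm : 1 ≤ m) {n u v : ℕ} (hu : u < n) (hv : v < n)
    (huv : u ≠ v) {A : Finset ℕ} (hA : A ⊆ ((Finset.range n).erase u).erase v) :
    Ex (natGraph m n) (fun E => ind (A ⊆ commonNbrs n E u v)) ≤
      ENNReal.ofReal (∏ a ∈ A, edgeBound m (2 * A.card) ^ 2 /
        (((a : ℝ) + 1) * (√((u : ℝ) + 1) * √((v : ℝ) + 1)))) := by
  have hA' : ∀ a ∈ A, a ≠ v ∧ a ≠ u ∧ a < n := by
    intro a ha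
    have := hA ha
    rw [Finset.mem_erase, Finset.mem_erase, Finset.mem_range] at this
    exact this
  set f : ℕ → ℕ → ℕ × ℕ := fun w a => (max a w, min a w) with hf
  have hinj : ∀ w, Set.InjOn (f w) (A : Set ℕ) := by
    intro w a _ b _ hab
    simp only [hf, Prod.mk.injEq] at hab
    omega
  have hdisj : Disjoint (A.image (f u)) (A.image (f v)) := by
    rw [Finset.disjoint_left]
    intro p hp hp'
    rw [Finset.mem_image] at hp hp'
    obtain ⟨a, ha, rfl⟩ := hp
    obtain ⟨b, hb, hab⟩ := hp'
    have h1 := hA' a ha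
    have h2 := hA' b hb
    simp only [hf, Prod.mk.injEq] at hab
    omega
  set F := A.image (f u) ∪ A.image (f v) with hF
  have hcard : F.card = 2 * A.card := by
    rw [hF, Finset.card_union_of_disjoint hdisj, Finset.card_image_of_injOn (hinj u),
      Finset.card_image_of_injOn (hinj v)]
    ring
  have hFmem : ∀ p ∈ F, p.2 < p.1 ∧ p.1 < n := by
    intro p hp
    rw [hF, Finset.mem_union, Finset.mem_image, Finset.mem_image] at hp
    rcases hp with ⟨a, ha, rfl⟩ | ⟨a, ha, rfl⟩
    · have := hA' a ha
      simp only [hf]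
      omega
    · have := hA' a ha
      simp only [hf]
      omega
  have h1 : Ex (natGraph m n) (fun E => ind (A ⊆ commonNbrs n E u v)) ≤
      Ex (natGraph m n) (fun E => ind (∀ p ∈ F, p ∈ E)) := by
    refine Ex_mono_support fun E hE => ind_mono fun h p hp => ?_
    have hG := isGrown_of_mem_support (by omega) hE
    rw [hF, Finset.mem_union, Finset.mem_image, Finset.mem_image] at hp
    rcases hp with ⟨a, ha, rfl⟩ | ⟨a, ha, rfl⟩
    · exact hG.mem_of_adj (Finset.mem_filter.1 (h ha)).2.1
    · exact hG.mem_of_adj (Finset.mem_filter.1 (h ha)).2.2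
  refine h1.trans ((Ex_forall_mem_le hm (by omega) (fun p hp => (hFmem p hp).1)
    fun p hp => (hFmem p hp).2).trans (le_of_eq ?_))
  congr 1
  rw [hcard, hF, Finset.prod_union hdisj, Finset.prod_image (hinj u), Finset.prod_image (hinj v),
    ← Finset.prod_mul_distrib]
  refine Finset.prod_congr rfl fun a _ => ?_
  have h2 : ∀ w : ℕ, √((((f w a).1 : ℕ) : ℝ) + 1) * √((((f w a).2 : ℕ) : ℝ) + 1) =
      √((a : ℝ) + 1) * √((w : ℝ) + 1) := by
    intro w
    simp only [hf]
    rcases le_total a w with h | h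
    · rw [max_eq_right h, min_eq_left h, mul_comm]
    · rw [max_eq_left h, min_eq_right h]
  have ha1 : √((a : ℝ) + 1) * √((a : ℝ) + 1) = (a : ℝ) + 1 :=
    Real.mul_self_sqrt (by positivity)
  rw [h2, h2, div_mul_div_comm]
  congr 1
  · ring
  · linear_combination (√((u : ℝ) + 1) * √((v : ℝ) + 1)) * ha1

/-- The probability that two nodes have at least `k` common neighbours. -/
theorem Ex_card_commonNbrs_ge {m : ℕ} (hm : 1 ≤ m) (k : ℕ) {n u v : ℕ} (hu : u < n) (hv : v < n)
    (huv : u ≠ v) :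
    Ex (natGraph m n) (fun E => ind (k ≤ (commonNbrs n E u v).card)) ≤
      ENNReal.ofReal ((edgeBound m (2 * k) ^ 2 * (∑ a ∈ Finset.range n, 1 / ((a : ℝ) + 1)) /
        (√((u : ℝ) + 1) * √((v : ℝ) + 1))) ^ k) := by
  set s := ((Finset.range n).erase u).erase v with hs
  set w : ℕ → ℝ := fun a => edgeBound m (2 * k) ^ 2 /
        (((a : ℝ) + 1) * (√((u : ℝ) + 1) * √((v : ℝ) + 1))) with hw
  have hw0 : ∀ a, 0 ≤ w a := fun a => by simp only [hw]; positivity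
  have h1 : ∀ E, ind (k ≤ (commonNbrs n E u v).card) ≤
      ∑ A ∈ s.powersetCard k, ind (A ⊆ commonNbrs n E u v) := by
    intro E
    refine le_trans (ind_mono fun h => ?_) (ind_exists_mem_le _ _)
    obtain ⟨A, hA, hAk⟩ := Finset.exists_subset_card_eq h
    exact ⟨A, Finset.mem_powersetCard.2 ⟨hA.trans (Finset.filter_subset _ _), hAk⟩, hA⟩
  refine (Ex_mono h1).trans ?_
  rw [Ex_finset_sum]
  have h2 : ∀ A ∈ s.powersetCard k, Ex (natGraph m n) (fun E => ind (A ⊆ commonNbrs n E u v)) ≤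
      ENNReal.ofReal (∏ a ∈ A, w a) := by
    intro A hA
    rw [Finset.mem_powersetCard] at hA
    have := Ex_subset_commonNbrs_le hm hu hv huv hA.1
    rwa [hA.2] at this
  refine (Finset.sum_le_sum h2).trans ?_
  rw [← ENNReal.ofReal_sum_of_nonneg fun A _ => Finset.prod_nonneg fun a _ => hw0 a]
  apply ENNReal.ofReal_le_ofReal
  refine (sum_powersetCard_prod_le w hw0 k s).trans ?_
  refine pow_le_pow_left₀ (Finset.sum_nonneg fun a _ => hw0 a) ?_ k
  refine (Finset.sum_le_sum_of_subset_of_nonneg (t := Finset.range n)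
    ((Finset.erase_subset _ _).trans (Finset.erase_subset _ _)) fun a _ _ => hw0 a).trans
    (le_of_eq ?_)
  rw [Finset.mul_sum, Finset.sum_div]
  refine Finset.sum_congr rfl fun a _ => ?_
  simp only [hw]
  field_simp

/-- The expected number of common neighbours of two nodes. -/
theorem Ex_card_commonNbrs_le {m : ℕ} (hm : 1 ≤ m) {n u v : ℕ} (hu : u < n) (hv : v < n)
    (huv : u ≠ v) :
    Ex (natGraph m n) (fun E => ((commonNbrs n E u v).card : ℝ≥0∞)) ≤
      ENNReal.ofReal (edgeBound m 2 ^ 2 * ∑ a ∈ Finset.range n, 1 / ((a : ℝ) + 1)) := by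
  classical
  set s := ((Finset.range n).erase u).erase v with hs
  have h1 : ∀ E, ((commonNbrs n E u v).card : ℝ≥0∞) = ∑ a ∈ s, ind ({a} ⊆ commonNbrs n E u v) := by
    intro E
    unfold commonNbrs ind
    rw [Finset.card_filter]
    push_cast
    refine Finset.sum_congr rfl fun a ha => ?_
    simp only [Finset.singleton_subset_iff, Finset.mem_filter]
    rw [← hs]
    simp only [ha, true_and]
  simp only [h1]
  rw [Ex_finset_sum]
  have h2 : ∀ a ∈ s, Ex (natGraph m n) (fun E => ind ({a} ⊆ commonNbrs n E u v)) ≤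
      ENNReal.ofReal (edgeBound m 2 ^ 2 * (1 / ((a : ℝ) + 1))) := by
    intro a ha
    refine (Ex_subset_commonNbrs_le hm hu hv huv (Finset.singleton_subset_iff.2 ha)).trans
      (ENNReal.ofReal_le_ofReal ?_)
    rw [Finset.prod_singleton, Finset.card_singleton, mul_one, mul_one_div]
    have h3 : ∀ w : ℕ, 1 ≤ √((w : ℝ) + 1) := fun w => by
      rw [Real.one_le_sqrt]
      linarith [(Nat.cast_nonneg w : (0 : ℝ) ≤ w)]
    gcongr
    exact le_mul_of_one_le_right (by positivity) (one_le_mul_of_one_le_of_one_le (h3 u) (h3 v))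
  refine (Finset.sum_le_sum h2).trans ?_
  rw [← ENNReal.ofReal_sum_of_nonneg fun a _ => by positivity]
  apply ENNReal.ofReal_le_ofReal
  rw [← Finset.mul_sum]
  gcongr
  exact (Finset.erase_subset _ _).trans (Finset.erase_subset _ _)

/-! ### Anti-concentration of degrees -/

theorem degree_le_two_mul_length {V : Type} [DecidableEq V] (E : EdgeList V) (v : V) :
    degree E v ≤ 2 * E.length := by
  unfold degree
  have h1 : E.countP (fun e => e.1 = v) ≤ E.length := List.countP_le_length
  have h2 : E.countP (fun e => e.2 = v) ≤ E.length := List.countP_le_length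
  omega

theorem natCast_sub_div_add_div {a b : ℕ} (h : a ≤ b) (hb : b ≠ 0) :
    ((b - a : ℕ) : ℝ≥0∞) / b + (a : ℝ≥0∞) / b = 1 := by
  rw [← ENNReal.add_div, ← Nat.cast_add, Nat.sub_add_cancel h]
  exact ENNReal.div_self (by simpa using hb) (ENNReal.natCast_ne_top _)

theorem Ex_attachN_ind_eq {E : EdgeList ℕ} {s x : ℕ} (hx : x ≠ s) :
    Ex (attachN E s) (fun v => ind (v = x)) =
      (degree E x : ℝ≥0∞) / ((2 * E.length + 1 : ℕ) : ℝ≥0∞) := by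
  have h := Ex_attachN_ind_mul s x E (fun _ => 1)
  simp only [mul_one] at h
  rw [h, attachN_apply, if_neg hx, add_zero]

theorem Ex_attachN_ind_ne {E : EdgeList ℕ} {s x : ℕ} (hx : x ≠ s) :
    Ex (attachN E s) (fun v => ind (v ≠ x)) =
      ((2 * E.length + 1 - degree E x : ℕ) : ℝ≥0∞) / ((2 * E.length + 1 : ℕ) : ℝ≥0∞) := by
  have h1 : Ex (attachN E s) (fun v => ind (v ≠ x)) + Ex (attachN E s) (fun v => ind (v = x)) = 1 := by
    rw [← Ex_add, ← Ex_const (attachN E s) 1]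
    congr 1
    ext v
    by_cases h : v = x <;> simp [ind, h]
  have h2 := natCast_sub_div_add_div (a := degree E x) (b := 2 * E.length + 1)
    ((degree_le_two_mul_length E x).trans (by omega)) (by omega)
  rw [Ex_attachN_ind_eq hx] at h1
  rw [← h2] at h1
  refine (ENNReal.add_left_inj ?_).1 h1
  exact ENNReal.div_ne_top (ENNReal.natCast_ne_top _) (by simp)

/-- The degree becomes `k` only from `k` by a miss or from `k - 1` by a hit. -/
theorem Ex_attachN_degree_eq_le {E : EdgeList ℕ} {s x : ℕ} (hx : x ≠ s) (hd : 0 < degree E x)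
    (k : ℕ) :
    Ex (attachN E s) (fun v => ind (degree ((s, v) :: E) x = k)) ≤
      ind (degree E x = k) * (((2 * E.length + 1 - k : ℕ) : ℝ≥0∞) /
        ((2 * E.length + 1 : ℕ) : ℝ≥0∞)) +
      ind (degree E x = k - 1) * (((k - 1 : ℕ) : ℝ≥0∞) / ((2 * E.length + 1 : ℕ) : ℝ≥0∞)) := by
  have hdeg : ∀ v, degree ((s, v) :: E) x = degree E x + if v = x then 1 else 0 := by
    intro v
    rw [degree_cons, if_neg (Ne.symm hx), zero_add]
  by_cases h1 : degree E x = k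
  · rw [ind_true h1, one_mul, ← h1]
    refine le_trans (le_trans (Ex_mono fun v => ind_mono fun h => ?_)
      (Ex_attachN_ind_ne hx).le) (le_add_right le_rfl)
    rintro rfl
    rw [hdeg, if_pos rfl, h1] at h
    omega
  · by_cases h2 : degree E x = k - 1
    · rw [ind_true h2, one_mul, ← h2]
      refine le_trans (le_trans (Ex_mono fun v => ind_mono fun h => ?_)
        (Ex_attachN_ind_eq hx).le) (le_add_left le_rfl)
      by_contra hv
      rw [hdeg, if_neg hv, add_zero] at h
      exact h1 h
    · refine (Ex_le_const (c := 0) fun v _ => (ind_false ?_).le).trans zero_le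
      rw [hdeg]
      split_ifs <;> omega

/-- If `p` bounds all point probabilities, then after one edge they are at most `p ((2e+1-k) +
(k-1)) / (2e+1) = p · 2e / (2e+1)`. So each edge contracts the largest point probability by at least
`exp(-1/(2L))`. The law `μ` is arbitrary because the induction passes to the law after a single
edge. -/
theorem Ex_addEdgesN_degree_eq_le {s x : ℕ} (hx : x ≠ s) {L : ℕ} (i : ℕ) {e : ℕ} (heL : e + i ≤ L)
    (μ : PMF (EdgeList ℕ)) (hμ : ∀ E ∈ μ.support, E.length = e ∧ 0 < degree E x) {p : ℝ≥0∞}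
    (hp : ∀ k, Ex μ (fun E => ind (degree E x = k)) ≤ p) (k : ℕ) :
    Ex μ (fun E => Ex (addEdgesN s i E) fun E' => ind (degree E' x = k)) ≤
      p * ENNReal.ofReal (Real.exp (-(1 / (2 * (L : ℝ))))) ^ i := by
  induction i generalizing e μ p k with
  | zero => simpa [Ex_addEdgesN_zero] using hp k
  | succ i ih =>
    set r := ENNReal.ofReal (Real.exp (-(1 / (2 * (L : ℝ))))) with hr
    set ν : PMF (EdgeList ℕ) := μ.bind fun E => (attachN E s).map fun v => (s, v) :: E with hν
    have hνEx : ∀ f, Ex ν f = Ex μ fun E => Ex (attachN E s) fun v => f ((s, v) :: E) := by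
      intro f
      rw [hν, Ex_bind]
      simp only [Ex_map, Function.comp_def]
    have hνsupp : ∀ E ∈ ν.support, E.length = e + 1 ∧ 0 < degree E x := by
      intro E hE
      rw [hν, PMF.mem_support_bind_iff] at hE
      obtain ⟨E₀, h0, hE⟩ := hE
      rw [PMF.mem_support_map_iff] at hE
      obtain ⟨v, -, rfl⟩ := hE
      refine ⟨by simp [(hμ E₀ h0).1], ?_⟩
      rw [degree_cons]
      have := (hμ E₀ h0).2
      omega
    have hνp : ∀ k, Ex ν (fun E => ind (degree E x = k)) ≤ p * r := by
      intro k
      -- The values `k = 0` and `k > 2e + 1` have probability zero. They are set aside because the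
      -- truncated subtractions add up to `2e` only between them.
      rcases Nat.eq_zero_or_pos k with rfl | hk
      · rw [Ex_congr_support (g := fun _ => 0), Ex_const]
        · exact zero_le
        · intro E hE
          exact ind_false (hνsupp E hE).2.ne'
      by_cases hkN : 2 * e + 1 < k
      · rw [Ex_congr_support (g := fun _ => 0), Ex_const]
        · exact zero_le
        · intro E hE
          apply ind_false
          intro hcon
          rw [hν, PMF.mem_support_bind_iff] at hE
          obtain ⟨E₀, h0, hE⟩ := hE
          rw [PMF.mem_support_map_iff] at hE
          obtain ⟨v, -, rfl⟩ := hE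
          rw [degree_cons, if_neg (Ne.symm hx)] at hcon
          have h1 := degree_le_two_mul_length E₀ x
          rw [(hμ E₀ h0).1] at h1
          split_ifs at hcon <;> omega
      rw [hνEx]
      have hN0 : ((2 * e + 1 : ℕ) : ℝ≥0∞) ≠ 0 := by simp
      calc Ex μ (fun E => Ex (attachN E s) fun v => ind (degree ((s, v) :: E) x = k))
          ≤ Ex μ (fun E => ind (degree E x = k) * (((2 * e + 1 - k : ℕ) : ℝ≥0∞) /
              ((2 * e + 1 : ℕ) : ℝ≥0∞)) + ind (degree E x = k - 1) * (((k - 1 : ℕ) : ℝ≥0∞) /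
              ((2 * e + 1 : ℕ) : ℝ≥0∞))) := by
            refine Ex_mono_support fun E hE => ?_
            have h1 := Ex_attachN_degree_eq_le hx (hμ E hE).2 k
            rwa [(hμ E hE).1] at h1
        _ ≤ p * (((2 * e + 1 - k : ℕ) : ℝ≥0∞) / ((2 * e + 1 : ℕ) : ℝ≥0∞)) +
              p * (((k - 1 : ℕ) : ℝ≥0∞) / ((2 * e + 1 : ℕ) : ℝ≥0∞)) := by
            rw [Ex_add, Ex_mul_const, Ex_mul_const]
            gcongr
            · exact hp k
            · exact hp (k - 1)
        _ = p * (((2 * e : ℕ) : ℝ≥0∞) / ((2 * e + 1 : ℕ) : ℝ≥0∞)) := by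
            rw [← mul_add, ← ENNReal.add_div, ← Nat.cast_add]
            congr 4
            omega
        _ ≤ p * r := by
            gcongr
            rw [hr, ← ENNReal.ofReal_natCast, ← ENNReal.ofReal_natCast (2 * e + 1),
              ← ENNReal.ofReal_div_of_pos (by positivity)]
            apply ENNReal.ofReal_le_ofReal
            have hL : (0 : ℝ) < L := by exact_mod_cast (by omega : 0 < L)
            have heL' : (2 : ℝ) * e + 1 ≤ 2 * L := by exact_mod_cast (by omega : 2 * e + 1 ≤ 2 * L)
            have h1 : ((2 * e : ℕ) : ℝ) / ((2 * e + 1 : ℕ) : ℝ) = 1 - 1 / (2 * (e : ℝ) + 1) := by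
              push_cast
              field_simp
              ring
            have h2 : 1 / (2 * (L : ℝ)) ≤ 1 / (2 * (e : ℝ) + 1) :=
              one_div_le_one_div_of_le (by positivity) heL'
            have h3 := Real.add_one_le_exp (-(1 / (2 * (L : ℝ))))
            rw [h1]
            linarith
    have := ih (e := e + 1) (by omega) ν hνsupp hνp k
    rw [hνEx] at this
    simp only [Ex_addEdgesN_succ]
    refine this.trans (le_of_eq ?_)
    rw [pow_succ']
    ring

/-- No value of the degree of a node is very likely. -/
theorem Ex_degree_eq_le {m : ℕ} (hm : 1 ≤ m) {u n : ℕ} (hn : u + 1 ≤ n) (k : ℕ) :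
    Ex (natGraph m n) (fun E => ind (degree E u = k)) ≤
      ENNReal.ofReal (growth (u + 2) / growth (n + 1)) := by
  induction n, hn using Nat.le_induction generalizing k with
  | base =>
    rw [div_self (growth_pos _).ne', ENNReal.ofReal_one]
    exact Ex_le_const fun E _ => ind_le_one _
  | succ n hn ih =>
    rw [Ex_natGraph_succ m (by omega)]
    have hsupp : ∀ E ∈ (natGraph m n).support, E.length = m * n ∧ 0 < degree E u := by
      intro E hE
      have hG := isGrown_of_mem_support (by omega) hE
      refine ⟨hG.length_eq, ?_⟩
      have := hG.count_source u (by omega)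
      unfold degree
      omega
    refine (Ex_addEdgesN_degree_eq_le (by omega) (L := m * (n + 1)) m (e := m * n) (by ring_nf; omega)
      _ hsupp ih k).trans (le_of_eq ?_)
    have hn0 : (0 : ℝ) < (n : ℝ) + 1 := by positivity
    have hm0 : (0 : ℝ) < m := by exact_mod_cast hm
    rw [← ENNReal.ofReal_pow (Real.exp_pos _).le,
      ← ENNReal.ofReal_mul (div_pos (growth_pos _) (growth_pos _)).le, ← Real.exp_nat_mul,
      growth_succ (n := n + 1) (by omega)]
    congr 1
    have h1 : (m : ℝ) * -(1 / (2 * ((m * (n + 1) : ℕ) : ℝ))) = -(1 / (2 * ((n + 1 : ℕ) : ℝ))) := by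
      push_cast
      field_simp
    rw [h1, Real.exp_neg, ← div_eq_mul_inv, div_div]

theorem Ex_degree_mem_le {m : ℕ} (hm : 1 ≤ m) {u n : ℕ} (hn : u < n) (K : Finset ℕ) :
    Ex (natGraph m n) (fun E => ind (degree E u ∈ K)) ≤
      ENNReal.ofReal (K.card * (4 * √(((u : ℝ) + 1) / n))) := by
  have h1 : ∀ E, ind (degree E u ∈ K) ≤ ∑ k ∈ K, ind (degree E u = k) := by
    intro E
    exact le_trans (ind_mono fun h => ⟨_, h, rfl⟩) (ind_exists_mem_le K fun k => degree E u = k)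
  have hn0 : (0 : ℝ) < n := by exact_mod_cast (by omega : 0 < n)
  have hg : growth (u + 2) / growth (n + 1) ≤ 4 * √(((u : ℝ) + 1) / n) := by
    have h2 := growth_le (t := u + 2) (by omega)
    have h3 := sqrt_le_growth (t := n + 1) (by omega)
    have h4 : √((u + 2 : ℕ) : ℝ) ≤ 2 * √((u : ℝ) + 1) := by
      rw [Real.sqrt_le_left (by positivity), mul_pow, Real.sq_sqrt (by positivity)]
      push_cast
      linarith [(Nat.cast_nonneg u : (0 : ℝ) ≤ u)]
    have h5 : √(n : ℝ) ≤ √((n + 1 : ℕ) : ℝ) := by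
      apply Real.sqrt_le_sqrt
      push_cast
      linarith
    have h6 : 0 < √(n : ℝ) := Real.sqrt_pos.2 hn0
    rw [Real.sqrt_div (by positivity), ← mul_div_assoc]
    exact div_le_div₀ (by positivity) (by linarith) h6 (h5.trans h3)
  calc Ex (natGraph m n) (fun E => ind (degree E u ∈ K))
      ≤ ∑ k ∈ K, Ex (natGraph m n) (fun E => ind (degree E u = k)) := by
        rw [← Ex_finset_sum]; exact Ex_mono h1
    _ ≤ ∑ _k ∈ K, ENNReal.ofReal (4 * √(((u : ℝ) + 1) / n)) := by
        refine Finset.sum_le_sum fun k _ => (Ex_degree_eq_le hm (by omega) k).trans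
          (ENNReal.ofReal_le_ofReal hg)
    _ = _ := by
        rw [Finset.sum_const, nsmul_eq_mul, ENNReal.ofReal_mul (Nat.cast_nonneg _),
          ENNReal.ofReal_natCast]

/-! ### Deterministic analysis of the algorithm -/

section Deterministic

variable {V : Type} [Fintype V] [DecidableEq V]

theorem mem_neighbors {E : EdgeList V} {u v : V} :
    u ∈ neighbors E v ↔ (u, v) ∈ E ∨ (v, u) ∈ E := by
  simp [neighbors]

theorem card_neighbors_le_degree (E : EdgeList V) (v : V) :
    (neighbors E v).card ≤ degree E v := by
  have h : neighbors E v ⊆ ((E.filter fun e => e.1 = v).map Prod.snd ++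
      (E.filter fun e => e.2 = v).map Prod.fst).toFinset := by
    intro a ha
    rw [List.mem_toFinset, List.mem_append, List.mem_map, List.mem_map]
    rcases mem_neighbors.1 ha with h | h
    · exact Or.inr ⟨(a, v), by simp [h], rfl⟩
    · exact Or.inl ⟨(v, a), by simp [h], rfl⟩
  refine (Finset.card_le_card h).trans ((List.toFinset_card_le _).trans ?_)
  rw [List.length_append, List.length_map, List.length_map, ← List.countP_eq_length_filter,
    ← List.countP_eq_length_filter]
  rfl

/-- The nodes adjacent to `u` in the first copy and to `v` in the second copy. -/
def witnesses (x : Instance V) (u v : V) : Finset V := neighbors x.G₁ u ∩ neighbors x.G₂ v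

/-- The input is separated: a wrong pair either has fewer than `T` potential witnesses, or is
dominated by the seed witnesses of a correct pair which is considered at the same time. -/
structure Separated (T : ℕ) (x : Instance V) : Prop where
  diag_seeds : ∀ p ∈ x.seeds, p.1 = p.2
  few_or_dominated : ∀ u v, u ≠ v → (witnesses x u v).card < T ∨
    ((∀ j : ℕ, 2 ^ j ≤ degree x.G₁ u → 2 ^ j ≤ degree x.G₂ u) ∧
      (witnesses x u v).card ≤ ((witnesses x u u).filter fun a => (a, a) ∈ x.seeds).card)

/-- Links which contain the seeds and no mismatch. -/
def Correct (x : Instance V) (L : Finset (V × V)) : Prop :=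
  x.seeds ⊆ L ∧ ∀ p ∈ L, p.1 = p.2

variable {T : ℕ} {x : Instance V}

/-- Correct links lie on the diagonal, so a scoring link is determined by its first node, which is a
witness. -/
theorem Correct.score_le {L : Finset (V × V)} (hL : Correct x L) (p : V × V) :
    score x.G₁ x.G₂ L p ≤ (witnesses x p.1 p.2).card := by
  unfold score
  apply Finset.card_le_card_of_injOn Prod.fst
  · intro q hq
    rw [Finset.mem_coe, Finset.mem_filter] at hq
    rw [Finset.mem_coe, witnesses, Finset.mem_inter]
    refine ⟨hq.2.1, ?_⟩
    rw [hL.2 q hq.1]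
    exact hq.2.2
  · intro q hq q' hq' h
    rw [Finset.mem_coe, Finset.mem_filter] at hq hq'
    exact Prod.ext h (by rw [← hL.2 q hq.1, ← hL.2 q' hq'.1]; exact h)

theorem card_le_score {L : Finset (V × V)} {v : V} {W : Finset V}
    (hW : W ⊆ witnesses x v v) (hWL : ∀ a ∈ W, (a, a) ∈ L) :
    W.card ≤ score x.G₁ x.G₂ L (v, v) := by
  unfold score
  apply Finset.card_le_card_of_injOn fun a => (a, a)
  · intro a ha
    have h := hW ha
    rw [witnesses, Finset.mem_inter] at h
    rw [Finset.mem_coe, Finset.mem_filter]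
    exact ⟨hWL a ha, h.1, h.2⟩
  · intro a _ b _ h
    exact (Prod.mk.inj h).1

theorem subset_phase (L : Finset (V × V)) (j : ℕ) : L ⊆ phase x.G₁ x.G₂ T L j :=
  Finset.subset_union_left

/-- A wrong pair `(u, v)` either misses the threshold or competes with `(u, u)`, whose seeds alone
score at least as much. A tie suffices, since only strict maxima are selected. -/
theorem Separated.correct_phase (hx : Separated T x) {L : Finset (V × V)} (hL : Correct x L)
    (j : ℕ) : Correct x (phase x.G₁ x.G₂ T L j) := by
  refine ⟨hL.1.trans (subset_phase L j), fun p hp => ?_⟩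
  rw [phase, Finset.mem_union, Finset.mem_filter] at hp
  rcases hp with hp | ⟨hc, hT, hmax⟩
  · exact hL.2 p hp
  obtain ⟨u, v⟩ := p
  by_contra huv
  simp only at huv
  have hs := hL.score_le (u, v)
  rcases hx.few_or_dominated u v huv with h | ⟨h1, h2⟩
  · simp only at hs
    omega
  · have hcu : (u, u) ∈ candidates x.G₁ x.G₂ j := by
      simp only [candidates, Finset.mem_filter, Finset.mem_univ, true_and] at hc ⊢
      exact ⟨hc.1, h1 j hc.1⟩
    have h3 := hmax (u, u) hcu (by simpa using huv) (Or.inl rfl)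
    have h4 : ((witnesses x u u).filter fun a => (a, a) ∈ x.seeds).card ≤
        score x.G₁ x.G₂ L (u, u) :=
      card_le_score (Finset.filter_subset _ _) fun a ha => hL.1 (Finset.mem_filter.1 ha).2
    simp only at hs
    omega

theorem Separated.correct_foldl (hx : Separated T x) (js : List ℕ) {L : Finset (V × V)}
    (hL : Correct x L) :
    Correct x (js.foldl (phase x.G₁ x.G₂ T) L) ∧ L ⊆ js.foldl (phase x.G₁ x.G₂ T) L := by
  induction js generalizing L with
  | nil => exact ⟨hL, Finset.Subset.refl _⟩
  | cons j js ih =>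
    obtain ⟨h1, h2⟩ := ih (hx.correct_phase hL j)
    exact ⟨h1, (subset_phase L j).trans h2⟩

theorem Separated.correct_iteration (hx : Separated T x) {L : Finset (V × V)} (hL : Correct x L) :
    Correct x (iteration x.G₁ x.G₂ T L) ∧ L ⊆ iteration x.G₁ x.G₂ T L :=
  hx.correct_foldl _ hL

theorem Separated.correct_userMatching (hx : Separated T x) (k : ℕ) :
    Correct x (userMatching T k x) := by
  induction k with
  | zero => exact ⟨Finset.Subset.refl _, hx.diag_seeds⟩
  | succ k ih =>
    rw [userMatching, Function.iterate_succ_apply']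
    exact (hx.correct_iteration ih).1

theorem Separated.userMatching_mono (hx : Separated T x) : Monotone fun k => userMatching T k x := by
  refine monotone_nat_of_le_succ fun k => ?_
  simp only [userMatching, Function.iterate_succ_apply']
  exact (hx.correct_iteration (hx.correct_userMatching k)).2

/-- A node with enough witnesses, more than any wrong pair containing it, is identified. -/
theorem Separated.mem_iteration (hx : Separated T x) {L : Finset (V × V)} (hL : Correct x L)
    {v : V} {W : Finset V} (hT : 2 ≤ T) (hW : W ⊆ witnesses x v v) (hWL : ∀ a ∈ W, (a, a) ∈ L)
    (hWT : T ≤ W.card) (h1 : ∀ v', v' ≠ v → (witnesses x v v').card < W.card)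
    (h2 : ∀ v', v' ≠ v → (witnesses x v' v).card < W.card) :
    (v, v) ∈ iteration x.G₁ x.G₂ T L := by
  have hd1 : 2 ≤ degree x.G₁ v := by
    refine le_trans ?_ (card_neighbors_le_degree x.G₁ v)
    exact hT.trans (hWT.trans (Finset.card_le_card (hW.trans Finset.inter_subset_left)))
  have hd2 : 2 ≤ degree x.G₂ v := by
    refine le_trans ?_ (card_neighbors_le_degree x.G₂ v)
    exact hT.trans (hWT.trans (Finset.card_le_card (hW.trans Finset.inter_subset_right)))
  have hmax : 2 ≤ maxDegree x.G₁ x.G₂ :=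
    hd1.trans ((le_max_left _ _).trans
      (Finset.le_sup (f := fun v => max (degree x.G₁ v) (degree x.G₂ v)) (Finset.mem_univ v)))
  have hlog : 0 < Nat.log 2 (maxDegree x.G₁ x.G₂) := Nat.log_pos (by norm_num) hmax
  obtain ⟨K, hK⟩ := Nat.exists_eq_add_of_le' hlog
  unfold iteration
  -- Level 1 is the last of the pass and admits all pairs of degree at least two, which `T ≥ 2`
  -- guarantees here. Links found at the higher levels can only raise the score.
  rw [hK, List.range'_succ, List.reverse_cons, List.foldl_append, List.foldl_cons, List.foldl_nil]
  obtain ⟨hL', hLL'⟩ := hx.correct_foldl (List.range' (1 + 1) K).reverse hL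
  set L' := (List.range' (1 + 1) K).reverse.foldl (phase x.G₁ x.G₂ T) L
  have hscore : W.card ≤ score x.G₁ x.G₂ L' (v, v) := card_le_score hW fun a ha => hLL' (hWL a ha)
  rw [phase, Finset.mem_union, Finset.mem_filter]
  refine Or.inr ⟨by simp [candidates, hd1, hd2], hWT.trans hscore, fun q _ hq hq' => ?_⟩
  refine lt_of_lt_of_le ((hL'.score_le q).trans_lt ?_) hscore
  obtain ⟨a, b⟩ := q
  simp only at hq'
  rcases hq' with rfl | rfl
  · exact h1 b fun h => hq (by rw [h])
  · exact h2 a fun h => hq (by rw [h])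

end Deterministic

/-! ### Tail bounds for thinned lists -/

section Thin

variable {α : Type}

/-- The expectation over two independent thinnings of the same list. -/
noncomputable def Ex₂ (p : I) (G : List α) (f : List α → List α → ℝ≥0∞) : ℝ≥0∞ :=
  Ex (thin p G) fun G₁ => Ex (thin p G) fun G₂ => f G₁ G₂

theorem Ex₂_mono {p : I} {G : List α} {f g : List α → List α → ℝ≥0∞}
    (h : ∀ G₁ G₂, f G₁ G₂ ≤ g G₁ G₂) : Ex₂ p G f ≤ Ex₂ p G g :=
  Ex_mono fun G₁ => Ex_mono fun G₂ => h G₁ G₂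

theorem Ex₂_const_mul (p : I) (G : List α) (f : List α → List α → ℝ≥0∞) (c : ℝ≥0∞) :
    Ex₂ p G (fun G₁ G₂ => c * f G₁ G₂) = c * Ex₂ p G f := by
  simp only [Ex₂, Ex_const_mul]

theorem Ex₂_cons (p : I) (e : α) (G : List α) (f : List α → List α → ℝ≥0∞) :
    Ex₂ p (e :: G) f = Ex (coin p) fun b₁ => Ex (coin p) fun b₂ =>
      Ex₂ p G fun G₁ G₂ => f (if b₁ then e :: G₁ else G₁) (if b₂ then e :: G₂ else G₂) := by
  unfold Ex₂
  rw [Ex_thin_cons]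
  congr 1
  ext b₁
  simp only [Ex_thin_cons]
  rw [Ex_comm]

theorem ofReal_mixture (p : I) {z : ℝ} (hz : 0 ≤ z) :
    ENNReal.ofReal p * ENNReal.ofReal z + ENNReal.ofReal (1 - p) =
      ENNReal.ofReal (1 - p * (1 - z)) := by
  have h1 := p.2.1
  have h2 : (0 : ℝ) ≤ 1 - p := sub_nonneg.2 p.2.2
  rw [← ENNReal.ofReal_mul h1, ← ENNReal.ofReal_add (mul_nonneg h1 hz) h2]
  congr 1
  ring

theorem Ex_coin_mul (p : I) {z : ℝ} (hz : 0 ≤ z) (c : ℝ≥0∞) :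
    Ex (coin p) (fun b => if b then ENNReal.ofReal z * c else c) =
      ENNReal.ofReal (1 - p * (1 - z)) * c := by
  rw [Ex_coin, ← ofReal_mixture p hz]
  simp only [if_true, Bool.false_eq_true, if_false]
  ring

variable [DecidableEq α]

theorem card_filter_mem_mono {A B : Finset α} {L M : List α} (hAB : A ⊆ B) (h : ∀ a ∈ L, a ∈ M) :
    (A.filter fun a => a ∈ L).card ≤ (B.filter fun a => a ∈ M).card := by
  apply Finset.card_le_card
  intro a ha
  rw [Finset.mem_filter] at ha ⊢
  exact ⟨hAB ha.1, h a ha.2⟩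

/-- The generating function of independent coins. It is only an upper bound because `L` may repeat
elements: each element of `C` is charged to its last occurrence, and further chances only lower the
left side. -/
theorem Ex_thin_pow_card_le (p : I) {z : ℝ} (hz : 0 ≤ z) (hz1 : z ≤ 1) (L : List α)
    (C : Finset α) (hC : ∀ a ∈ C, a ∈ L) :
    Ex (thin p L) (fun S => ENNReal.ofReal z ^ (C.filter fun a => a ∈ S).card) ≤
      ENNReal.ofReal (1 - p * (1 - z)) ^ C.card := by
  have hzE : ENNReal.ofReal z ≤ 1 := ENNReal.ofReal_le_one.2 hz1
  induction L generalizing C with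
  | nil =>
    have : C = ∅ := Finset.eq_empty_of_forall_notMem fun a ha => by simpa using hC a ha
    subst this
    simp [Ex_thin_nil]
  | cons e L ih =>
    rw [Ex_thin_cons]
    by_cases hCL : ∀ a ∈ C, a ∈ L
    · refine Ex_le_const fun b _ => le_trans (Ex_mono fun S => ?_) (ih C hCL)
      refine pow_le_pow_right_of_le_one' hzE (card_filter_mem_mono subset_rfl ?_)
      intro a ha
      cases b <;> simp [ha]
    · have heC : e ∈ C ∧ e ∉ L := by
        push Not at hCL
        obtain ⟨a, haC, haL⟩ := hCL
        have := hC a haC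
        rw [List.mem_cons] at this
        rcases this with rfl | h
        · exact ⟨haC, haL⟩
        · exact absurd h haL
      have hC' : ∀ a ∈ C.erase e, a ∈ L := by
        intro a ha
        rw [Finset.mem_erase] at ha
        exact (List.mem_cons.1 (hC a ha.2)).resolve_left ha.1
      have hcard : C.card = (C.erase e).card + 1 := by
        rw [Finset.card_erase_add_one heC.1]
      refine le_trans (Ex_mono (g := fun b => if b then ENNReal.ofReal z *
        Ex (thin p L) (fun S => ENNReal.ofReal z ^ ((C.erase e).filter fun a => a ∈ S).card) else
        Ex (thin p L) (fun S => ENNReal.ofReal z ^ ((C.erase e).filter fun a => a ∈ S).card))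
        fun b => ?_) ?_
      · cases b
        · simp only [Bool.false_eq_true, if_false]
          exact Ex_mono fun S => pow_le_pow_right_of_le_one' hzE
            (card_filter_mem_mono (Finset.erase_subset _ _) fun _ h => h)
        · simp only [if_true]
          rw [← Ex_const_mul]
          refine Ex_mono fun S => ?_
          rw [← pow_succ']
          refine pow_le_pow_right_of_le_one' hzE ?_
          rw [← Finset.card_insert_of_notMem (s := (C.erase e).filter fun a => a ∈ S) (a := e)
            (by simp)]
          apply Finset.card_le_card
          intro a ha
          rw [Finset.mem_insert, Finset.mem_filter, Finset.mem_erase] at ha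
          rw [Finset.mem_filter, List.mem_cons]
          rcases ha with rfl | ha
          · exact ⟨heC.1, Or.inl rfl⟩
          · exact ⟨ha.1.2, Or.inr ha.2⟩
      · rw [Ex_coin_mul p hz, hcard, pow_succ']
        gcongr
        exact ih _ hC'

/-- Two thinnings compose the map `z ↦ 1 - p (1 - z)` with itself. -/
theorem Ex₂_pow_card_le (p : I) {z : ℝ} (hz : 0 ≤ z) (hz1 : z ≤ 1) (L : List α)
    (C : Finset α) (hC : ∀ a ∈ C, a ∈ L) :
    Ex₂ p L (fun G₁ G₂ => ENNReal.ofReal z ^ (C.filter fun a => a ∈ G₁ ∧ a ∈ G₂).card) ≤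
      ENNReal.ofReal (1 - (p : ℝ) ^ 2 * (1 - z)) ^ C.card := by
  have hp1 := p.2.2
  have hp0 := p.2.1
  have h : ∀ G₁ G₂ : List α, (C.filter fun a => a ∈ G₁ ∧ a ∈ G₂) =
      ((C.filter fun a => a ∈ G₁).filter fun a => a ∈ G₂) := by
    intro G₁ G₂
    rw [Finset.filter_filter]
  unfold Ex₂
  simp only [h]
  have hz' : 0 ≤ 1 - (p : ℝ) * (1 - z) := by nlinarith
  have hz1' : 1 - (p : ℝ) * (1 - z) ≤ 1 := by nlinarith
  refine (Ex_mono fun G₁ => Ex_thin_pow_card_le p hz hz1 L _ fun a ha =>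
    hC a (Finset.mem_filter.1 ha).1).trans ?_
  refine (Ex_thin_pow_card_le p hz' hz1' L C hC).trans (le_of_eq ?_)
  congr 2
  ring

end Thin

/-- Markov's inequality for `2^(-X)`. -/
theorem ind_lt_le_pow (X w : ℕ) : ind (X < w) ≤ 2 ^ w * ENNReal.ofReal (1 / 2) ^ X := by
  refine ind_le_of fun h => ?_
  have h1 : ENNReal.ofReal (1 / 2) ^ X ≥ ENNReal.ofReal (1 / 2) ^ w :=
    pow_le_pow_right_of_le_one' (ENNReal.ofReal_le_one.2 (by norm_num)) h.le
  refine le_trans ?_ (mul_le_mul_right h1 _)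
  rw [← mul_pow]
  have : (2 : ℝ≥0∞) * ENNReal.ofReal (1 / 2) = 1 := by
    rw [show (2 : ℝ≥0∞) = ENNReal.ofReal 2 by simp, ← ENNReal.ofReal_mul (by norm_num)]
    norm_num
  rw [this, one_pow]

/-- A node with many younger neighbours has many seed witnesses. -/
theorem Ex_seed_witnesses_lt_le (s l : I) (n u w : ℕ) (G : EdgeList ℕ) :
    Ex₂ s G (fun G₁ G₂ => Ex (thin l (List.range n)) fun S =>
      ind (((Finset.range n).filter fun a => (a, u) ∈ G₁ ∧ (a, u) ∈ G₂ ∧ a ∈ S).card < w)) ≤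
      2 ^ w * ENNReal.ofReal (1 - (s : ℝ) ^ 2 * (l / 2)) ^
        ((Finset.range n).filter fun a => (a, u) ∈ G).card := by
  have hl1 := l.2.2
  have hl0 := l.2.1
  set A := (Finset.range n).filter fun a => (a, u) ∈ G with hA
  set F : Finset (ℕ × ℕ) := A.image fun a => (a, u) with hF
  have hinj : Function.Injective fun a : ℕ => (a, u) := fun a b h => (Prod.mk.inj h).1
  have hstep : ∀ G₁ G₂ : EdgeList ℕ, Ex (thin l (List.range n)) (fun S =>
      ind (((Finset.range n).filter fun a => (a, u) ∈ G₁ ∧ (a, u) ∈ G₂ ∧ a ∈ S).card < w)) ≤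
      2 ^ w * ENNReal.ofReal (1 - l / 2) ^ (F.filter fun a => a ∈ G₁ ∧ a ∈ G₂).card := by
    intro G₁ G₂
    refine (Ex_mono fun S => ind_lt_le_pow _ _).trans ?_
    rw [Ex_const_mul]
    gcongr
    set C := (Finset.range n).filter fun a => (a, u) ∈ G₁ ∧ (a, u) ∈ G₂ with hC
    have h1 : ∀ S : List ℕ, ((Finset.range n).filter fun a => (a, u) ∈ G₁ ∧ (a, u) ∈ G₂ ∧ a ∈ S) =
        C.filter fun a => a ∈ S := by
      intro S
      rw [hC, Finset.filter_filter]
      simp only [and_assoc]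
    simp only [h1]
    refine (Ex_thin_pow_card_le l (by norm_num) (by norm_num) (List.range n) C ?_).trans ?_
    · intro a ha
      simpa using (Finset.mem_filter.1 ha).1
    · have h2 : 1 - (l : ℝ) * (1 - 1 / 2) = 1 - l / 2 := by ring
      rw [h2]
      refine pow_le_pow_right_of_le_one' (ENNReal.ofReal_le_one.2 (by linarith)) ?_
      rw [← Finset.card_image_of_injective C hinj]
      apply Finset.card_le_card
      intro e he
      rw [Finset.mem_filter, hF, Finset.mem_image] at he
      obtain ⟨⟨a, ha, rfl⟩, h3⟩ := he
      rw [Finset.mem_image]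
      refine ⟨a, ?_, rfl⟩
      rw [hC, Finset.mem_filter]
      exact ⟨(Finset.mem_filter.1 ha).1, h3⟩
  refine (Ex₂_mono hstep).trans ?_
  rw [Ex₂_const_mul]
  gcongr
  have hFG : ∀ e ∈ F, e ∈ G := by
    intro e he
    rw [hF, Finset.mem_image] at he
    obtain ⟨a, ha, rfl⟩ := he
    exact (Finset.mem_filter.1 ha).2
  -- The coins are folded one after the other: `1/2` becomes `1 - l/2` through the seed coin, then
  -- `1 - s^2 l/2` through the two copies.
  have hmain := Ex₂_pow_card_le s (z := 1 - l / 2) (by linarith) (by linarith) G F hFG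
  rw [hF, Finset.card_image_of_injective _ hinj, ← hF] at hmain
  rw [show (s : ℝ) ^ 2 * (1 - (1 - (l : ℝ) / 2)) = (s : ℝ) ^ 2 * (l / 2) by ring] at hmain
  refine le_trans (le_of_eq ?_) hmain
  congr!

/-! ### Concentration of the degrees in a copy -/

/-- The variance of a sum of independent terms. The offset `c` carries the deviation of the coins
already tossed, so that the induction runs through identities. -/
theorem Ex_thin_sq (p : I) {α : Type} (w : α → ℝ) (L : List α) (c : ℝ) :
    Ex (thin p L) (fun S => ENNReal.ofReal ((c + (S.map w).sum - p * (L.map w).sum) ^ 2)) =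
      ENNReal.ofReal (c ^ 2 + p * (1 - p) * (L.map fun a => w a ^ 2).sum) := by
  have h1 := p.2.1
  have h2 : (0 : ℝ) ≤ 1 - p := sub_nonneg.2 p.2.2
  induction L generalizing c with
  | nil => simp [Ex_thin_nil]
  | cons a L ih =>
    rw [Ex_thin_cons, Ex_coin]
    have e1 : ∀ S : List α, c + ((a :: S).map w).sum - p * ((a :: L).map w).sum =
        (c + (1 - p) * w a) + (S.map w).sum - p * (L.map w).sum := by
      intro S
      simp only [List.map_cons, List.sum_cons]
      ring
    have e2 : ∀ S : List α, c + (S.map w).sum - p * ((a :: L).map w).sum =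
        (c - p * w a) + (S.map w).sum - p * (L.map w).sum := by
      intro S
      simp only [List.map_cons, List.sum_cons]
      ring
    simp only [if_true, Bool.false_eq_true, if_false]
    simp only [e1, e2, ih]
    have h3 : 0 ≤ (L.map fun a => w a ^ 2).sum :=
      List.sum_nonneg fun x hx => by
        obtain ⟨b, -, rfl⟩ := List.mem_map.1 hx
        positivity
    have h4 : 0 ≤ (p : ℝ) * (1 - p) * (L.map fun a => w a ^ 2).sum := by positivity
    rw [← ENNReal.ofReal_mul h1, ← ENNReal.ofReal_mul h2, ← ENNReal.ofReal_add
      (by positivity) (by positivity)]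
    congr 1
    simp only [List.map_cons, List.sum_cons]
    ring

theorem degree_eq_sum (E : EdgeList ℕ) (v : ℕ) : (degree E v : ℝ) =
    (E.map fun e => (((if e.1 = v then 1 else 0) + (if e.2 = v then 1 else 0) : ℕ) : ℝ)).sum := by
  induction E with
  | nil => simp
  | cons e E ih =>
    rw [degree_cons, Nat.cast_add, ih, List.map_cons, List.sum_cons, add_comm]

/-- Chebyshev's inequality for the degree of a node in a copy. -/
theorem Ex_thin_degree_deviation_le (s : I) (G : EdgeList ℕ) (u : ℕ) {y : ℝ} (hy : 0 < y) :
    Ex (thin s G) (fun G₁ => ind (y < |(degree G₁ u : ℝ) - s * degree G u|)) ≤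
      degree G u * ENNReal.ofReal (2 / y ^ 2) := by
  have h1 := s.2.1
  have h2 : (0 : ℝ) ≤ 1 - s := sub_nonneg.2 s.2.2
  set w : ℕ × ℕ → ℝ := fun e =>
    (((if e.1 = u then 1 else 0) + (if e.2 = u then 1 else 0) : ℕ) : ℝ) with hw
  have h := Ex_thin_sq s w G 0
  have h3 : ∀ G₁ : EdgeList ℕ, ind (y < |(degree G₁ u : ℝ) - s * degree G u|) ≤
      ENNReal.ofReal ((0 + (G₁.map w).sum - s * (G.map w).sum) ^ 2) * ENNReal.ofReal (1 / y ^ 2) := by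
    intro G₁
    refine ind_le_of fun hlt => ?_
    rw [degree_eq_sum, degree_eq_sum] at hlt
    rw [← ENNReal.ofReal_mul (by positivity), ENNReal.one_le_ofReal, mul_one_div,
      one_le_div (by positivity), zero_add, ← sq_abs ((G₁.map w).sum - s * (G.map w).sum)]
    exact pow_le_pow_left₀ hy.le hlt.le 2
  -- Self-loops have weight two, hence `w^2 ≤ 2 w`.
  have h4 : (G.map fun a => w a ^ 2).sum ≤ 2 * (degree G u : ℝ) := by
    rw [degree_eq_sum, ← List.sum_map_mul_left]
    apply List.sum_le_sum
    intro e _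
    simp only [hw]
    split_ifs <;> norm_num
  have h5 : 0 ≤ (G.map fun a => w a ^ 2).sum :=
    List.sum_nonneg fun x hx => by
      obtain ⟨b, -, rfl⟩ := List.mem_map.1 hx
      positivity
  have h6 : (s : ℝ) * (1 - s) ≤ 1 := by nlinarith
  have h7 : 0 ≤ (s : ℝ) * (1 - s) := mul_nonneg h1 h2
  refine (Ex_mono h3).trans ?_
  rw [Ex_mul_const, h, ← ENNReal.ofReal_natCast, ← ENNReal.ofReal_mul (by positivity),
    ← ENNReal.ofReal_mul (Nat.cast_nonneg _)]
  apply ENNReal.ofReal_le_ofReal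
  rw [mul_one_div, mul_div_assoc']
  gcongr
  nlinarith

/-! ### Growing the graph together with its two copies -/

theorem Ex₂_comm {α β : Type} (p : I) (G : List α) (μ : PMF β)
    (f : β → List α → List α → ℝ≥0∞) :
    Ex₂ p G (fun G₁ G₂ => Ex μ fun b => f b G₁ G₂) = Ex μ fun b => Ex₂ p G (f b) := by
  have h : ∀ G₁, (Ex (thin p G) fun G₂ => Ex μ fun b => f b G₁ G₂) =
      Ex μ fun b => Ex (thin p G) fun G₂ => f b G₁ G₂ := fun G₁ => Ex_comm _ _ _
  unfold Ex₂
  simp only [h]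
  rw [Ex_comm]

/-- The node `u` issues `i` edges, and each copy keeps each of them with probability `s`. -/
noncomputable def addEdgesCopies (s : I) (u : ℕ) : ℕ → EdgeList ℕ → EdgeList ℕ → EdgeList ℕ →
    PMF (EdgeList ℕ × EdgeList ℕ × EdgeList ℕ)
  | 0, G, G₁, G₂ => PMF.pure (G, G₁, G₂)
  | i + 1, G, G₁, G₂ => (attachN G u).bind fun v => (coin s).bind fun b₁ => (coin s).bind fun b₂ =>
      addEdgesCopies s u i ((u, v) :: G) (if b₁ then (u, v) :: G₁ else G₁)
        (if b₂ then (u, v) :: G₂ else G₂)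

theorem Ex_addEdgesCopies_zero (s : I) (u : ℕ) (G G₁ G₂ : EdgeList ℕ)
    (f : EdgeList ℕ × EdgeList ℕ × EdgeList ℕ → ℝ≥0∞) :
    Ex (addEdgesCopies s u 0 G G₁ G₂) f = f (G, G₁, G₂) := by
  rw [addEdgesCopies, Ex_pure]

theorem Ex_addEdgesCopies_succ (s : I) (u i : ℕ) (G G₁ G₂ : EdgeList ℕ)
    (f : EdgeList ℕ × EdgeList ℕ × EdgeList ℕ → ℝ≥0∞) :
    Ex (addEdgesCopies s u (i + 1) G G₁ G₂) f =
      Ex (attachN G u) fun v => Ex (coin s) fun b₁ => Ex (coin s) fun b₂ =>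
        Ex (addEdgesCopies s u i ((u, v) :: G) (if b₁ then (u, v) :: G₁ else G₁)
          (if b₂ then (u, v) :: G₂ else G₂)) f := by
  rw [addEdgesCopies]
  simp only [Ex_bind]

/-- The thinning coins are independent of the attachment, so they may be tossed as the edges arrive.
The graph and its copies then form one growing process, and events can be conditioned on its past.
-/
theorem Ex_addEdgesN_Ex₂ (s : I) (u i : ℕ) (G : EdgeList ℕ)
    (f : EdgeList ℕ → EdgeList ℕ → EdgeList ℕ → ℝ≥0∞) :
    Ex (addEdgesN u i G) (fun G' => Ex₂ s G' (f G')) =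
      Ex₂ s G fun G₁ G₂ => Ex (addEdgesCopies s u i G G₁ G₂) fun T => f T.1 T.2.1 T.2.2 := by
  induction i generalizing G with
  | zero => simp only [Ex_addEdgesN_zero, Ex_addEdgesCopies_zero]
  | succ i ih =>
    simp only [Ex_addEdgesN_succ, Ex_addEdgesCopies_succ, ih, Ex₂_cons, Ex₂_comm]

theorem Ex_addEdgesCopies_fst (s : I) (u i : ℕ) (G G₁ G₂ : EdgeList ℕ) (f : EdgeList ℕ → ℝ≥0∞) :
    Ex (addEdgesCopies s u i G G₁ G₂) (fun T => f T.1) = Ex (addEdgesN u i G) f := by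
  induction i generalizing G G₁ G₂ with
  | zero => rw [Ex_addEdgesN_zero, Ex_addEdgesCopies_zero]
  | succ i ih => simp only [Ex_addEdgesN_succ, Ex_addEdgesCopies_succ, ih, Ex_const]

theorem mem_support_addEdgesCopies {s : I} {u i : ℕ} {G G₁ G₂ : EdgeList ℕ}
    {T : EdgeList ℕ × EdgeList ℕ × EdgeList ℕ}
    (h : T ∈ (addEdgesCopies s u i G G₁ G₂).support) :
    (∃ F : EdgeList ℕ, T.1 = F ++ G ∧ F.length = i ∧ ∀ e ∈ F, e.1 = u) ∧
      (∀ e ∈ G₁, e ∈ T.2.1) ∧ ∀ e ∈ G₂, e ∈ T.2.2 := by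
  induction i generalizing G G₁ G₂ with
  | zero =>
    rw [addEdgesCopies, PMF.mem_support_pure_iff] at h
    subst h
    exact ⟨⟨[], by simp⟩, fun _ h => h, fun _ h => h⟩
  | succ i ih =>
    simp only [addEdgesCopies, PMF.mem_support_bind_iff] at h
    obtain ⟨v, -, b₁, -, b₂, -, h⟩ := h
    obtain ⟨⟨F, h1, h2, h3⟩, h4, h5⟩ := ih h
    refine ⟨⟨F ++ [(u, v)], by simp [h1], by simp [h2], ?_⟩, fun e he => h4 e ?_, fun e he => h5 e ?_⟩
    · intro e he
      rw [List.mem_append, List.mem_singleton] at he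
      rcases he with he | rfl
      · exact h3 e he
      · rfl
    · cases b₁ <;> simp [he]
    · cases b₂ <;> simp [he]

/-! ### Probability of missing a set of nodes -/

theorem Ex_attachN_mem (G : EdgeList ℕ) (u : ℕ) (B : Finset ℕ) :
    Ex (attachN G u) (fun v => ind (v ∈ B)) =
      ((∑ v ∈ B, (degree G v + if v = u then 1 else 0) : ℕ) : ℝ≥0∞) /
        ((2 * G.length + 1 : ℕ) : ℝ≥0∞) := by
  unfold Ex
  rw [tsum_eq_sum (s := B)]
  · simp only [attachN_apply, div_eq_mul_inv]
    rw [Nat.cast_sum, Finset.sum_mul]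
    refine Finset.sum_congr rfl fun v hv => ?_
    rw [ind_true hv, mul_one]
  · intro v hv
    simp only [ind_false hv, mul_zero]

theorem sum_degree_cons_le (B : Finset ℕ) (e : ℕ × ℕ) (G : EdgeList ℕ) :
    ∑ v ∈ B, degree (e :: G) v ≤ ∑ v ∈ B, degree G v + 2 := by
  simp only [degree_cons, Finset.sum_add_distrib, Finset.sum_ite_eq]
  split_ifs <;> omega

/-- The expected number of new edges into `B`. -/
theorem Ex_addEdgesN_countP_le {u : ℕ} (B : Finset ℕ) {e₀ W : ℕ} (i : ℕ) (G : EdgeList ℕ)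
    (hG : e₀ ≤ G.length) (hW : ∑ v ∈ B, degree G v + 2 * i + 1 ≤ W) :
    Ex (addEdgesN u i G) (fun G' => (G'.countP (fun e => e.1 = u ∧ e.2 ∈ B) : ℝ≥0∞)) ≤
      G.countP (fun e => e.1 = u ∧ e.2 ∈ B) + i * ((W : ℝ≥0∞) / ((2 * e₀ + 1 : ℕ) : ℝ≥0∞)) := by
  induction i generalizing G with
  | zero => simp [Ex_addEdgesN_zero]
  | succ i ih =>
    rw [Ex_addEdgesN_succ]
    have h1 : ∀ v, Ex (addEdgesN u i ((u, v) :: G))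
        (fun G' => (G'.countP (fun e => e.1 = u ∧ e.2 ∈ B) : ℝ≥0∞)) ≤
        ind (v ∈ B) + (G.countP (fun e => e.1 = u ∧ e.2 ∈ B) +
          i * ((W : ℝ≥0∞) / ((2 * e₀ + 1 : ℕ) : ℝ≥0∞))) := by
      intro v
      refine (ih ((u, v) :: G) (by simp; omega) ?_).trans (le_of_eq ?_)
      · have := sum_degree_cons_le B (u, v) G
        omega
      · rw [List.countP_cons]
        by_cases hv : v ∈ B
        · simp only [hv, and_self, decide_true, if_true, ind_true]
          push_cast
          ring
        · simp [hv, ind]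
    refine (Ex_mono h1).trans ?_
    rw [Ex_add, Ex_const, Ex_attachN_mem]
    have h2 : ((∑ v ∈ B, (degree G v + if v = u then 1 else 0) : ℕ) : ℝ≥0∞) /
        ((2 * G.length + 1 : ℕ) : ℝ≥0∞) ≤ (W : ℝ≥0∞) / ((2 * e₀ + 1 : ℕ) : ℝ≥0∞) := by
      refine ENNReal.div_le_div ?_ ?_
      · rw [Nat.cast_le, Finset.sum_add_distrib, Finset.sum_ite_eq']
        split_ifs <;> omega
      · rw [Nat.cast_le]
        omega
    refine (add_le_add_left h2 _).trans (le_of_eq ?_)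
    push_cast
    ring

/-- As `ρ ≤ 1`, the expectation decreases in the hitting probability, so a lower bound `p` for it
suffices. -/
theorem Ex_attachN_mixture_le {G : EdgeList ℕ} {u : ℕ} {B : Finset ℕ} {p ρ : ℝ} (hp : 0 ≤ p)
    (hρ0 : 0 ≤ ρ) (hρ : ρ ≤ 1) (h : ENNReal.ofReal p ≤ Ex (attachN G u) fun v => ind (v ∈ B)) :
    Ex (attachN G u) (fun v => if v ∈ B then ENNReal.ofReal ρ else 1) ≤
      ENNReal.ofReal (1 - p * (1 - ρ)) := by
  rw [ENNReal.ofReal_sub _ (mul_nonneg hp (by linarith)), ENNReal.ofReal_one]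
  apply ENNReal.le_sub_of_add_le_right ENNReal.ofReal_ne_top
  calc Ex (attachN G u) (fun v => if v ∈ B then ENNReal.ofReal ρ else 1) +
        ENNReal.ofReal (p * (1 - ρ))
      ≤ Ex (attachN G u) (fun v => if v ∈ B then ENNReal.ofReal ρ else 1) +
        Ex (attachN G u) (fun v => ind (v ∈ B) * ENNReal.ofReal (1 - ρ)) := by
        rw [ENNReal.ofReal_mul hp, Ex_mul_const]
        gcongr
    _ = Ex (attachN G u) (fun _ => 1) := by
        rw [← Ex_add]
        congr 1
        ext v
        by_cases hv : v ∈ B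
        · rw [if_pos hv, ind_true hv, one_mul, ← ENNReal.ofReal_add hρ0 (by linarith)]
          simp
        · rw [if_neg hv, ind_false hv, zero_mul, add_zero]
    _ = 1 := Ex_const _ _

theorem Ex_coin_coin (s : I) {z : ℝ} (hz : 0 ≤ z) (c : ℝ≥0∞) :
    Ex (coin s) (fun b₁ => Ex (coin s) fun b₂ => if b₁ ∧ b₂ then ENNReal.ofReal z * c else c) =
      ENNReal.ofReal (1 - (s : ℝ) ^ 2 * (1 - z)) * c := by
  have h1 := s.2.1
  have h2 := s.2.2
  have h : ∀ b₁ : Bool, (Ex (coin s) fun b₂ => if b₁ ∧ b₂ then ENNReal.ofReal z * c else c) =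
      if b₁ then ENNReal.ofReal (1 - s * (1 - z)) * c else c := by
    intro b₁
    cases b₁
    · simp [Ex_const]
    · simpa using Ex_coin_mul s hz c
  simp only [h]
  rw [Ex_coin_mul s (by nlinarith)]
  congr 2
  ring

/-- The number of nodes of `A` that are joined to `u` by an edge from `u` in both copies. -/
def hitCount (u : ℕ) (A : Finset ℕ) (G₁ G₂ : EdgeList ℕ) : ℕ :=
  (A.filter fun a => (u, a) ∈ G₁ ∧ (u, a) ∈ G₂).card

theorem hitCount_mono {u : ℕ} {A : Finset ℕ} {G₁ G₂ H₁ H₂ : EdgeList ℕ}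
    (h1 : ∀ e ∈ G₁, e ∈ H₁) (h2 : ∀ e ∈ G₂, e ∈ H₂) : hitCount u A G₁ G₂ ≤ hitCount u A H₁ H₂ := by
  apply Finset.card_le_card
  intro a ha
  rw [Finset.mem_filter] at ha ⊢
  exact ⟨ha.1, h1 _ ha.2.1, h2 _ ha.2.2⟩

/-- Whatever set `C` has been hit so far, a proportion at least `p` of the attachment weight sits on
fresh nodes of `A`, and an edge survives in both copies with probability `s^2`. So every edge
contributes a factor as if the trials were independent. The frozen degrees `d` bound the current
ones from below. -/
theorem Ex_pow_hitCount_le {s : I} {u m N : ℕ} {A : Finset ℕ} {d : ℕ → ℕ} {p z : ℝ} (hp : 0 ≤ p)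
    (hz : 0 ≤ z) (hz1 : z ≤ 1) (hA : ∀ C ⊆ A, C.card ≤ m → p * N ≤ ∑ v ∈ A \ C, (d v : ℝ))
    (i : ℕ) (G G₁ G₂ : EdgeList ℕ) (hd : ∀ v, d v ≤ degree G v)
    (hlen : 2 * (G.length + i) + 1 ≤ N) (hi : hitCount u A G₁ G₂ + i ≤ m) :
    Ex (addEdgesCopies s u i G G₁ G₂) (fun T => ENNReal.ofReal z ^ hitCount u A T.2.1 T.2.2) ≤
      ENNReal.ofReal (1 - p * ((s : ℝ) ^ 2 * (1 - z))) ^ i *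
        ENNReal.ofReal z ^ hitCount u A G₁ G₂ := by
  have hs0 := s.2.1
  have hs1 := s.2.2
  have hzE : ENNReal.ofReal z ≤ 1 := ENNReal.ofReal_le_one.2 hz1
  set κ := ENNReal.ofReal (1 - p * ((s : ℝ) ^ 2 * (1 - z))) with hκ
  set ρ : ℝ := 1 - (s : ℝ) ^ 2 * (1 - z) with hρ
  have hs2 : (s : ℝ) ^ 2 ≤ 1 := by nlinarith
  have hρ0 : 0 ≤ ρ := by nlinarith [sq_nonneg (s : ℝ)]
  have hρ1 : ρ ≤ 1 := by nlinarith [sq_nonneg (s : ℝ)]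
  induction i generalizing G G₁ G₂ with
  | zero => simp [Ex_addEdgesCopies_zero]
  | succ i ih =>
    rw [Ex_addEdgesCopies_succ]
    set C := A.filter fun a => (u, a) ∈ G₁ ∧ (u, a) ∈ G₂ with hC
    have hCcard : C.card = hitCount u A G₁ G₂ := rfl
    set X := hitCount u A G₁ G₂ with hX
    have hdeg : ∀ v w, d w ≤ degree ((u, v) :: G) w := by
      intro v w
      rw [degree_cons]
      exact (hd w).trans (Nat.le_add_right _ _)
    have hstep : ∀ (v : ℕ) (b₁ b₂ : Bool),
        Ex (addEdgesCopies s u i ((u, v) :: G) (if b₁ then (u, v) :: G₁ else G₁)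
          (if b₂ then (u, v) :: G₂ else G₂))
          (fun T => ENNReal.ofReal z ^ hitCount u A T.2.1 T.2.2) ≤
        if v ∈ A \ C then (if b₁ ∧ b₂ then ENNReal.ofReal z * (κ ^ i * ENNReal.ofReal z ^ X) else
          κ ^ i * ENNReal.ofReal z ^ X) else κ ^ i * ENNReal.ofReal z ^ X := by
      intro v b₁ b₂
      set H₁ := (if b₁ then (u, v) :: G₁ else G₁) with hH₁
      set H₂ := (if b₂ then (u, v) :: G₂ else G₂) with hH₂
      have hm1 : ∀ e ∈ G₁, e ∈ H₁ := by
        intro e he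
        rw [hH₁]
        cases b₁ <;> simp [he]
      have hm2 : ∀ e ∈ G₂, e ∈ H₂ := by
        intro e he
        rw [hH₂]
        cases b₂ <;> simp [he]
      have hmono : X ≤ hitCount u A H₁ H₂ := hitCount_mono hm1 hm2
      have hle : hitCount u A H₁ H₂ ≤ X + 1 := by
        rw [← hCcard]
        refine le_trans (Finset.card_le_card (t := insert v C) ?_) (Finset.card_insert_le _ _)
        intro a ha
        rw [Finset.mem_filter] at ha
        rw [Finset.mem_insert, hC, Finset.mem_filter]
        by_cases hav : a = v
        · exact Or.inl hav
        · right
          refine ⟨ha.1, ?_, ?_⟩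
          · have := ha.2.1
            rw [hH₁] at this
            cases b₁ <;> simpa [hav] using this
          · have := ha.2.2
            rw [hH₂] at this
            cases b₂ <;> simpa [hav] using this
      have hmain := ih ((u, v) :: G) H₁ H₂ (hdeg v) (by simp; omega) (by omega)
      have hweak : κ ^ i * ENNReal.ofReal z ^ hitCount u A H₁ H₂ ≤
          κ ^ i * ENNReal.ofReal z ^ X := by
        gcongr κ ^ i * ?_
        exact pow_le_pow_right_of_le_one' hzE hmono
      by_cases hv : v ∈ A \ C
      · rw [if_pos hv]
        by_cases hb : b₁ = true ∧ b₂ = true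
        · rw [if_pos hb]
          refine hmain.trans (le_of_eq ?_)
          have hX1 : hitCount u A H₁ H₂ = X + 1 := by
            refine le_antisymm hle ?_
            rw [Finset.mem_sdiff] at hv
            rw [← hCcard, ← Finset.card_insert_of_notMem hv.2]
            apply Finset.card_le_card
            intro a ha
            rw [Finset.mem_insert] at ha
            rw [Finset.mem_filter]
            rcases ha with rfl | ha
            · exact ⟨hv.1, by rw [hH₁, hb.1]; simp, by rw [hH₂, hb.2]; simp⟩
            · rw [hC, Finset.mem_filter] at ha
              exact ⟨ha.1, hm1 _ ha.2.1, hm2 _ ha.2.2⟩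
          rw [hX1, pow_succ]
          ring
        · rw [if_neg hb]
          exact hmain.trans hweak
      · rw [if_neg hv]
        exact hmain.trans hweak
    have hinner : ∀ v, (Ex (coin s) fun b₁ => Ex (coin s) fun b₂ =>
        Ex (addEdgesCopies s u i ((u, v) :: G) (if b₁ then (u, v) :: G₁ else G₁)
          (if b₂ then (u, v) :: G₂ else G₂))
          (fun T => ENNReal.ofReal z ^ hitCount u A T.2.1 T.2.2)) ≤
        (if v ∈ A \ C then ENNReal.ofReal ρ else 1) * (κ ^ i * ENNReal.ofReal z ^ X) := by
      intro v
      refine (Ex_mono fun b₁ => Ex_mono fun b₂ => hstep v b₁ b₂).trans ?_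
      by_cases hv : v ∈ A \ C
      · simp only [if_pos hv]
        rw [Ex_coin_coin s hz]
      · simp only [if_neg hv, Ex_const, one_mul, le_refl]
    refine (Ex_mono hinner).trans ?_
    rw [Ex_mul_const]
    have hfresh : ENNReal.ofReal p ≤ Ex (attachN G u) fun v => ind (v ∈ A \ C) := by
      rw [Ex_attachN_mem, ENNReal.le_div_iff_mul_le (Or.inl (by simp)) (Or.inl (ENNReal.natCast_ne_top _)),
        ← ENNReal.ofReal_natCast, ← ENNReal.ofReal_natCast, ← ENNReal.ofReal_mul hp]
      apply ENNReal.ofReal_le_ofReal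
      calc p * ((2 * G.length + 1 : ℕ) : ℝ) ≤ p * N := by
            gcongr
            omega
        _ ≤ ∑ v ∈ A \ C, (d v : ℝ) := hA C (Finset.filter_subset _ _) (by omega)
        _ ≤ _ := by
            push_cast
            refine Finset.sum_le_sum fun v _ => ?_
            have h1 : (d v : ℝ) ≤ degree G v := by exact_mod_cast hd v
            have h2 : (0 : ℝ) ≤ if v = u then 1 else 0 := by split_ifs <;> norm_num
            linarith
    have hmix := Ex_attachN_mixture_le (u := u) hp hρ0 hρ1 hfresh
    have hκρ : 1 - p * (1 - ρ) = 1 - p * ((s : ℝ) ^ 2 * (1 - z)) := by rw [hρ]; ring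
    rw [hκρ] at hmix
    calc _ ≤ κ * (κ ^ i * ENNReal.ofReal z ^ X) := by gcongr
      _ = _ := by rw [pow_succ']; ring

/-! ### Nodes reached by chains of witnesses -/

/-- The nodes which are reached from the nodes below `U` by repeatedly using nine witnesses, each
substantially older than the node itself and joined to it by an edge it issued. -/
inductive Reached (U : ℕ) (G₁ G₂ : EdgeList ℕ) : ℕ → Prop
  | early {v : ℕ} (hv : v < U) : Reached U G₁ G₂ v
  | step {v : ℕ} (A : Finset ℕ) (hcard : 9 ≤ A.card) (h1 : ∀ a ∈ A, (v, a) ∈ G₁)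
      (h2 : ∀ a ∈ A, (v, a) ∈ G₂) (hold : ∀ a ∈ A, 101 * a ≤ 100 * v)
      (hA : ∀ a ∈ A, Reached U G₁ G₂ a) : Reached U G₁ G₂ v

theorem Reached.mono {U : ℕ} {G₁ G₂ H₁ H₂ : EdgeList ℕ} (h1 : ∀ e ∈ G₁, e ∈ H₁)
    (h2 : ∀ e ∈ G₂, e ∈ H₂) {v : ℕ} (hv : Reached U G₁ G₂ v) : Reached U H₁ H₂ v := by
  induction hv with
  | early hv => exact .early hv
  | step A hcard a1 a2 hold _ ih =>
    exact .step A hcard (fun a ha => h1 _ (a1 a ha)) (fun a ha => h2 _ (a2 a ha)) hold ih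

noncomputable instance (U : ℕ) (G₁ G₂ : EdgeList ℕ) : DecidablePred (Reached U G₁ G₂) :=
  fun _ => Classical.propDecidable _

/-- The nodes among the first `n` which are not reached. -/
noncomputable def unreached (U n : ℕ) (G₁ G₂ : EdgeList ℕ) : Finset ℕ :=
  (Finset.range n).filter fun v => ¬Reached U G₁ G₂ v

/-- The total degree of the nodes which are not reached. -/
noncomputable def badWeight (U n : ℕ) (G G₁ G₂ : EdgeList ℕ) : ℕ :=
  ∑ v ∈ unreached U n G₁ G₂, degree G v

/-- The reached nodes substantially older than `n`. -/
noncomputable def eligible (U n : ℕ) (G₁ G₂ : EdgeList ℕ) : Finset ℕ :=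
  (Finset.range n).filter fun v => Reached U G₁ G₂ v ∧ 101 * v ≤ 100 * n

/-! ### Total degree of reached, unreached and young nodes -/

theorem sum_degree_range {m n : ℕ} {G : EdgeList ℕ} (hG : IsGrown m n G) :
    ∑ v ∈ Finset.range n, degree G v = 2 * (m * n) := by
  have h := sum_degree_mul (s := Finset.range n) (E := G) (fun e he => by
    have h1 := hG.source_lt e he
    have h2 := hG.target_le e he
    simp only [Finset.mem_range]
    omega) (fun _ => 1)
  simp only [mul_one, List.map_const', List.sum_replicate, hG.length_eq] at h
  have h' : ((∑ v ∈ Finset.range n, degree G v : ℕ) : ℝ≥0∞) = ((2 * (m * n) : ℕ) : ℝ≥0∞) := by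
    push_cast
    rw [h, nsmul_eq_mul]
    push_cast
    ring
  exact_mod_cast h'

theorem sum_countP_source (B : Finset ℕ) (G : EdgeList ℕ) :
    ∑ v ∈ B, G.countP (fun e => e.1 = v) = G.countP fun e => e.1 ∈ B := by
  induction G with
  | nil => simp
  | cons e G ih =>
    simp only [List.countP_cons, Finset.sum_add_distrib, ih, decide_eq_true_eq]
    rw [Finset.sum_ite_eq]

theorem sum_countP_target (B : Finset ℕ) (G : EdgeList ℕ) :
    ∑ v ∈ B, G.countP (fun e => e.2 = v) = G.countP fun e => e.2 ∈ B := by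
  induction G with
  | nil => simp
  | cons e G ih =>
    simp only [List.countP_cons, Finset.sum_add_distrib, ih, decide_eq_true_eq]
    rw [Finset.sum_ite_eq]

/-- The youngest nodes carry little degree. -/
theorem IsGrown.sum_degree_Ico_le {m n : ℕ} {G : EdgeList ℕ} (hG : IsGrown m n G) (a : ℕ) :
    ∑ v ∈ Finset.Ico a n, degree G v ≤ 2 * (m * (n - a)) := by
  have h1 : ∑ v ∈ Finset.Ico a n, G.countP (fun e => e.1 = v) = m * (n - a) := by
    rw [Finset.sum_congr rfl fun v hv => hG.count_source v (Finset.mem_Ico.1 hv).2]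
    simp [mul_comm]
  have h2 : ∑ v ∈ Finset.Ico a n, G.countP (fun e => e.2 = v) ≤ m * (n - a) := by
    rw [← h1, sum_countP_source, sum_countP_target]
    apply List.countP_mono_left
    intro e he h
    simp only [decide_eq_true_eq, Finset.mem_Ico] at h ⊢
    have := hG.source_lt e he
    have := hG.target_le e he
    omega
  unfold degree
  rw [Finset.sum_add_distrib]
  omega

/-- The total degree `2 m n` is shared by the eligible nodes, the unreached ones and the youngest
`n/101 + 1` at most; the last group carries at most `2 m` per node, by `sum_degree_Ico_le`. -/
theorem sum_degree_eligible {U m n : ℕ} {G G₁ G₂ : EdgeList ℕ} (hG : IsGrown m n G) :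
    (2 - 2 / 101 : ℝ) * (m * n) ≤ ∑ v ∈ eligible U n G₁ G₂, (degree G v : ℝ) +
      badWeight U n G G₁ G₂ + 2 * m := by
  have hsub : Finset.range n ⊆
      eligible U n G₁ G₂ ∪ (unreached U n G₁ G₂ ∪ Finset.Ico (100 * n / 101) n) := by
    intro v hv
    rw [Finset.mem_union, Finset.mem_union, eligible, unreached, Finset.mem_filter,
      Finset.mem_filter, Finset.mem_Ico]
    rw [Finset.mem_range] at hv
    by_cases hr : Reached U G₁ G₂ v
    · by_cases h : 101 * v ≤ 100 * n
      · exact Or.inl ⟨Finset.mem_range.2 hv, hr, h⟩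
      · right; right
        omega
    · exact Or.inr (Or.inl ⟨Finset.mem_range.2 hv, hr⟩)
  have h1 : ∑ v ∈ Finset.range n, degree G v ≤ ∑ v ∈ eligible U n G₁ G₂, degree G v +
      (badWeight U n G G₁ G₂ + ∑ v ∈ Finset.Ico (100 * n / 101) n, degree G v) := by
    refine (Finset.sum_le_sum_of_subset hsub).trans ?_
    refine (Finset.sum_union_inter (s₁ := eligible U n G₁ G₂) (f := degree G) ▸
      Nat.le_add_right _ _ : _ ≤ _).trans ?_
    refine Nat.add_le_add_left ?_ _
    exact (Finset.sum_union_inter (s₁ := unreached U n G₁ G₂) (f := degree G) ▸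
      Nat.le_add_right _ _ : _ ≤ _)
  rw [sum_degree_range hG] at h1
  have h2 := hG.sum_degree_Ico_le (100 * n / 101)
  have h3 : (n - 100 * n / 101) * 101 ≤ n + 101 := by omega
  have h4 : 2 * (m * (n - 100 * n / 101)) * 101 ≤ 2 * (m * n) + 202 * m := by nlinarith
  have h5 : 2 * (m * n) * 101 ≤ (∑ v ∈ eligible U n G₁ G₂, degree G v) * 101 +
      badWeight U n G G₁ G₂ * 101 + (2 * (m * n) + 202 * m) := by nlinarith
  have h6 : (2 : ℝ) * (m * n) * 101 ≤ (∑ v ∈ eligible U n G₁ G₂, (degree G v : ℝ)) * 101 +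
      badWeight U n G G₁ G₂ * 101 + (2 * (m * n) + 202 * m) := by exact_mod_cast h5
  linarith

theorem IsGrown.degree_eq_zero {m n v : ℕ} {G : EdgeList ℕ} (hG : IsGrown m n G) (hv : n ≤ v) :
    degree G v = 0 := by
  by_contra h
  exact absurd (hG.lt_of_degree_pos (Nat.pos_of_ne_zero h)) (by omega)

theorem sum_degree_append {u : ℕ} {B : Finset ℕ} (hB : u ∉ B) {F G : EdgeList ℕ}
    (hF : ∀ e ∈ F, e.1 = u) :
    ∑ v ∈ B, degree (F ++ G) v = ∑ v ∈ B, degree G v + F.countP fun e => e.2 ∈ B := by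
  simp only [degree_append, Finset.sum_add_distrib]
  rw [add_comm]
  congr 1
  unfold degree
  rw [Finset.sum_add_distrib, sum_countP_source, sum_countP_target]
  have : F.countP (fun e => e.1 ∈ B) = 0 := by
    rw [List.countP_eq_zero]
    intro e he
    simp only [decide_eq_true_eq]
    rw [hF e he]
    exact hB
  omega

/-- How the bad weight changes when a node is added. -/
theorem badWeight_succ_le {s : I} {U m n : ℕ} {G G₁ G₂ : EdgeList ℕ} (hG : IsGrown m n G)
    {T : EdgeList ℕ × EdgeList ℕ × EdgeList ℕ}
    (hT : T ∈ (addEdgesCopies s n m G G₁ G₂).support) :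
    (badWeight U (n + 1) T.1 T.2.1 T.2.2 : ℝ≥0∞) ≤ badWeight U n G G₁ G₂ +
        (T.1.countP (fun e => e.1 = n ∧ e.2 ∈ insert n (unreached U n G₁ G₂)) +
          m * ind (hitCount n (eligible U n G₁ G₂) T.2.1 T.2.2 < 9)) ∧
      T.1.countP (fun e => e.1 = n ∧ e.2 ∈ insert n (unreached U n G₁ G₂)) ≤ m := by
  obtain ⟨⟨F, hF, hFm, hFn⟩, h1, h2⟩ := mem_support_addEdgesCopies hT
  set B := unreached U n G₁ G₂ with hB
  have hBn : n ∉ B := by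
    rw [hB, unreached, Finset.mem_filter, Finset.mem_range]
    omega
  have hcount : T.1.countP (fun e => e.1 = n ∧ e.2 ∈ insert n B) =
      F.countP fun e => e.2 ∈ insert n B := by
    rw [hF, List.countP_append]
    have hG0 : G.countP (fun e => e.1 = n ∧ e.2 ∈ insert n B) = 0 := by
      rw [List.countP_eq_zero]
      intro e he
      have := hG.source_lt e he
      simp only [decide_eq_true_eq]
      omega
    rw [hG0, add_zero]
    apply List.countP_congr
    intro e he
    simp [hFn e he]
  rw [hcount]
  refine ⟨?_, hFm ▸ List.countP_le_length⟩
  have hBsum : ∑ v ∈ B, degree T.1 v = badWeight U n G G₁ G₂ + F.countP fun e => e.2 ∈ B := by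
    rw [hF, sum_degree_append hBn hFn]
    rfl
  -- With fewer than nine hits the new node may stay unreached and brings its degree: `m` issued
  -- ends, plus its self-loop ends, which are counted because `n` is inserted in `B`. Otherwise
  -- weight enters only through edges to older unreached nodes.
  by_cases h9 : hitCount n (eligible U n G₁ G₂) T.2.1 T.2.2 < 9
  · rw [ind_true h9, mul_one]
    have hsub : unreached U (n + 1) T.2.1 T.2.2 ⊆ insert n B := by
      intro v hv
      rw [unreached, Finset.mem_filter, Finset.mem_range] at hv
      rw [Finset.mem_insert, hB, unreached, Finset.mem_filter, Finset.mem_range]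
      by_cases hvn : v = n
      · exact Or.inl hvn
      · exact Or.inr ⟨by omega, fun h => hv.2 (h.mono h1 h2)⟩
    have h3 : badWeight U (n + 1) T.1 T.2.1 T.2.2 ≤ ∑ v ∈ insert n B, degree T.1 v :=
      Finset.sum_le_sum_of_subset hsub
    have hdn : degree T.1 n = m + F.countP fun e => e.2 = n := by
      rw [hF, degree_append, hG.degree_eq_zero le_rfl, add_zero]
      unfold degree
      congr 1
      rw [← hFm, List.countP_eq_length]
      intro e he
      simp [hFn e he]
    rw [Finset.sum_insert hBn, hBsum, hdn] at h3
    have h4 : (F.countP fun e => e.2 ∈ insert n B) =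
        (F.countP fun e => e.2 = n) + F.countP fun e => e.2 ∈ B := by
      rw [← sum_countP_target, Finset.sum_insert hBn, sum_countP_target]
    rw [h4]
    have h5 : badWeight U (n + 1) T.1 T.2.1 T.2.2 ≤ badWeight U n G G₁ G₂ +
      (((F.countP fun e => e.2 = n) + F.countP fun e => e.2 ∈ B) + m) := by omega
    exact_mod_cast h5
  · rw [ind_false h9, mul_zero, add_zero]
    have hn : Reached U T.2.1 T.2.2 n := by
      refine .step ((eligible U n G₁ G₂).filter fun a => (n, a) ∈ T.2.1 ∧ (n, a) ∈ T.2.2)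
        (not_lt.1 h9) ?_ ?_ ?_ ?_
      · exact fun a ha => (Finset.mem_filter.1 ha).2.1
      · exact fun a ha => (Finset.mem_filter.1 ha).2.2
      · intro a ha
        exact (Finset.mem_filter.1 (Finset.mem_filter.1 ha).1).2.2
      · intro a ha
        exact ((Finset.mem_filter.1 (Finset.mem_filter.1 ha).1).2.1).mono h1 h2
    have hsub : unreached U (n + 1) T.2.1 T.2.2 ⊆ B := by
      intro v hv
      rw [unreached, Finset.mem_filter, Finset.mem_range] at hv
      rw [hB, unreached, Finset.mem_filter, Finset.mem_range]
      have hvn : v ≠ n := fun h => hv.2 (h ▸ hn)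
      exact ⟨by omega, fun h => hv.2 (h.mono h1 h2)⟩
    have h3 : badWeight U (n + 1) T.1 T.2.1 T.2.2 ≤ ∑ v ∈ B, degree T.1 v :=
      Finset.sum_le_sum_of_subset hsub
    rw [hBsum] at h3
    have h4 : (F.countP fun e => e.2 ∈ B) ≤ F.countP fun e => e.2 ∈ insert n B :=
      List.countP_mono_left fun e _ h => by simp only [decide_eq_true_eq] at h ⊢; simp [h]
    exact_mod_cast h3.trans (Nat.add_le_add_left h4 _)

/-! ### The probability that a new node has few witnesses -/

/-- Eligible nodes carry about `(2 - 2/101 - 3/100) m n`; discarding `m` nodes of degree at most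
`n/20` costs `m n / 20`, which leaves at least `10/11` of the total weight. With `z = 2/5` the
generating function is at most `exp(-(10/11)(3/5) m s^2) ≤ exp(-12)`, and Markov's inequality for
fewer than nine hits costs `(5/2)^8`. -/
theorem Ex_hitCount_lt_nine_le {s : I} {m n U : ℕ} (hms : 22 ≤ (m : ℝ) * (s : ℝ) ^ 2)
    (hn : 1000 ≤ n) {G G₁ G₂ : EdgeList ℕ} (hG : IsGrown m n G)
    (hnew : ∀ e ∈ G₁, e.1 ≠ n)
    (hbad : (badWeight U n G G₁ G₂ : ℝ) ≤ 3 / 100 * (m * n))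
    (hmax : ∀ x < n, 20 * degree G x ≤ n) :
    Ex (addEdgesCopies s n m G G₁ G₂)
      (fun T => ind (hitCount n (eligible U n G₁ G₂) T.2.1 T.2.2 < 9)) ≤
      ENNReal.ofReal (94 / 10000) := by
  have hs0 := s.2.1
  have hs1 := s.2.2
  have hn' : (1000 : ℝ) ≤ n := by exact_mod_cast hn
  have hm1 : (1 : ℝ) ≤ m := by nlinarith [sq_nonneg (s : ℝ)]
  set A := eligible U n G₁ G₂ with hA
  have hX0 : hitCount n A G₁ G₂ = 0 := by
    rw [hitCount, Finset.card_eq_zero, Finset.filter_eq_empty_iff]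
    rintro a - ⟨h, -⟩
    exact hnew _ h rfl
  have hfresh : ∀ C ⊆ A, C.card ≤ m →
      (10 / 11 : ℝ) * ((2 * (m * n + m) + 1 : ℕ) : ℝ) ≤ ∑ v ∈ A \ C, (degree G v : ℝ) := by
    intro C hC hCm
    have h1 := sum_degree_eligible (U := U) (G₁ := G₁) (G₂ := G₂) hG
    rw [← hA, ← Finset.sum_sdiff hC] at h1
    have h2 : ∑ v ∈ C, (degree G v : ℝ) ≤ m * (n / 20) := by
      calc ∑ v ∈ C, (degree G v : ℝ) ≤ ∑ _v ∈ C, (n / 20 : ℝ) := by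
            refine Finset.sum_le_sum fun v hv => ?_
            have hvn : v < n := by
              have := hC hv
              rw [hA, eligible, Finset.mem_filter, Finset.mem_range] at this
              exact this.1
            have h3 : (20 : ℝ) * degree G v ≤ n := by exact_mod_cast hmax v hvn
            linarith
        _ = C.card * (n / 20 : ℝ) := by rw [Finset.sum_const, nsmul_eq_mul]
        _ ≤ m * (n / 20 : ℝ) := by
            have : (C.card : ℝ) ≤ m := by exact_mod_cast hCm
            gcongr
    have h4 : (1000 : ℝ) * m ≤ m * n := by nlinarith
    push_cast
    nlinarith
  have hmain := Ex_pow_hitCount_le (s := s) (u := n) (m := m) (N := 2 * (m * n + m) + 1) (A := A)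
    (d := degree G) (p := 10 / 11) (z := 2 / 5) (by norm_num) (by norm_num) (by norm_num) hfresh m
    G G₁ G₂ (fun _ => le_rfl) (by rw [hG.length_eq]) (by rw [hX0, zero_add])
  rw [hX0, pow_zero, mul_one] at hmain
  have hs2 : (s : ℝ) ^ 2 ≤ 1 := by nlinarith
  have h3 : 0 ≤ 1 - 10 / 11 * ((s : ℝ) ^ 2 * (1 - 2 / 5)) := by nlinarith [sq_nonneg (s : ℝ)]
  rw [← ENNReal.ofReal_pow h3] at hmain
  have hexp : (1 - 10 / 11 * ((s : ℝ) ^ 2 * (1 - 2 / 5))) ^ m ≤ Real.exp (-12) := by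
    calc (1 - 10 / 11 * ((s : ℝ) ^ 2 * (1 - 2 / 5))) ^ m
        ≤ Real.exp (-(10 / 11 * ((s : ℝ) ^ 2 * (1 - 2 / 5)))) ^ m := by
          gcongr
          linarith [Real.add_one_le_exp (-(10 / 11 * ((s : ℝ) ^ 2 * (1 - 2 / 5))))]
      _ = Real.exp (m * -(10 / 11 * ((s : ℝ) ^ 2 * (1 - 2 / 5)))) := by rw [← Real.exp_nat_mul]
      _ ≤ Real.exp (-12) := by
          apply Real.exp_le_exp.2
          nlinarith
  have hnum : (5 / 2 : ℝ) ^ 8 * Real.exp (-12) ≤ 94 / 10000 := by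
    have h4 : Real.exp (-12) = (Real.exp 1 ^ 12)⁻¹ := by
      rw [← Real.exp_nat_mul, ← Real.exp_neg]
      norm_num
    have h5 : (2.7182 : ℝ) ^ 12 ≤ Real.exp 1 ^ 12 := by
      have := Real.exp_one_gt_d9
      gcongr
      linarith
    rw [h4, ← div_eq_mul_inv, div_le_iff₀ (by positivity)]
    refine le_trans ?_ (mul_le_mul_of_nonneg_left h5 (by norm_num))
    norm_num
  have hpt : ∀ X : ℕ, ind (X < 9) ≤ ENNReal.ofReal ((5 / 2) ^ 8) * ENNReal.ofReal (2 / 5) ^ X := by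
    intro X
    refine ind_le_of fun h => ?_
    have h6 : ENNReal.ofReal (2 / 5) ^ 8 ≤ ENNReal.ofReal (2 / 5) ^ X :=
      pow_le_pow_right_of_le_one' (ENNReal.ofReal_le_one.2 (by norm_num)) (by omega)
    refine le_trans ?_ (mul_le_mul_right h6 _)
    rw [← ENNReal.ofReal_pow (by norm_num), ← ENNReal.ofReal_mul (by norm_num)]
    norm_num
  refine (Ex_mono fun T => hpt _).trans ?_
  rw [Ex_const_mul]
  refine (mul_le_mul_right hmain _).trans ?_
  rw [← ENNReal.ofReal_mul (by positivity)]
  apply ENNReal.ofReal_le_ofReal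
  exact (mul_le_mul_of_nonneg_left hexp (by positivity)).trans hnum

/-! ### The bad weight stays small -/

/-- The exponential potential of the bad weight. -/
noncomputable def expPotential (m U n : ℕ) (G G₁ G₂ : EdgeList ℕ) : ℝ :=
  Real.exp ((badWeight U n G G₁ G₂ : ℝ) / (20 * m) - 15 / 10000 * n)

/-- One arrival changes the bad weight by at most `2 m`. Divided by `20 m` this is at most `1/10`,
where the exponential is linear up to the factor `11/10`. -/
theorem exp_le_one_add_mul {x : ℝ} (h0 : 0 ≤ x) (h1 : x ≤ 1 / 10) :
    Real.exp x ≤ 1 + 11 / 10 * x := by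
  have h := Real.abs_exp_sub_one_sub_id_le (x := x) (by rw [abs_of_nonneg h0]; linarith)
  have h2 := (abs_le.1 h).2
  nlinarith

theorem ofReal_expPotential_succ_le {m n D D' k : ℕ} {p : Prop} (hm : 1 ≤ m)
    (hk : k ≤ m) (hD : (D' : ℝ≥0∞) ≤ D + (k + m * ind p)) :
    ENNReal.ofReal (Real.exp ((D' : ℝ) / (20 * m) - 15 / 10000 * ((n + 1 : ℕ) : ℝ))) ≤
      ENNReal.ofReal (Real.exp ((D : ℝ) / (20 * m) - 15 / 10000 * n) * Real.exp (-(15 / 10000))) *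
        (1 + ENNReal.ofReal (11 / (200 * m)) * (k + m * ind p)) := by
  have hm0 : (0 : ℝ) < m := by exact_mod_cast hm
  obtain ⟨j, hj, hj2⟩ : ∃ j : ℕ, (k : ℝ≥0∞) + m * ind p = (j : ℕ) ∧ j ≤ 2 * m := by
    by_cases hp : p
    · exact ⟨k + m, by rw [ind_true hp]; push_cast; ring, by omega⟩
    · exact ⟨k, by rw [ind_false hp]; simp, by omega⟩
  rw [hj] at hD ⊢
  have hD' : D' ≤ D + j := by exact_mod_cast hD
  rw [← ENNReal.ofReal_natCast j, ← ENNReal.ofReal_mul (by positivity), ← ENNReal.ofReal_one,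
    ← ENNReal.ofReal_add (by norm_num) (by positivity), ← ENNReal.ofReal_mul (by positivity)]
  apply ENNReal.ofReal_le_ofReal
  have hj2' : (j : ℝ) ≤ 2 * m := by exact_mod_cast hj2
  have hD2 : (D' : ℝ) ≤ D + j := by exact_mod_cast hD'
  have hx := exp_le_one_add_mul (x := (j : ℝ) / (20 * m)) (by positivity) (by
    rw [div_le_div_iff₀ (by positivity) (by norm_num)]
    linarith)
  calc Real.exp ((D' : ℝ) / (20 * m) - 15 / 10000 * ((n + 1 : ℕ) : ℝ))
      ≤ Real.exp (((D : ℝ) / (20 * m) - 15 / 10000 * n) + -(15 / 10000) + (j : ℝ) / (20 * m)) := by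
        apply Real.exp_le_exp.2
        have h1 : (D' : ℝ) / (20 * m) ≤ (D + j) / (20 * m) := by gcongr
        rw [add_div] at h1
        push_cast
        linarith
    _ = Real.exp ((D : ℝ) / (20 * m) - 15 / 10000 * n) * Real.exp (-(15 / 10000)) *
          Real.exp ((j : ℝ) / (20 * m)) := by rw [Real.exp_add, Real.exp_add]
    _ ≤ _ := by
        gcongr
        refine hx.trans (le_of_eq ?_)
        field_simp
        ring

/-- The expected increment of the bad weight is at most `m (0.0165 + 0.0094)`: edges into nodes
holding `0.03 m n` of a total `2 m n`, with lower-order corrections, and failures of the new node.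
In the exponent this costs `1.1 · 0.0259 / 20 < 0.0015`, the compensating slope; and `0.0015 n` is
exactly the exponent of a bad weight `0.03 m n`, so the hypothesis sustains itself. -/
theorem Ex_expPotential_step {s : I} {m n U : ℕ} (hms : 22 ≤ (m : ℝ) * (s : ℝ) ^ 2)
    (hn : 1000 ≤ n) {G G₁ G₂ : EdgeList ℕ} (hG : IsGrown m n G) (hnew : ∀ e ∈ G₁, e.1 ≠ n)
    (hbad : (badWeight U n G G₁ G₂ : ℝ) ≤ 3 / 100 * (m * n))
    (hmax : ∀ x < n, 20 * degree G x ≤ n) :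
    Ex (addEdgesCopies s n m G G₁ G₂)
        (fun T => ENNReal.ofReal (expPotential m U (n + 1) T.1 T.2.1 T.2.2)) ≤
      ENNReal.ofReal (expPotential m U n G G₁ G₂) := by
  have hs0 := s.2.1
  have hs1 := s.2.2
  have hn' : (1000 : ℝ) ≤ n := by exact_mod_cast hn
  have hm1 : (1 : ℝ) ≤ m := by nlinarith [sq_nonneg (s : ℝ)]
  have hm : 1 ≤ m := by exact_mod_cast hm1
  set B := insert n (unreached U n G₁ G₂) with hB
  set Z := Real.exp ((badWeight U n G G₁ G₂ : ℝ) / (20 * m) - 15 / 10000 * n) with hZ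
  set r := Real.exp (-(15 / 10000) : ℝ) with hr
  have hpt : ∀ T ∈ (addEdgesCopies s n m G G₁ G₂).support,
      ENNReal.ofReal (expPotential m U (n + 1) T.1 T.2.1 T.2.2) ≤ ENNReal.ofReal (Z * r) *
        (1 + ENNReal.ofReal (11 / (200 * m)) * (T.1.countP (fun e => e.1 = n ∧ e.2 ∈ B) +
          m * ind (hitCount n (eligible U n G₁ G₂) T.2.1 T.2.2 < 9))) := by
    intro T hT
    obtain ⟨h1, h2⟩ := badWeight_succ_le (U := U) hG hT
    exact ofReal_expPotential_succ_le hm h2 h1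
  refine (Ex_mono_support hpt).trans ?_
  rw [Ex_const_mul, Ex_add, Ex_const, Ex_const_mul, Ex_add, Ex_const_mul]
  have hhit := Ex_hitCount_lt_nine_le (U := U) hms hn hG hnew hbad hmax
  have hBsum : ∑ v ∈ B, degree G v = badWeight U n G G₁ G₂ := by
    rw [hB, Finset.sum_insert (by simp [unreached]), hG.degree_eq_zero le_rfl, zero_add]
    rfl
  have hcount := Ex_addEdgesN_countP_le (u := n) B (e₀ := m * n)
    (W := badWeight U n G G₁ G₂ + 2 * m + 1) m G hG.length_eq.ge (by rw [hBsum])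
  have hG0 : G.countP (fun e => e.1 = n ∧ e.2 ∈ B) = 0 := by
    rw [List.countP_eq_zero]
    intro e he
    have := hG.source_lt e he
    simp only [decide_eq_true_eq]
    omega
  rw [hG0, Nat.cast_zero, zero_add, ← Ex_addEdgesCopies_fst s n m G G₁ G₂] at hcount
  have hfrac : ((badWeight U n G G₁ G₂ + 2 * m + 1 : ℕ) : ℝ≥0∞) / ((2 * (m * n) + 1 : ℕ) : ℝ≥0∞) ≤
      ENNReal.ofReal (165 / 10000) := by
    rw [← ENNReal.ofReal_natCast, ← ENNReal.ofReal_natCast,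
      ← ENNReal.ofReal_div_of_pos (by positivity)]
    apply ENNReal.ofReal_le_ofReal
    rw [div_le_iff₀ (by positivity)]
    push_cast
    nlinarith
  calc ENNReal.ofReal (Z * r) * (1 + ENNReal.ofReal (11 / (200 * m)) *
        (Ex (addEdgesCopies s n m G G₁ G₂)
            (fun T => (T.1.countP (fun e => e.1 = n ∧ e.2 ∈ B) : ℝ≥0∞)) +
          m * Ex (addEdgesCopies s n m G G₁ G₂)
            (fun T => ind (hitCount n (eligible U n G₁ G₂) T.2.1 T.2.2 < 9))))
      ≤ ENNReal.ofReal (Z * r) * (1 + ENNReal.ofReal (11 / (200 * m)) *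
        (m * ENNReal.ofReal (165 / 10000) + m * ENNReal.ofReal (94 / 10000))) := by
        gcongr
        exact hcount.trans (by gcongr)
    _ = ENNReal.ofReal (Z * r * (1 + 11 / 200 * (259 / 10000))) := by
        rw [← mul_add, ← ENNReal.ofReal_add (by norm_num) (by norm_num), ← ENNReal.ofReal_natCast,
          ← ENNReal.ofReal_mul (by positivity), ← ENNReal.ofReal_mul (by positivity),
          ← ENNReal.ofReal_one, ← ENNReal.ofReal_add (by norm_num) (by positivity),
          ← ENNReal.ofReal_mul (by positivity)]
        congr 2
        field_simp
        norm_num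
    _ ≤ ENNReal.ofReal Z := by
        apply ENNReal.ofReal_le_ofReal
        have h1 : 1 + 11 / 200 * (259 / 10000) ≤ Real.exp (15 / 10000 : ℝ) := by
          have := Real.add_one_le_exp (15 / 10000 : ℝ)
          linarith
        have h2 : r * Real.exp (15 / 10000 : ℝ) = 1 := by
          rw [hr, ← Real.exp_add]
          norm_num
        calc Z * r * (1 + 11 / 200 * (259 / 10000)) ≤ Z * r * Real.exp (15 / 10000 : ℝ) := by gcongr
          _ = Z := by rw [mul_assoc, h2, mul_one]

/-- The joint expectation over the graph and its two copies. -/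
noncomputable def ExCopies (m n : ℕ) (s : I) (f : EdgeList ℕ → EdgeList ℕ → EdgeList ℕ → ℝ≥0∞) :
    ℝ≥0∞ :=
  Ex (natGraph m n) fun G => Ex₂ s G (f G)

theorem ExCopies_succ (m : ℕ) {n : ℕ} (hn : 1 ≤ n) (s : I)
    (f : EdgeList ℕ → EdgeList ℕ → EdgeList ℕ → ℝ≥0∞) :
    ExCopies m (n + 1) s f = ExCopies m n s fun G G₁ G₂ =>
      Ex (addEdgesCopies s n m G G₁ G₂) fun T => f T.1 T.2.1 T.2.2 := by
  unfold ExCopies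
  rw [Ex_natGraph_succ m hn]
  simp only [Ex_addEdgesN_Ex₂]

theorem Ex₂_mono_support {α : Type} {p : I} {L : List α} {f g : List α → List α → ℝ≥0∞}
    (h : ∀ G₁ G₂ : List α, G₁.Sublist L → G₂.Sublist L → f G₁ G₂ ≤ g G₁ G₂) :
    Ex₂ p L f ≤ Ex₂ p L g :=
  Ex_mono_support fun _ h1 => Ex_mono_support fun _ h2 =>
    h _ _ (sublist_of_mem_support_thin h1) (sublist_of_mem_support_thin h2)

theorem ExCopies_mono_support {m n : ℕ} (hn : 1 ≤ n) {s : I}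
    {f g : EdgeList ℕ → EdgeList ℕ → EdgeList ℕ → ℝ≥0∞}
    (h : ∀ G G₁ G₂ : EdgeList ℕ, IsGrown m n G → G₁.Sublist G → G₂.Sublist G →
      f G G₁ G₂ ≤ g G G₁ G₂) : ExCopies m n s f ≤ ExCopies m n s g :=
  Ex_mono_support fun G hG => Ex₂_mono_support (h G · · (isGrown_of_mem_support hn hG))

theorem ExCopies_add (m n : ℕ) (s : I) (f g : EdgeList ℕ → EdgeList ℕ → EdgeList ℕ → ℝ≥0∞) :
    ExCopies m n s (fun G G₁ G₂ => f G G₁ G₂ + g G G₁ G₂) =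
      ExCopies m n s f + ExCopies m n s g := by
  simp only [ExCopies, Ex₂, Ex_add]

theorem ExCopies_fst (m n : ℕ) (s : I) (f : EdgeList ℕ → ℝ≥0∞) :
    ExCopies m n s (fun G _ _ => f G) = Ex (natGraph m n) f := by
  simp only [ExCopies, Ex₂, Ex_const]

/-! ### Summable tails and large degrees -/

theorem sum_Ico_inv_succ_sq_le {a n : ℕ} (ha : 1 ≤ a) (hn : a ≤ n) :
    ∑ x ∈ Finset.Ico a n, 1 / ((x : ℝ) + 1) ^ 2 ≤ 1 / (a : ℝ) - 1 / (n : ℝ) := by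
  induction n, hn using Nat.le_induction with
  | base => simp
  | succ n hn ih =>
    have hn0 : (0 : ℝ) < n := by exact_mod_cast ha.trans hn
    rw [Finset.sum_Ico_succ_top hn]
    have h4 : 1 / ((n : ℝ) + 1) ^ 2 ≤ 1 / n - 1 / ((n + 1 : ℕ) : ℝ) := by
      push_cast
      rw [div_sub_div _ _ (by positivity) (by positivity), div_le_div_iff₀ (by positivity)
        (by positivity)]
      nlinarith
    linarith

theorem sum_range_inv_succ_sq_le (n : ℕ) :
    ∑ x ∈ Finset.range n, 1 / ((x : ℝ) + 1) ^ 2 ≤ 2 := by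
  rcases Nat.eq_zero_or_pos n with rfl | hn
  · simp
  · rw [Finset.range_eq_Ico, Finset.sum_eq_sum_Ico_succ_bot hn]
    have h := sum_Ico_inv_succ_sq_le (a := 1) le_rfl hn
    have h5 : (0 : ℝ) ≤ (n : ℝ)⁻¹ := by positivity
    norm_num at h ⊢
    linarith

theorem sum_Ico_inv_sq_le {a n : ℕ} (ha : 1 ≤ a) (hn : a ≤ n) :
    ∑ t ∈ Finset.Ico a n, 1 / (t : ℝ) ^ 2 ≤ 4 / (a : ℝ) := by
  have h := sum_Ico_inv_succ_sq_le ha hn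
  have h5 : (0 : ℝ) ≤ 1 / (n : ℝ) := by positivity
  calc ∑ t ∈ Finset.Ico a n, 1 / (t : ℝ) ^ 2
      ≤ ∑ t ∈ Finset.Ico a n, 4 * (1 / ((t : ℝ) + 1) ^ 2) := by
        refine Finset.sum_le_sum fun t ht => ?_
        have ht1 : (1 : ℝ) ≤ t := by exact_mod_cast ha.trans (Finset.mem_Ico.1 ht).1
        rw [mul_one_div, div_le_div_iff₀ (by positivity) (by positivity)]
        nlinarith
    _ = 4 * ∑ t ∈ Finset.Ico a n, 1 / ((t : ℝ) + 1) ^ 2 := by rw [Finset.mul_sum]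
    _ ≤ 4 * (1 / (a : ℝ)) := by
        gcongr
        linarith
    _ = 4 / (a : ℝ) := by ring

/-- Large degrees at time `n` are unlikely. -/
theorem Ex_exists_large_degree_le {m n : ℕ} (hm : 1 ≤ m) (hn : 1 ≤ n) :
    Ex (natGraph m n) (fun G => ind (∃ x ∈ Finset.range n, n < 20 * degree G x)) ≤
      ENNReal.ofReal ((20 * (2 * ((2 * m + 4 : ℕ) : ℝ))) ^ 4 * 2 / (n : ℝ) ^ 2) := by
  have hn0 : (0 : ℝ) < n := by exact_mod_cast hn
  set C : ℝ := 2 * ((2 * m + 4 : ℕ) : ℝ) with hC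
  -- Fourth moments: the sum over `x` converges and leaves order `n^(-2)`, which is summable over
  -- the times from `U` on.
  have h1 : ∀ G : EdgeList ℕ, ind (∃ x ∈ Finset.range n, n < 20 * degree G x) ≤
      ∑ x ∈ Finset.range n, (degree G x : ℝ≥0∞) ^ 4 * ENNReal.ofReal ((20 / n) ^ 4) := by
    intro G
    refine (ind_exists_mem_le _ _).trans (Finset.sum_le_sum fun x _ => ind_le_of fun h => ?_)
    rw [← ENNReal.ofReal_natCast, ← ENNReal.ofReal_pow (by positivity),
      ← ENNReal.ofReal_mul (by positivity), ENNReal.one_le_ofReal, ← mul_pow]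
    apply one_le_pow₀
    rw [mul_div_assoc', one_le_div hn0]
    have : (n : ℝ) < 20 * degree G x := by exact_mod_cast h
    linarith
  refine (Ex_mono h1).trans ?_
  rw [Ex_finset_sum]
  have h2 : ∀ x ∈ Finset.range n, Ex (natGraph m n) (fun G => (degree G x : ℝ≥0∞) ^ 4 *
      ENNReal.ofReal ((20 / n) ^ 4)) ≤
      ENNReal.ofReal ((20 * C) ^ 4 / (n : ℝ) ^ 2 * (1 / ((x : ℝ) + 1) ^ 2)) := by
    intro x hx
    rw [Ex_mul_const]
    refine (mul_le_mul_left (Ex_degree_pow_le hm 4 (Finset.mem_range.1 hx)) _).trans ?_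
    rw [← ENNReal.ofReal_mul (by positivity)]
    apply ENNReal.ofReal_le_ofReal
    apply le_of_eq
    have h3 : √((n : ℝ) / ((x : ℝ) + 1)) ^ 4 = ((n : ℝ) / ((x : ℝ) + 1)) ^ 2 := by
      rw [show 4 = 2 * 2 by norm_num, pow_mul, Real.sq_sqrt (by positivity)]
    rw [mul_pow, h3]
    field_simp
    rw [hC]
    ring
  refine (Finset.sum_le_sum h2).trans ?_
  rw [← ENNReal.ofReal_sum_of_nonneg fun x _ => by positivity, ← Finset.mul_sum]
  apply ENNReal.ofReal_le_ofReal
  have h3 := sum_range_inv_succ_sq_le n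
  calc (20 * C) ^ 4 / (n : ℝ) ^ 2 * ∑ x ∈ Finset.range n, 1 / ((x : ℝ) + 1) ^ 2
      ≤ (20 * C) ^ 4 / (n : ℝ) ^ 2 * 2 := by gcongr
    _ = _ := by ring

/-- The truncated exponential potential grows at most by the probability of a large degree. -/
theorem ExCopies_min_expPotential_le {s : I} {m U : ℕ} (hms : 22 ≤ (m : ℝ) * (s : ℝ) ^ 2)
    (hU : 1000 ≤ U) {n : ℕ} (hn : U ≤ n) :
    ExCopies m n s (fun G G₁ G₂ => min 1 (ENNReal.ofReal (expPotential m U n G G₁ G₂))) ≤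
      ENNReal.ofReal (Real.exp (-(15 / 10000 * U))) + ∑ t ∈ Finset.Ico U n,
        ENNReal.ofReal ((20 * (2 * ((2 * m + 4 : ℕ) : ℝ))) ^ 4 * 2 / (t : ℝ) ^ 2) := by
  have hs0 := s.2.1
  have hs1 := s.2.2
  have hm1 : (1 : ℝ) ≤ m := by nlinarith [sq_nonneg (s : ℝ)]
  have hm : 1 ≤ m := by exact_mod_cast hm1
  induction n, hn using Nat.le_induction with
  | base =>
    rw [Finset.Ico_self, Finset.sum_empty, add_zero]
    refine Ex_le_const fun G _ => Ex_le_const fun G₁ _ => Ex_le_const fun G₂ _ => ?_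
    refine (min_le_right _ _).trans (le_of_eq ?_)
    -- At time `U` all nodes are early, so the potential starts without bad weight.
    have h0 : badWeight U U G G₁ G₂ = 0 := by
      unfold badWeight
      rw [Finset.sum_eq_zero]
      intro v hv
      rw [unreached, Finset.mem_filter, Finset.mem_range] at hv
      exact absurd (Reached.early hv.1) hv.2
    rw [expPotential, h0, Nat.cast_zero, zero_div, zero_sub]
  | succ n hn ih =>
    rw [ExCopies_succ m (by omega), Finset.sum_Ico_succ_top hn, ← add_assoc]
    have hstep : ∀ G G₁ G₂ : EdgeList ℕ, IsGrown m n G → G₁.Sublist G → G₂.Sublist G →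
        Ex (addEdgesCopies s n m G G₁ G₂) (fun T =>
          min 1 (ENNReal.ofReal (expPotential m U (n + 1) T.1 T.2.1 T.2.2))) ≤
        min 1 (ENNReal.ofReal (expPotential m U n G G₁ G₂)) +
          ind (∃ x ∈ Finset.range n, n < 20 * degree G x) := by
      intro G G₁ G₂ hG h1 h2
      have hone : Ex (addEdgesCopies s n m G G₁ G₂) (fun T =>
          min 1 (ENNReal.ofReal (expPotential m U (n + 1) T.1 T.2.1 T.2.2))) ≤ 1 :=
        Ex_le_const fun T _ => min_le_left _ _
      by_cases hmax : ∃ x ∈ Finset.range n, n < 20 * degree G x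
      · rw [ind_true hmax]
        exact hone.trans (le_add_left le_rfl)
      · refine le_trans (le_min hone ?_) (le_add_right le_rfl)
        -- Truncation at one replaces a stopping time: above the threshold the potential is at least
        -- one and the bound is trivial.
        by_cases hbad : (badWeight U n G G₁ G₂ : ℝ) ≤ 3 / 100 * (m * n)
        · refine (Ex_mono fun T => min_le_right _ _).trans
            (Ex_expPotential_step hms (by omega) hG ?_ hbad ?_)
          · intro e he
            have := hG.source_lt e (h1.subset he)
            omega
          · push Not at hmax
            exact fun x hx => hmax x (Finset.mem_range.2 hx)
        · push Not at hbad
          have h3 : 3 / 100 * ((m : ℝ) * n) / (20 * m) ≤ (badWeight U n G G₁ G₂ : ℝ) / (20 * m) := by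
            gcongr
          have h4 : 3 / 100 * ((m : ℝ) * n) / (20 * m) = 15 / 10000 * n := by
            field_simp
            ring
          refine hone.trans (ENNReal.one_le_ofReal.2 (Real.one_le_exp ?_))
          linarith
    refine (ExCopies_mono_support (by omega) hstep).trans ?_
    rw [ExCopies_add, ExCopies_fst]
    exact add_le_add ih (Ex_exists_large_degree_le hm (by omega))

/-- With high probability the unreached nodes carry little degree. -/
theorem ExCopies_badWeight_gt_le {s : I} {m U : ℕ} (hms : 22 ≤ (m : ℝ) * (s : ℝ) ^ 2)
    (hU : 1000 ≤ U) {n : ℕ} (hn : U ≤ n) :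
    ExCopies m n s (fun G G₁ G₂ => ind (3 / 100 * (m * n : ℝ) < badWeight U n G G₁ G₂)) ≤
      ENNReal.ofReal (Real.exp (-(15 / 10000 * U)) +
        (20 * (2 * ((2 * m + 4 : ℕ) : ℝ))) ^ 4 * 8 / U) := by
  have hm0 : (0 : ℝ) < m := by
    have hs0 := s.2.1
    have hs1 := s.2.2
    nlinarith [sq_nonneg (s : ℝ)]
  have h1 : ExCopies m n s (fun G G₁ G₂ => ind (3 / 100 * (m * n : ℝ) < badWeight U n G G₁ G₂)) ≤
      ExCopies m n s (fun G G₁ G₂ => min 1 (ENNReal.ofReal (expPotential m U n G G₁ G₂))) := by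
    refine ExCopies_mono_support (by omega) fun G G₁ G₂ _ _ _ => ind_le_of fun h => ?_
    have h3 : 3 / 100 * ((m : ℝ) * n) / (20 * m) ≤ (badWeight U n G G₁ G₂ : ℝ) / (20 * m) := by
      gcongr
    have h4 : 3 / 100 * ((m : ℝ) * n) / (20 * m) = 15 / 10000 * n := by
      field_simp
      ring
    refine le_min le_rfl (ENNReal.one_le_ofReal.2 (Real.one_le_exp ?_))
    linarith
  refine h1.trans ((ExCopies_min_expPotential_le hms hU hn).trans ?_)
  rw [ENNReal.ofReal_add (Real.exp_pos _).le (by positivity),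
    ← ENNReal.ofReal_sum_of_nonneg fun t _ => by positivity]
  gcongr
  set C : ℝ := (20 * (2 * ((2 * m + 4 : ℕ) : ℝ))) ^ 4 with hC
  calc ∑ t ∈ Finset.Ico U n, C * 2 / (t : ℝ) ^ 2
      = C * 2 * ∑ t ∈ Finset.Ico U n, 1 / (t : ℝ) ^ 2 := by
        rw [Finset.mul_sum]
        exact Finset.sum_congr rfl fun t _ => by ring
    _ ≤ C * 2 * (4 / U) := by
        have hC0 : 0 ≤ C := by rw [hC]; positivity
        gcongr
        exact sum_Ico_inv_sq_le (by omega) hn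
    _ = C * 8 / U := by ring

/-! ### Bounds on the exceptional events -/

/-- The partial sums of the harmonic series. -/
noncomputable def harmonicSum (n : ℕ) : ℝ := ∑ a ∈ Finset.range n, 1 / ((a : ℝ) + 1)

theorem harmonicSum_nonneg (n : ℕ) : 0 ≤ harmonicSum n :=
  Finset.sum_nonneg fun a _ => by positivity

theorem harmonicSum_le (n : ℕ) : harmonicSum n ≤ 1 + Real.log n := by
  refine le_trans (le_of_eq ?_) (harmonic_le_one_add_log n)
  unfold harmonicSum harmonic
  push_cast
  simp

/-- Two nodes, one of which is late, rarely have four common neighbours. -/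
theorem Ex_exists_late_pair_le {m n U : ℕ} (hm : 1 ≤ m) (hU : 1 ≤ U) (hn : U ≤ n) :
    Ex (natGraph m n) (fun G => ind (∃ p ∈ Finset.range n ×ˢ Finset.Ico U n,
        p.1 ≠ p.2 ∧ 4 ≤ (commonNbrs n G p.1 p.2).card)) ≤
      ENNReal.ofReal ((edgeBound m 8 ^ 2 * harmonicSum n) ^ 4 * 2 / U) := by
  refine (Ex_mono fun G => ind_exists_mem_le _ _).trans ?_
  rw [Ex_finset_sum]
  set C := edgeBound m 8 ^ 2 * harmonicSum n with hC
  have hC0 : 0 ≤ C := mul_nonneg (sq_nonneg _) (harmonicSum_nonneg n)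
  -- Four common neighbours give decay by the square of each index: summable over all pairs, with
  -- tail `1/U` in the late node.
  have h1 : ∀ p ∈ Finset.range n ×ˢ Finset.Ico U n, Ex (natGraph m n) (fun G =>
      ind (p.1 ≠ p.2 ∧ 4 ≤ (commonNbrs n G p.1 p.2).card)) ≤
      ENNReal.ofReal (C ^ 4 * (1 / ((p.1 : ℝ) + 1) ^ 2 * (1 / ((p.2 : ℝ) + 1) ^ 2))) := by
    rintro ⟨u, v⟩ hp
    rw [Finset.mem_product, Finset.mem_range, Finset.mem_Ico] at hp
    simp only at hp ⊢
    by_cases huv : u = v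
    · refine (Ex_le_const (c := 0) fun G _ => (ind_false ?_).le).trans zero_le
      tauto
    · refine (Ex_mono fun G => ind_mono fun h => h.2).trans
        ((Ex_card_commonNbrs_ge hm 4 hp.1 hp.2.2 huv).trans (ENNReal.ofReal_le_ofReal (le_of_eq ?_)))
      have h4 : ∀ x : ℕ, √((x : ℝ) + 1) ^ 4 = ((x : ℝ) + 1) ^ 2 := by
        intro x
        rw [show 4 = 2 * 2 by norm_num, pow_mul, Real.sq_sqrt (by positivity)]
      rw [div_pow, mul_pow (√_), h4, h4, show 2 * 4 = 8 by norm_num, ← harmonicSum, ← hC]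
      field_simp
  refine (Finset.sum_le_sum h1).trans ?_
  rw [← ENNReal.ofReal_sum_of_nonneg fun p _ => by positivity, ← Finset.mul_sum]
  apply ENNReal.ofReal_le_ofReal
  rw [Finset.sum_product]
  simp only [← Finset.mul_sum, ← Finset.sum_mul]
  have h2 := sum_range_inv_succ_sq_le n
  have h3 := sum_Ico_inv_succ_sq_le hU hn
  have h4 : (0 : ℝ) ≤ 1 / (n : ℝ) := by positivity
  have h5 : ∑ i ∈ Finset.Ico U n, 1 / ((i : ℝ) + 1) ^ 2 ≤ 1 / (U : ℝ) := by linarith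
  have h6 : 0 ≤ ∑ i ∈ Finset.Ico U n, 1 / ((i : ℝ) + 1) ^ 2 :=
    Finset.sum_nonneg fun i _ => by positivity
  calc C ^ 4 * ((∑ i ∈ Finset.range n, 1 / ((i : ℝ) + 1) ^ 2) *
        ∑ i ∈ Finset.Ico U n, 1 / ((i : ℝ) + 1) ^ 2) ≤ C ^ 4 * (2 * (1 / (U : ℝ))) := by gcongr
    _ = C ^ 4 * 2 / U := by ring

/-- Two early nodes rarely have many common neighbours. -/
theorem Ex_exists_early_pair_le {m n U w : ℕ} (hm : 1 ≤ m) (hn : U ≤ n) (hw : 1 ≤ w) :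
    Ex (natGraph m n) (fun G => ind (∃ p ∈ Finset.range U ×ˢ Finset.range U,
        p.1 ≠ p.2 ∧ w ≤ (commonNbrs n G p.1 p.2).card)) ≤
      ENNReal.ofReal ((U : ℝ) ^ 2 * (edgeBound m 2 ^ 2 * harmonicSum n) / w) := by
  have hw0 : (0 : ℝ) < w := by exact_mod_cast hw
  refine (Ex_mono fun G => ind_exists_mem_le _ _).trans ?_
  rw [Ex_finset_sum]
  set C := edgeBound m 2 ^ 2 * harmonicSum n with hC
  have hC0 : 0 ≤ C := mul_nonneg (sq_nonneg _) (harmonicSum_nonneg n)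
  have h1 : ∀ p ∈ Finset.range U ×ˢ Finset.range U, Ex (natGraph m n) (fun G =>
      ind (p.1 ≠ p.2 ∧ w ≤ (commonNbrs n G p.1 p.2).card)) ≤ ENNReal.ofReal (C / w) := by
    rintro ⟨u, v⟩ hp
    rw [Finset.mem_product, Finset.mem_range, Finset.mem_range] at hp
    simp only at hp ⊢
    by_cases huv : u = v
    · refine (Ex_le_const (c := 0) fun G _ => (ind_false ?_).le).trans zero_le
      tauto
    · have h2 : ∀ G : EdgeList ℕ, ind (u ≠ v ∧ w ≤ (commonNbrs n G u v).card) ≤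
          ((commonNbrs n G u v).card : ℝ≥0∞) * ENNReal.ofReal (1 / w) := by
        intro G
        refine ind_le_of fun h => ?_
        rw [← ENNReal.ofReal_natCast, ← ENNReal.ofReal_mul (by positivity), ENNReal.one_le_ofReal,
          mul_one_div, one_le_div hw0]
        exact_mod_cast h.2
      refine (Ex_mono h2).trans ?_
      rw [Ex_mul_const]
      refine (mul_le_mul_left (Ex_card_commonNbrs_le hm (hp.1.trans_le hn) (hp.2.trans_le hn) huv)
        _).trans (le_of_eq ?_)
      rw [← harmonicSum, ← hC, ← ENNReal.ofReal_mul hC0, mul_one_div]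
  refine (Finset.sum_le_sum h1).trans (le_of_eq ?_)
  rw [Finset.sum_const, nsmul_eq_mul, Finset.card_product, Finset.card_range,
    ← ENNReal.ofReal_natCast, ← ENNReal.ofReal_mul (by positivity)]
  congr 1
  push_cast
  ring

/-- The degree of a node is controlled by the number of nodes with an edge to it. -/
theorem IsGrown.degree_le_card_sources {m n u : ℕ} {G : EdgeList ℕ} (hG : IsGrown m n G)
    (hu : u < n) :
    degree G u ≤ m + m * ((Finset.range n).filter fun a => (a, u) ∈ G).card := by
  unfold degree
  rw [hG.count_source u hu]
  gcongr
  set A := (Finset.range n).filter fun a => (a, u) ∈ G with hA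
  calc G.countP (fun e => e.2 = u) ≤ G.countP (fun e => e.1 ∈ A) := by
        apply List.countP_mono_left
        intro e he h
        simp only [decide_eq_true_eq] at h ⊢
        rw [hA, Finset.mem_filter, Finset.mem_range]
        exact ⟨hG.source_lt e he, by rw [← h]; exact he⟩
    _ = ∑ a ∈ A, G.countP (fun e => e.1 = a) := (sum_countP_source A G).symm
    _ = ∑ _a ∈ A, m := Finset.sum_congr rfl fun a ha =>
        hG.count_source a (Finset.mem_range.1 (Finset.mem_filter.1 ha).1)
    _ = m * A.card := by rw [Finset.sum_const, smul_eq_mul, mul_comm]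

/-- The joint expectation over the graph, its two copies and the seeds. -/
noncomputable def ExInput (m n : ℕ) (s l : I)
    (f : EdgeList ℕ → EdgeList ℕ → EdgeList ℕ → List ℕ → ℝ≥0∞) : ℝ≥0∞ :=
  ExCopies m n s fun G G₁ G₂ => Ex (thin l (List.range n)) (f G G₁ G₂)

/-- Early nodes have many seed witnesses. -/
theorem ExInput_few_seed_witnesses_le {m n U : ℕ} (hm : 1 ≤ m) (hn : U ≤ n) (hU : 1 ≤ U) (s l : I)
    (w N : ℕ) :
    ExInput m n s l (fun _ G₁ G₂ S => ind (∃ u ∈ Finset.range U,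
        ((Finset.range n).filter fun a => (a, u) ∈ G₁ ∧ (a, u) ∈ G₂ ∧ a ∈ S).card < w)) ≤
      ENNReal.ofReal (U * ((m * (N + 1) : ℕ) * (4 * √((U : ℝ) / n))) +
        U * (2 ^ w * (1 - (s : ℝ) ^ 2 * (l / 2)) ^ N)) := by
  have hs0 := s.2.1
  have hs1 := s.2.2
  have hl0 := l.2.1
  have hl1 := l.2.2
  have hq0 : 0 ≤ 1 - (s : ℝ) ^ 2 * (l / 2) := by nlinarith
  have hq1 : 1 - (s : ℝ) ^ 2 * (l / 2) ≤ 1 := by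
    have : 0 ≤ (s : ℝ) ^ 2 * (l / 2) := by positivity
    linarith
  set q : ℝ := 2 ^ w * (1 - (s : ℝ) ^ 2 * (l / 2)) ^ N with hq
  have h1 : ∀ G ∈ (natGraph m n).support, Ex₂ s G (fun G₁ G₂ => Ex (thin l (List.range n)) fun S =>
      ind (∃ u ∈ Finset.range U,
        ((Finset.range n).filter fun a => (a, u) ∈ G₁ ∧ (a, u) ∈ G₂ ∧ a ∈ S).card < w)) ≤
      ∑ u ∈ Finset.range U, (ind (degree G u ∈ Finset.range (m * (N + 1))) + ENNReal.ofReal q) := by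
    intro G hG
    have hgr := isGrown_of_mem_support (by omega) hG
    calc _ ≤ Ex₂ s G (fun G₁ G₂ => Ex (thin l (List.range n)) fun S => ∑ u ∈ Finset.range U,
          ind (((Finset.range n).filter fun a => (a, u) ∈ G₁ ∧ (a, u) ∈ G₂ ∧ a ∈ S).card < w)) :=
          Ex₂_mono fun G₁ G₂ => Ex_mono fun S => ind_exists_mem_le _ _
      _ = ∑ u ∈ Finset.range U, Ex₂ s G (fun G₁ G₂ => Ex (thin l (List.range n)) fun S =>
          ind (((Finset.range n).filter fun a => (a, u) ∈ G₁ ∧ (a, u) ∈ G₂ ∧ a ∈ S).card < w)) := by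
          simp only [Ex₂, Ex_finset_sum]
      _ ≤ _ := by
          refine Finset.sum_le_sum fun u hu => ?_
          rw [Finset.mem_range] at hu
          -- A source issues only `m` edges, so degree at least `m (N + 1)` forces `N` distinct
          -- sources, each with its own chance to be a seed witness. Smaller degrees are rare by
          -- anti-concentration.
          by_cases hd : degree G u ∈ Finset.range (m * (N + 1))
          · rw [ind_true hd]
            refine le_trans ?_ (le_add_right le_rfl)
            exact Ex_le_const fun _ _ => Ex_le_const fun _ _ => Ex_le_const fun _ _ => ind_le_one _
          · refine le_trans (Ex_seed_witnesses_lt_le s l n u w G) (le_trans ?_ (le_add_left le_rfl))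
            rw [Finset.mem_range, not_lt] at hd
            have h2 := hgr.degree_le_card_sources (hu.trans_le hn)
            have h3 : N ≤ ((Finset.range n).filter fun a => (a, u) ∈ G).card := by
              by_contra hcon
              push Not at hcon
              have : m * ((Finset.range n).filter fun a => (a, u) ∈ G).card + m ≤ m * N := by
                rw [← Nat.mul_succ]
                exact Nat.mul_le_mul_left m hcon
              rw [Nat.mul_succ] at hd
              omega
            rw [hq, ENNReal.ofReal_mul (by positivity), ENNReal.ofReal_pow (by norm_num),
              ENNReal.ofReal_pow hq0, ENNReal.ofReal_ofNat]
            gcongr 2 ^ w * ?_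
            exact pow_le_pow_right_of_le_one' (ENNReal.ofReal_le_one.2 hq1) h3
  unfold ExInput ExCopies
  refine (Ex_mono_support h1).trans ?_
  rw [Ex_finset_sum]
  have h2 : ∀ u ∈ Finset.range U, Ex (natGraph m n) (fun G =>
      ind (degree G u ∈ Finset.range (m * (N + 1))) + ENNReal.ofReal q) ≤
      ENNReal.ofReal ((m * (N + 1) : ℕ) * (4 * √((U : ℝ) / n)) + q) := by
    intro u hu
    rw [Finset.mem_range] at hu
    rw [Ex_add, Ex_const, ENNReal.ofReal_add (by positivity) (by positivity)]
    gcongr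
    refine (Ex_degree_mem_le hm (hu.trans_le hn) _).trans (ENNReal.ofReal_le_ofReal ?_)
    rw [Finset.card_range]
    gcongr
    exact_mod_cast hu
  refine (Finset.sum_le_sum h2).trans (le_of_eq ?_)
  rw [Finset.sum_const, nsmul_eq_mul, Finset.card_range, ← ENNReal.ofReal_natCast,
    ← ENNReal.ofReal_mul (by positivity)]
  congr 1
  ring

/-! ### Degrees near powers of two -/

theorem card_le_of_pairwise_sub_le {S : Finset ℕ} {D : ℝ} (hD : 0 ≤ D)
    (h : ∀ a ∈ S, ∀ b ∈ S, (b : ℝ) - a ≤ D) : (S.card : ℝ) ≤ D + 1 := by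
  rcases S.eq_empty_or_nonempty with rfl | hS
  · simp
    linarith
  · have h1 : S ⊆ Finset.Icc (S.min' hS) (S.max' hS) := fun a ha =>
      Finset.mem_Icc.2 ⟨S.min'_le a ha, S.le_max' a ha⟩
    have h2 := Finset.card_le_card h1
    rw [Nat.card_Icc] at h2
    have h3 := h _ (S.min'_mem hS) _ (S.max'_mem hS)
    have h4 : S.min' hS ≤ S.max' hS := S.min'_le _ (S.max'_mem hS)
    have h5 : S.card + S.min' hS ≤ S.max' hS + 1 := by omega
    have h6 : (S.card : ℝ) + S.min' hS ≤ S.max' hS + 1 := by exact_mod_cast h5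
    linarith

open Classical in
/-- The degrees for which the expected degree in a copy is within `y` of a power of two. -/
noncomputable def windows (s y : ℝ) (M : ℕ) : Finset ℕ :=
  (Finset.range (Nat.log 2 M + 1)).biUnion fun j =>
    (Finset.range (M + 1)).filter fun d => |s * d - 2 ^ j| ≤ y

/-- For each power of two the admissible degrees lie in an interval of length `2 y / s`. The count
matters because `Ex_degree_mem_le` converts it into a probability. -/
theorem card_windows_le {s y : ℝ} (hs : 0 < s) (hy : 0 ≤ y) (M : ℕ) :
    ((windows s y M).card : ℝ) ≤ ((Nat.log 2 M + 1 : ℕ) : ℝ) * (2 * y / s + 1) := by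
  classical
  have h1 : ((windows s y M).card : ℝ) ≤ ((∑ j ∈ Finset.range (Nat.log 2 M + 1),
      ((Finset.range (M + 1)).filter fun d : ℕ => |s * d - 2 ^ j| ≤ y).card : ℕ) : ℝ) := by
    refine Nat.cast_le.2 ?_
    unfold windows
    refine le_trans (le_of_eq ?_) Finset.card_biUnion_le
    congr!
  refine h1.trans ?_
  push_cast
  refine (Finset.sum_le_sum (g := fun _ => 2 * y / s + 1) fun j _ => ?_).trans (le_of_eq ?_)
  · refine card_le_of_pairwise_sub_le (by positivity) fun a ha b hb => ?_
    have ha' := abs_le.1 (Finset.mem_filter.1 ha).2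
    have hb' := abs_le.1 (Finset.mem_filter.1 hb).2
    rw [le_div_iff₀ hs]
    nlinarith
  · rw [Finset.sum_const, Finset.card_range, nsmul_eq_mul]
    push_cast
    ring

/-- It is unlikely that the degrees of an early node in the two copies are separated by a power of
two. -/
theorem ExInput_straddle_le {m n U : ℕ} (hm : 1 ≤ m) (hn : U ≤ n) (hU : 1 ≤ U) (s l : I)
    (hs : 0 < (s : ℝ)) {y : ℝ} (hy : 0 < y) :
    ExInput m n s l (fun _ G₁ G₂ _ => ind (∃ u ∈ Finset.range U,
        ∃ j : ℕ, 2 ^ j ≤ degree G₁ u ∧ degree G₂ u < 2 ^ j)) ≤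
      ENNReal.ofReal (U * (2 * (2 * ((2 * m + 1 : ℕ) : ℝ) * √(n : ℝ) * (2 / y ^ 2)) +
        ((Nat.log 2 (2 * (m * n)) + 1 : ℕ) : ℝ) * (2 * y / s + 1) * (4 * √((U : ℝ) / n)))) := by
  set M := 2 * (m * n) with hM
  have h1 : ∀ G ∈ (natGraph m n).support, Ex₂ s G (fun G₁ G₂ => Ex (thin l (List.range n)) fun _ =>
      ind (∃ u ∈ Finset.range U, ∃ j : ℕ, 2 ^ j ≤ degree G₁ u ∧ degree G₂ u < 2 ^ j)) ≤
      ∑ u ∈ Finset.range U, (2 * ((degree G u : ℝ≥0∞) ^ 1 * ENNReal.ofReal (2 / y ^ 2)) +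
        ind (degree G u ∈ windows s y M)) := by
    intro G hG
    have hgr := isGrown_of_mem_support (by omega) hG
    have hpt : ∀ G₁ G₂ : EdgeList ℕ, G₁.Sublist G → G₂.Sublist G →
        ind (∃ u ∈ Finset.range U, ∃ j : ℕ, 2 ^ j ≤ degree G₁ u ∧ degree G₂ u < 2 ^ j) ≤
        ∑ u ∈ Finset.range U, (ind (y < |(degree G₁ u : ℝ) - s * degree G u|) +
          ind (y < |(degree G₂ u : ℝ) - s * degree G u|) + ind (degree G u ∈ windows s y M)) := by
      intro G₁ G₂ hs1 hs2
      refine (ind_exists_mem_le _ _).trans (Finset.sum_le_sum fun u _ => ?_)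
      refine le_trans (ind_mono ?_) ((ind_or_le _ _).trans (add_le_add_left (ind_or_le _ _) _))
      -- If both copies are within `y` of `s · deg u` and `2^j` lies between them, then `s · deg u`
      -- is itself within `y` of `2^j`.
      rintro ⟨j, hj1, hj2⟩
      by_contra hcon
      push Not at hcon
      obtain ⟨⟨ha, hb⟩, hc⟩ := hcon
      apply hc
      have hdM : degree G u ≤ M := by
        have := degree_le_two_mul_length G u
        rwa [hgr.length_eq] at this
      rw [windows, Finset.mem_biUnion]
      refine ⟨j, ?_, ?_⟩
      · rw [Finset.mem_range, Nat.lt_succ_iff]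
        exact Nat.le_log_of_pow_le (by norm_num) (hj1.trans ((degree_mono hs1 u).trans hdM))
      · rw [Finset.mem_filter, Finset.mem_range]
        refine ⟨by omega, ?_⟩
        rw [abs_le] at ha hb ⊢
        have hj1' : (2 : ℝ) ^ j ≤ degree G₁ u := by exact_mod_cast hj1
        have hj2' : (degree G₂ u : ℝ) ≤ 2 ^ j := by exact_mod_cast hj2.le
        constructor <;> linarith
    simp only [Ex_const]
    refine (Ex₂_mono_support hpt).trans ?_
    simp only [Ex₂, Ex_finset_sum, Ex_add, Ex_const]
    refine Finset.sum_le_sum fun u _ => ?_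
    have h2 := Ex_thin_degree_deviation_le s G u hy
    rw [two_mul, pow_one]
    gcongr
  unfold ExInput ExCopies
  refine (Ex_mono_support h1).trans ?_
  rw [Ex_finset_sum]
  have h2 : ∀ u ∈ Finset.range U, Ex (natGraph m n) (fun G =>
      2 * ((degree G u : ℝ≥0∞) ^ 1 * ENNReal.ofReal (2 / y ^ 2)) +
        ind (degree G u ∈ windows s y M)) ≤
      ENNReal.ofReal (2 * (2 * ((2 * m + 1 : ℕ) : ℝ) * √(n : ℝ) * (2 / y ^ 2)) +
        ((Nat.log 2 M + 1 : ℕ) : ℝ) * (2 * y / s + 1) * (4 * √((U : ℝ) / n))) := by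
    intro u hu
    rw [Finset.mem_range] at hu
    have hun : u < n := hu.trans_le hn
    rw [Ex_add, Ex_const_mul, Ex_mul_const, ENNReal.ofReal_add (by positivity) (by positivity),
      ENNReal.ofReal_mul (by norm_num), ENNReal.ofReal_ofNat, ENNReal.ofReal_mul (by positivity)]
    gcongr
    · refine (Ex_degree_pow_le hm 1 hun).trans (ENNReal.ofReal_le_ofReal ?_)
      rw [pow_one]
      gcongr
      exact div_le_self (Nat.cast_nonneg _) (by linarith [(Nat.cast_nonneg u : (0 : ℝ) ≤ u)])
    · refine (Ex_degree_mem_le hm hun _).trans (ENNReal.ofReal_le_ofReal ?_)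
      have h3 := card_windows_le hs hy.le M
      gcongr
      exact_mod_cast hu
  refine (Finset.sum_le_sum h2).trans (le_of_eq ?_)
  rw [Finset.sum_const, nsmul_eq_mul, Finset.card_range, ← ENNReal.ofReal_natCast,
    ← ENNReal.ofReal_mul (by positivity)]

/-! ### The algorithm on typical inputs -/

/-- The properties of the graph, of its two copies and of the seeds on which the analysis of the
algorithm rests. -/
structure Typical (m n U w : ℕ) (G G₁ G₂ : EdgeList ℕ) (S : List ℕ) : Prop where
  grown : IsGrown m n G
  sub₁ : G₁.Sublist G
  sub₂ : G₂.Sublist G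
  late : ∀ u < n, ∀ v < n, U ≤ v → u ≠ v → (commonNbrs n G u v).card < 4
  early : ∀ u < U, ∀ v < U, u ≠ v → (commonNbrs n G u v).card < w
  straddle : ∀ u < U, ∀ j : ℕ, 2 ^ j ≤ degree G₁ u → 2 ^ j ≤ degree G₂ u
  seeds : ∀ u < U, w + 9 ≤
    ((Finset.range n).filter fun a => (a, u) ∈ G₁ ∧ (a, u) ∈ G₂ ∧ a ∈ S).card
  bad : (badWeight U n G G₁ G₂ : ℝ) ≤ 3 / 100 * (m * n)

theorem commonNbrs_comm (n : ℕ) (G : EdgeList ℕ) (u v : ℕ) :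
    commonNbrs n G u v = commonNbrs n G v u := by
  unfold commonNbrs
  rw [Finset.erase_right_comm]
  exact Finset.filter_congr fun a _ => and_comm

theorem mem_valEdges {n : ℕ} {E : EdgeList (Fin n)} {a b : Fin n} :
    ((a : ℕ), (b : ℕ)) ∈ valEdges E ↔ (a, b) ∈ E :=
  List.mem_map_of_injective (f := Prod.map Fin.val Fin.val)
    (Fin.val_injective.prodMap Fin.val_injective) (a := (a, b))

theorem degree_valEdges {n : ℕ} (E : EdgeList (Fin n)) (v : Fin n) :
    degree (valEdges E) (v : ℕ) = degree E v :=
  degree_map Fin.val Fin.val_injective E v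

/-- The input in which the nodes of `S` are the seeds. -/
def mkInstance {n : ℕ} (G₁ G₂ : EdgeList (Fin n)) (S : List (Fin n)) : Instance (Fin n) :=
  ⟨G₁, G₂, (S.map fun v => (v, v)).toFinset⟩

theorem mem_mkInstance_seeds {n : ℕ} {G₁ G₂ : EdgeList (Fin n)} {S : List (Fin n)}
    {p : Fin n × Fin n} : p ∈ (mkInstance G₁ G₂ S).seeds ↔ p.1 = p.2 ∧ (p.1 : ℕ) ∈ S.map Fin.val := by
  rw [mkInstance, List.mem_toFinset, List.mem_map, List.mem_map_of_injective Fin.val_injective]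
  constructor
  · rintro ⟨a, ha, rfl⟩
    exact ⟨rfl, ha⟩
  · rintro ⟨h1, h2⟩
    exact ⟨p.1, h2, Prod.ext rfl h1⟩

section

variable {m n U w : ℕ} {G : EdgeList ℕ} {G₁ G₂ : EdgeList (Fin n)} {S : List (Fin n)}

/-- `commonNbrs` leaves out `u` and `v`, which can be witnesses themselves through self-loops; hence
the `+ 2`. -/
theorem card_witnesses_le (h1 : (valEdges G₁).Sublist G) (h2 : (valEdges G₂).Sublist G)
    (u v : Fin n) :
    (witnesses (mkInstance G₁ G₂ S) u v).card ≤ (commonNbrs n G u v).card + 2 := by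
  have h : (witnesses (mkInstance G₁ G₂ S) u v).image Fin.val ⊆
      insert (u : ℕ) (insert (v : ℕ) (commonNbrs n G u v)) := by
    intro a ha
    obtain ⟨a, ha', rfl⟩ := Finset.mem_image.1 ha
    replace ha := ha'
    rw [witnesses, Finset.mem_inter, mem_neighbors, mem_neighbors] at ha
    simp only [mkInstance, ← mem_valEdges] at ha
    rw [Finset.mem_insert, Finset.mem_insert, commonNbrs, Finset.mem_filter, Finset.mem_erase,
      Finset.mem_erase, Finset.mem_range]
    have h3 : Adj G a u := ha.1.imp (fun h => h1.subset h) fun h => h1.subset h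
    have h4 : Adj G a v := ha.2.imp (fun h => h2.subset h) fun h => h2.subset h
    have := a.2
    tauto
  have h' := Finset.card_le_card h
  rw [Finset.card_image_of_injective _ Fin.val_injective] at h'
  have h5 := Finset.card_insert_le (u : ℕ) (insert (v : ℕ) (commonNbrs n G u v))
  have h6 := Finset.card_insert_le (v : ℕ) (commonNbrs n G u v)
  omega

variable (h : Typical m n U w G (valEdges G₁) (valEdges G₂) (S.map Fin.val))

include h

/-- Three common neighbours and the two endpoints remain below nine. -/
theorem Typical.card_witnesses_late {u v : Fin n} (huv : u ≠ v) (hU : U ≤ u ∨ U ≤ v) :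
    (witnesses (mkInstance G₁ G₂ S) u v).card < 9 := by
  refine (card_witnesses_le h.sub₁ h.sub₂ u v).trans_lt ?_
  have huv' : (u : ℕ) ≠ v := fun h' => huv (Fin.ext h')
  rcases hU with hU | hU
  · have := h.late v v.2 u u.2 hU huv'.symm
    rw [commonNbrs_comm] at this
    omega
  · have := h.late u u.2 v v.2 hU huv'
    omega

theorem Typical.card_witnesses_lt {u v : Fin n} (huv : u ≠ v) :
    (witnesses (mkInstance G₁ G₂ S) u v).card < w + 9 := by
  by_cases hU : U ≤ u ∨ U ≤ v
  · exact (h.card_witnesses_late huv hU).trans_le (Nat.le_add_left _ _)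
  · push Not at hU
    have huv' : (u : ℕ) ≠ v := fun h' => huv (Fin.ext h')
    have h1 := card_witnesses_le (S := S) h.sub₁ h.sub₂ u v
    have h2 := h.early u hU.1 v hU.2 huv'
    omega

theorem Typical.card_seed_witnesses {u : Fin n} (hu : (u : ℕ) < U) :
    w + 9 ≤ ((witnesses (mkInstance G₁ G₂ S) u u).filter fun a =>
      (a, a) ∈ (mkInstance G₁ G₂ S).seeds).card := by
  refine (h.seeds u hu).trans ?_
  rw [← Finset.card_image_of_injective _ Fin.val_injective]
  refine Finset.card_le_card fun a ha => ?_
  rw [Finset.mem_filter, Finset.mem_range] at ha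
  obtain ⟨han, h1, h2, h3⟩ := ha
  lift a to Fin n using han
  refine Finset.mem_image_of_mem _ ?_
  rw [Finset.mem_filter, mem_mkInstance_seeds, witnesses, Finset.mem_inter, mem_neighbors,
    mem_neighbors]
  exact ⟨⟨Or.inl (mem_valEdges.1 h1), Or.inl (mem_valEdges.1 h2)⟩, rfl, h3⟩

/-- Pairs with a late node fall below the threshold. For two early nodes the `w + 9` seed witnesses
of `(u, u)` dominate, and `straddle` makes `(u, u)` a candidate whenever `u` qualifies in the first
copy. -/
theorem Typical.separated : Separated 9 (mkInstance G₁ G₂ S) where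
  diag_seeds p hp := (mem_mkInstance_seeds.1 hp).1
  few_or_dominated u v huv := by
    by_cases hU : U ≤ u ∨ U ≤ v
    · exact Or.inl (h.card_witnesses_late huv hU)
    · push Not at hU
      refine Or.inr ⟨fun j => ?_, (h.card_witnesses_lt huv).le.trans (h.card_seed_witnesses hU.1)⟩
      have := h.straddle u hU.1 j
      rwa [degree_valEdges, degree_valEdges] at this

/-- Seeds alone identify the early nodes in the first pass. A chain step lowers the index by the
factor `100/101`, so after `i` more passes every reached node below `(101/100)^i U` is identified;
for a late node nine witnesses already beat every wrong pair. -/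
theorem Typical.mem_userMatching {i : ℕ} {v : Fin n}
    (hv : Reached U (valEdges G₁) (valEdges G₂) v) (hi : (v : ℕ) * 100 ^ i < 101 ^ i * U) :
    (v, v) ∈ userMatching 9 (i + 1) (mkInstance G₁ G₂ S) := by
  have hearly : ∀ v : Fin n, (v : ℕ) < U → (v, v) ∈ userMatching 9 1 (mkInstance G₁ G₂ S) := by
    intro v hv
    have hW := h.card_seed_witnesses hv
    refine h.separated.mem_iteration (h.separated.correct_userMatching 0) (by norm_num)
      (Finset.filter_subset _ _) (fun a ha => (Finset.mem_filter.1 ha).2)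
      ((Nat.le_add_left _ _).trans hW) (fun v' hv' => ?_) fun v' hv' => ?_
    · exact (h.card_witnesses_lt hv'.symm).trans_le hW
    · exact (h.card_witnesses_lt hv').trans_le hW
  have hmono := h.separated.userMatching_mono
  induction i generalizing v with
  | zero => exact hearly v (by simpa using hi)
  | succ i ih =>
    rcases lt_or_ge (v : ℕ) U with hvU | hvU
    · exact hmono (Nat.le_add_left 1 (i + 1)) (hearly v hvU)
    cases hv with
    | early h' => omega
    | step A hcard a1 a2 hold hA =>
      have hAn : ∀ a ∈ A, a < n := fun a ha => by have := hold a ha; have := v.2; omega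
      rw [userMatching, Function.iterate_succ_apply']
      have hW : 9 ≤ (Finset.univ.filter fun a : Fin n => (a : ℕ) ∈ A).card := by
        rw [← Finset.card_image_of_injective _ Fin.val_injective]
        refine hcard.trans (Finset.card_le_card fun a ha => ?_)
        exact Finset.mem_image.2 ⟨⟨a, hAn a ha⟩, by simpa using ha, rfl⟩
      refine h.separated.mem_iteration (W := Finset.univ.filter fun a : Fin n => (a : ℕ) ∈ A)
        (h.separated.correct_userMatching (i + 1)) (by norm_num) ?_ ?_ hW ?_ ?_
      · intro a ha
        rw [Finset.mem_filter] at ha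
        rw [witnesses, Finset.mem_inter, mem_neighbors, mem_neighbors]
        exact ⟨Or.inr (mem_valEdges.1 (a1 a ha.2)), Or.inr (mem_valEdges.1 (a2 a ha.2))⟩
      · intro a ha
        rw [Finset.mem_filter] at ha
        refine ih (hA a ha.2) ?_
        have h1 := hold a ha.2
        have h2 : (101 * (a : ℕ)) * 100 ^ i ≤ (100 * v) * 100 ^ i := Nat.mul_le_mul_right _ h1
        rw [pow_succ, pow_succ] at hi
        refine lt_of_mul_lt_mul_left (a := 101) ?_ (Nat.zero_le _)
        nlinarith
      · exact fun v' hv' => (h.card_witnesses_late hv'.symm (Or.inl hvU)).trans_le hW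
      · exact fun v' hv' => (h.card_witnesses_late hv' (Or.inr hvU)).trans_le hW

/-- Each unreached node contributes at least the `m` edges it issued to the bad weight. -/
theorem Typical.card_unreached_le (hm : 1 ≤ m) :
    ((unreached U n (valEdges G₁) (valEdges G₂)).card : ℝ) ≤ 3 / 100 * n := by
  have h1 : m * (unreached U n (valEdges G₁) (valEdges G₂)).card ≤
      badWeight U n G (valEdges G₁) (valEdges G₂) := by
    rw [mul_comm, ← smul_eq_mul]
    refine Finset.card_nsmul_le_sum _ _ _ fun v hv => ?_
    rw [unreached, Finset.mem_filter, Finset.mem_range] at hv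
    unfold degree
    rw [h.grown.count_source v hv.1]
    exact Nat.le_add_right _ _
  have h2 : (m : ℝ) * (unreached U n (valEdges G₁) (valEdges G₂)).card ≤
      badWeight U n G (valEdges G₁) (valEdges G₂) := by exact_mod_cast h1
  have h3 := h.bad
  have hm' : (1 : ℝ) ≤ m := by exact_mod_cast hm
  nlinarith

theorem Typical.card_identified_ge (hm : 1 ≤ m) {i k : ℕ} (hi : n * 100 ^ i ≤ 101 ^ i * U)
    (hk : i + 1 ≤ k) :
    (97 / 100 : ℝ) * n ≤ (identified (userMatching 9 k (mkInstance G₁ G₂ S))).card := by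
  have h1 : Finset.range n ⊆ (identified (userMatching 9 k (mkInstance G₁ G₂ S))).image Fin.val ∪
      unreached U n (valEdges G₁) (valEdges G₂) := by
    intro v hv
    rw [Finset.mem_range] at hv
    lift v to Fin n using hv
    rw [Finset.mem_union, unreached, Finset.mem_filter, Finset.mem_range]
    by_cases hr : Reached U (valEdges G₁) (valEdges G₂) v
    · refine Or.inl (Finset.mem_image_of_mem _ ?_)
      rw [identified, Finset.mem_filter]
      refine ⟨Finset.mem_univ _, h.separated.userMatching_mono hk (h.mem_userMatching hr ?_)⟩
      exact lt_of_lt_of_le (Nat.mul_lt_mul_of_pos_right v.2 (by positivity)) hi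
    · exact Or.inr ⟨v.2, hr⟩
  have h2 := (Finset.card_le_card h1).trans (Finset.card_union_le _ _)
  rw [Finset.card_range, Finset.card_image_of_injective _ Fin.val_injective] at h2
  have h3 := h.card_unreached_le hm
  have h4 : (n : ℝ) ≤ (identified (userMatching 9 k (mkInstance G₁ G₂ S))).card +
      (unreached U n (valEdges G₁) (valEdges G₂)).card := by exact_mod_cast h2
  linarith

end

/-! ### Typical inputs are likely -/

theorem ExInput_mono_support {m n : ℕ} (hn : 1 ≤ n) {s l : I}
    {f g : EdgeList ℕ → EdgeList ℕ → EdgeList ℕ → List ℕ → ℝ≥0∞}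
    (h : ∀ (G G₁ G₂ : EdgeList ℕ) (S : List ℕ), IsGrown m n G → G₁.Sublist G → G₂.Sublist G →
      f G G₁ G₂ S ≤ g G G₁ G₂ S) : ExInput m n s l f ≤ ExInput m n s l g :=
  ExCopies_mono_support hn fun G G₁ G₂ h0 h1 h2 => Ex_mono fun S => h G G₁ G₂ S h0 h1 h2

theorem ExInput_add (m n : ℕ) (s l : I)
    (f g : EdgeList ℕ → EdgeList ℕ → EdgeList ℕ → List ℕ → ℝ≥0∞) :
    ExInput m n s l (fun G G₁ G₂ S => f G G₁ G₂ S + g G G₁ G₂ S) =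
      ExInput m n s l f + ExInput m n s l g := by
  simp only [ExInput, Ex_add, ExCopies_add]

theorem ExInput_copies (m n : ℕ) (s l : I) (f : EdgeList ℕ → EdgeList ℕ → EdgeList ℕ → ℝ≥0∞) :
    ExInput m n s l (fun G G₁ G₂ _ => f G G₁ G₂) = ExCopies m n s f := by
  simp only [ExInput, Ex_const]

theorem ExInput_graph (m n : ℕ) (s l : I) (f : EdgeList ℕ → ℝ≥0∞) :
    ExInput m n s l (fun G _ _ _ => f G) = Ex (natGraph m n) f := by
  rw [ExInput_copies m n s l fun G _ _ => f G, ExCopies_fst]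

/-- The random input of the algorithm in terms of graphs on natural numbers. -/
theorem ExInput_le_Ex_randomInstance (m n : ℕ) (s l : I)
    (f : EdgeList ℕ → EdgeList ℕ → EdgeList ℕ → List ℕ → ℝ≥0∞) (g : Instance (Fin n) → ℝ≥0∞)
    (h : ∀ (G G₁ G₂ : EdgeList (Fin n)) (S : List (Fin n)), f (valEdges G) (valEdges G₁) (valEdges G₂) (S.map Fin.val) ≤
      g (mkInstance G₁ G₂ S)) :
    ExInput m n s l f ≤ Ex (randomInstance m n s l) g := by
  unfold ExInput ExCopies randomInstance
  rw [← Ex_paGraph_val, Ex_bind]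
  refine Ex_mono fun G => ?_
  rw [Ex_bind, Ex₂, valEdges, Ex_thin_map]
  refine Ex_mono fun G₁ => ?_
  rw [Ex_bind, Ex_thin_map]
  refine Ex_mono fun G₂ => ?_
  rw [Ex_bind, ← List.map_coe_finRange_eq_range]
  refine (Ex_thin_map l Fin.val (List.finRange n) _).le.trans ?_
  refine Ex_mono fun S => ?_
  rw [Ex_pure]
  exact h G G₁ G₂ S

/-- A bound for the probability that the input is not typical. -/
noncomputable def failureBound (m : ℕ) (s l : ℝ) (n U w N : ℕ) (y : ℝ) : ℝ :=
  (edgeBound m 8 ^ 2 * harmonicSum n) ^ 4 * 2 / U +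
  (U : ℝ) ^ 2 * (edgeBound m 2 ^ 2 * harmonicSum n) / w +
  U * (2 * (2 * ((2 * m + 1 : ℕ) : ℝ) * √(n : ℝ) * (2 / y ^ 2)) +
    ((Nat.log 2 (2 * (m * n)) + 1 : ℕ) : ℝ) * (2 * y / s + 1) * (4 * √((U : ℝ) / n))) +
  (U * ((m * (N + 1) : ℕ) * (4 * √((U : ℝ) / n))) + U * (2 ^ (w + 9) * (1 - s ^ 2 * (l / 2)) ^ N)) +
  (Real.exp (-(15 / 10000 * U)) + (20 * (2 * ((2 * m + 4 : ℕ) : ℝ))) ^ 4 * 8 / U)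

/-- A union bound over the five exceptional events, written additively to avoid subtraction in
`ℝ≥0∞`. -/
theorem one_le_ExInput_typical_add {m n U w N : ℕ} {s l : I}
    (hms : 22 ≤ (m : ℝ) * (s : ℝ) ^ 2) (hU : 1000 ≤ U) (hn : U ≤ n) (hw : 1 ≤ w) {y : ℝ}
    (hy : 0 < y) :
    1 ≤ ExInput m n s l (fun G G₁ G₂ S => ind (Typical m n U w G G₁ G₂ S)) +
      ENNReal.ofReal (failureBound m s l n U w N y) := by
  have hs0 : 0 < (s : ℝ) := by
    rcases s.2.1.eq_or_lt with h | h
    · rw [← h] at hms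
      norm_num at hms
    · exact h
  have hs1 := s.2.2
  have hl0 := l.2.1
  have hl1 := l.2.2
  have hm : 1 ≤ m := by
    rcases Nat.eq_zero_or_pos m with rfl | h
    · norm_num at hms
    · exact h
  have hq : 0 ≤ 1 - (s : ℝ) ^ 2 * (l / 2) := by nlinarith
  have hh := harmonicSum_nonneg n
  have hone : (1 : ℝ≥0∞) = ExInput m n s l fun _ _ _ _ => 1 := by
    rw [ExInput_graph m n s l fun _ => 1, Ex_const]
  have h1 : ExInput m n s l (fun _ _ _ _ => 1) ≤ ExInput m n s l (fun G G₁ G₂ S =>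
      ind (Typical m n U w G G₁ G₂ S) +
      (ind (∃ p ∈ Finset.range n ×ˢ Finset.Ico U n,
          p.1 ≠ p.2 ∧ 4 ≤ (commonNbrs n G p.1 p.2).card) +
        (ind (∃ p ∈ Finset.range U ×ˢ Finset.range U,
          p.1 ≠ p.2 ∧ w ≤ (commonNbrs n G p.1 p.2).card) +
        (ind (∃ u ∈ Finset.range U, ∃ j : ℕ, 2 ^ j ≤ degree G₁ u ∧ degree G₂ u < 2 ^ j) +
        (ind (∃ u ∈ Finset.range U,
          ((Finset.range n).filter fun a => (a, u) ∈ G₁ ∧ (a, u) ∈ G₂ ∧ a ∈ S).card < w + 9) +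
        ind (3 / 100 * (m * n : ℝ) < badWeight U n G G₁ G₂)))))) := by
    refine ExInput_mono_support (by omega) fun G G₁ G₂ S hG hG₁ hG₂ => ?_
    have hcover : Typical m n U w G G₁ G₂ S ∨
        (∃ p ∈ Finset.range n ×ˢ Finset.Ico U n, p.1 ≠ p.2 ∧ 4 ≤ (commonNbrs n G p.1 p.2).card) ∨
        (∃ p ∈ Finset.range U ×ˢ Finset.range U, p.1 ≠ p.2 ∧ w ≤ (commonNbrs n G p.1 p.2).card) ∨
        (∃ u ∈ Finset.range U, ∃ j : ℕ, 2 ^ j ≤ degree G₁ u ∧ degree G₂ u < 2 ^ j) ∨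
        (∃ u ∈ Finset.range U,
          ((Finset.range n).filter fun a => (a, u) ∈ G₁ ∧ (a, u) ∈ G₂ ∧ a ∈ S).card < w + 9) ∨
        3 / 100 * (m * n : ℝ) < badWeight U n G G₁ G₂ := by
      by_contra hcon
      push Not at hcon
      obtain ⟨h0, h1, h2, h3, h4, h5⟩ := hcon
      refine h0 ⟨hG, hG₁, hG₂, fun u hu v hv hUv huv => ?_, fun u hu v hv huv => ?_,
        fun u hu j => h3 u (Finset.mem_range.2 hu) j,
        fun u hu => h4 u (Finset.mem_range.2 hu), h5⟩
      · exact h1 (u, v) (by simp [hu, hv, hUv]) huv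
      · exact h2 (u, v) (by simp [hu, hv]) huv
    rw [← ind_true hcover]
    refine (ind_or_le _ _).trans (add_le_add le_rfl ?_)
    refine (ind_or_le _ _).trans (add_le_add le_rfl ?_)
    refine (ind_or_le _ _).trans (add_le_add le_rfl ?_)
    refine (ind_or_le _ _).trans (add_le_add le_rfl ?_)
    exact ind_or_le _ _
  rw [← hone] at h1
  refine h1.trans ?_
  rw [ExInput_add, ExInput_add, ExInput_add, ExInput_add, ExInput_add]
  refine add_le_add le_rfl ?_
  have e1 := Ex_exists_late_pair_le hm (by omega : 1 ≤ U) hn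
  have e2 := Ex_exists_early_pair_le hm hn hw
  have e3 := ExInput_straddle_le hm hn (by omega) s l hs0 hy
  have e4 := ExInput_few_seed_witnesses_le hm hn (by omega) s l (w + 9) N
  have e5 := ExCopies_badWeight_gt_le hms hU hn
  rw [← ExInput_graph m n s l] at e1 e2
  rw [← ExInput_copies m n s l] at e5
  refine (add_le_add e1 (add_le_add e2 (add_le_add e3 (add_le_add e4 e5)))).trans (le_of_eq ?_)
  rw [← ENNReal.ofReal_add (by positivity) (by positivity),
    ← ENNReal.ofReal_add (by positivity) (by positivity),
    ← ENNReal.ofReal_add (by positivity) (by positivity),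
    ← ENNReal.ofReal_add (by positivity) (by positivity)]
  congr 1
  unfold failureBound
  ring

/-- The probability that User-Matching succeeds. -/
theorem one_le_success_add {m n U w N i : ℕ} {s l : I}
    (hms : 22 ≤ (m : ℝ) * (s : ℝ) ^ 2) (hU : 1000 ≤ U) (hn : U ≤ n) (hw : 1 ≤ w) {y : ℝ}
    (hy : 0 < y) (hi : n * 100 ^ i ≤ 101 ^ i * U) {K : ℝ} (hK : (i : ℝ) < K) :
    1 ≤ (randomInstance m n s l).toOuterMeasure
        {x | (∀ k : ℕ, ∀ p ∈ userMatching 9 k x, p.1 = p.2) ∧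
          (∀ k : ℕ, K ≤ (k : ℝ) →
            (97 / 100 : ℝ) * (n : ℝ) ≤ ((identified (userMatching 9 k x)).card : ℝ))} +
      ENNReal.ofReal (failureBound m s l n U w N y) := by
  have hm : 1 ≤ m := by
    rcases Nat.eq_zero_or_pos m with rfl | h
    · norm_num at hms
    · exact h
  refine (one_le_ExInput_typical_add hms hU hn hw hy).trans (add_le_add ?_ le_rfl)
  rw [toOuterMeasure_eq_Ex]
  refine ExInput_le_Ex_randomInstance m n s l _ _ fun G G₁ G₂ S => ind_le_of fun h => ?_
  rw [Set.indicator_of_mem]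
  · rfl
  · refine ⟨fun k => (h.separated.correct_userMatching k).2, fun k hk => ?_⟩
    refine h.card_identified_ge hm hi ?_
    have : (i : ℝ) < k := hK.trans_le hk
    exact_mod_cast this

/-! ### Asymptotics -/

theorem natLog_two_le (M : ℕ) : (Nat.log 2 M : ℝ) ≤ 2 * Real.log M := by
  have h1 := Real.natLog_le_logb M 2
  rw [Real.logb, Nat.cast_ofNat, le_div_iff₀ (Real.log_pos (by norm_num))] at h1
  have h2 := Real.log_two_gt_d9
  have h3 : (0 : ℝ) ≤ Nat.log 2 M := Nat.cast_nonneg _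
  nlinarith

/-- The part of the failure bound which decreases superpolynomially in `U`. -/
noncomputable def fastBound (q : ℝ) (U : ℕ) : ℝ :=
  U * (2 ^ (U ^ 3 + 9) * q ^ U ^ 4) + Real.exp (-(15 / 10000 * U))

/-- As `U^4 = U · U^3`, the powers combine to `(2 q^U)^(U^3)`, whose base is eventually below `1/2`.
This is why `N = U^4` accompanies `w = U^3`. -/
theorem tendsto_fastBound {q : ℝ} (hq0 : 0 ≤ q) (hq1 : q < 1) :
    Tendsto (fastBound q) atTop (𝓝 0) := by
  have h1 : Tendsto (fun U : ℕ => 2 ^ 9 * ((U : ℝ) ^ 1 * (1 / 2 : ℝ) ^ U)) atTop (𝓝 0) := by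
    have := (tendsto_pow_const_mul_const_pow_of_lt_one 1 (r := (1 / 2 : ℝ)) (by norm_num)
      (by norm_num)).const_mul (2 ^ 9)
    rwa [mul_zero] at this
  have h2 : Tendsto (fun U : ℕ => Real.exp (-(15 / 10000 * (U : ℝ)))) atTop (𝓝 0) :=
    Real.tendsto_exp_neg_atTop_nhds_zero.comp
      (tendsto_natCast_atTop_atTop.const_mul_atTop (by norm_num))
  have h3 : ∀ᶠ U : ℕ in atTop, 2 * q ^ U < 1 / 2 := by
    have := (tendsto_pow_atTop_nhds_zero_of_lt_one hq0 hq1).const_mul 2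
    rw [mul_zero] at this
    exact this.eventually_lt_const (by norm_num)
  have h4 : Tendsto (fun U : ℕ => (U : ℝ) * (2 ^ (U ^ 3 + 9) * q ^ U ^ 4)) atTop (𝓝 0) := by
    refine tendsto_of_tendsto_of_tendsto_of_le_of_le' tendsto_const_nhds h1
      (Eventually.of_forall fun U => by positivity) ?_
    filter_upwards [h3, eventually_ge_atTop 1] with U hU hU1
    have h5 : (2 : ℝ) ^ (U ^ 3 + 9) * q ^ U ^ 4 = 2 ^ 9 * (2 * q ^ U) ^ U ^ 3 := by
      rw [mul_pow, ← pow_mul, pow_add, show U ^ 4 = U * U ^ 3 by ring]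
      ring
    have h6 : (2 * q ^ U) ^ U ^ 3 ≤ (1 / 2 : ℝ) ^ U := by
      refine (pow_le_pow_left₀ (by positivity) hU.le _).trans ?_
      exact pow_le_pow_of_le_one (by norm_num) (by norm_num) (Nat.le_self_pow (by norm_num) U)
    rw [h5, pow_one]
    calc (U : ℝ) * (2 ^ 9 * (2 * q ^ U) ^ U ^ 3) ≤ U * (2 ^ 9 * (1 / 2 : ℝ) ^ U) := by gcongr
      _ = _ := by ring
  have := h4.add h2
  rwa [add_zero] at this

/-- The failure bound when `n` is about the two hundredth power of `t`. -/
theorem exists_failureBound_le (m : ℕ) {s l : ℝ} (hs0 : 0 < s) (hm : 1 ≤ m) :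
    ∃ C : ℝ, ∀ t n : ℕ, 1 ≤ t → t ^ 200 ≤ n → n ≤ (2 * t) ^ 200 →
      failureBound m s l n (t ^ 10) ((t ^ 10) ^ 3) ((t ^ 10) ^ 4) ((t : ℝ) ^ 60) ≤
        C / t + fastBound (1 - s ^ 2 * (l / 2)) (t ^ 10) := by
  -- Sizes in powers of `t`, with `√n` about `t^100`: `w = U^3` beats the `U^2` early pairs; `y =
  -- t^60` satisfies both `y^2 = t^120 ≫ U √n = t^110` for Chebyshev's inequality and `U y √(U/n) =
  -- t^(-25)` for the windows. Logarithms are absorbed by a single power of `t`: `log n ≤ 400 t`,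
  -- whence the `401`.
  refine ⟨(edgeBound m 8 ^ 2 * 401) ^ 4 * 2 + edgeBound m 2 ^ 2 * 401 +
    (2 * (2 * ((2 * m + 1 : ℕ) : ℝ) * 2 ^ 100 * 2) +
      (4 * m + 801) * (2 / s + 1) * 4) + m * 2 * 4 +
    (20 * (2 * ((2 * m + 4 : ℕ) : ℝ))) ^ 4 * 8, fun t n ht hn1 hn2 => ?_⟩
  have ht1 : (1 : ℝ) ≤ t := by exact_mod_cast ht
  have ht0 : (0 : ℝ) < t := by linarith
  have hn1' : (t : ℝ) ^ 200 ≤ n := by exact_mod_cast hn1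
  have hn2' : (n : ℝ) ≤ (2 * t) ^ 200 := by exact_mod_cast hn2
  have hn0 : (0 : ℝ) < n := lt_of_lt_of_le (by positivity) hn1'
  have hm1 : (1 : ℝ) ≤ m := by exact_mod_cast hm
  have hlog : Real.log n ≤ 400 * t := by
    have h1 := Real.log_le_log hn0 hn2'
    rw [Real.log_pow] at h1
    have h2 := Real.log_le_self (by positivity : (0 : ℝ) ≤ 2 * t)
    push_cast at h1
    linarith
  have hh : harmonicSum n ≤ 401 * t := (harmonicSum_le n).trans (by linarith)
  have hh0 := harmonicSum_nonneg n
  have hlog2 : ((Nat.log 2 (2 * (m * n)) + 1 : ℕ) : ℝ) ≤ (4 * m + 801) * t := by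
    have h1 := natLog_two_le (2 * (m * n))
    have h2 : Real.log ((2 * (m * n) : ℕ) : ℝ) = Real.log (2 * m) + Real.log n := by
      rw [← Real.log_mul (by positivity) (by positivity)]
      push_cast
      rw [mul_assoc]
    have h3 := Real.log_le_self (by positivity : (0 : ℝ) ≤ 2 * m)
    rw [h2] at h1
    push_cast
    nlinarith
  have hsqrt : √(n : ℝ) ≤ 2 ^ 100 * t ^ 100 := by
    rw [Real.sqrt_le_left (by positivity)]
    refine hn2'.trans (le_of_eq ?_)
    rw [mul_pow, mul_pow, ← pow_mul, ← pow_mul]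
  have hratio : √(((t ^ 10 : ℕ) : ℝ) / n) ≤ 1 / t ^ 95 := by
    rw [Real.sqrt_le_left (by positivity), div_pow, one_pow, div_le_div_iff₀ hn0 (by positivity)]
    push_cast
    refine le_trans (le_of_eq ?_) (hn1'.trans (one_mul (n : ℝ)).ge)
    rw [← pow_mul, ← pow_add]
  have hpow : ∀ {c : ℝ} (_ : 0 ≤ c) (k : ℕ), 1 ≤ k → c / (t : ℝ) ^ k ≤ c / t := by
    intro c hc k hk
    gcongr
    exact le_self_pow₀ ht1 (by omega)
  have b1 : (edgeBound m 8 ^ 2 * harmonicSum n) ^ 4 * 2 / ((t ^ 10 : ℕ) : ℝ) ≤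
      (edgeBound m 8 ^ 2 * 401) ^ 4 * 2 / t := by
    calc _ ≤ (edgeBound m 8 ^ 2 * (401 * t)) ^ 4 * 2 / ((t ^ 10 : ℕ) : ℝ) := by gcongr
      _ = (edgeBound m 8 ^ 2 * 401) ^ 4 * 2 / (t : ℝ) ^ 6 := by
          push_cast
          field_simp
      _ ≤ _ := hpow (by positivity) 6 (by norm_num)
  have b2 : ((t ^ 10 : ℕ) : ℝ) ^ 2 * (edgeBound m 2 ^ 2 * harmonicSum n) /
      (((t ^ 10) ^ 3 : ℕ) : ℝ) ≤ edgeBound m 2 ^ 2 * 401 / t := by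
    calc _ ≤ ((t ^ 10 : ℕ) : ℝ) ^ 2 * (edgeBound m 2 ^ 2 * (401 * t)) /
          (((t ^ 10) ^ 3 : ℕ) : ℝ) := by gcongr
      _ = edgeBound m 2 ^ 2 * 401 / (t : ℝ) ^ 9 := by
          push_cast
          field_simp
      _ ≤ _ := hpow (by positivity) 9 (by norm_num)
  have b3 : ((t ^ 10 : ℕ) : ℝ) * (2 * (2 * ((2 * m + 1 : ℕ) : ℝ) * √(n : ℝ) *
        (2 / ((t : ℝ) ^ 60) ^ 2)) + ((Nat.log 2 (2 * (m * n)) + 1 : ℕ) : ℝ) *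
        (2 * (t : ℝ) ^ 60 / s + 1) * (4 * √(((t ^ 10 : ℕ) : ℝ) / n))) ≤
      (2 * (2 * ((2 * m + 1 : ℕ) : ℝ) * 2 ^ 100 * 2) + (4 * m + 801) * (2 / s + 1) * 4) / t := by
    have h60 : 2 * (t : ℝ) ^ 60 / s + 1 ≤ (2 / s + 1) * t ^ 60 := by
      have : (1 : ℝ) ≤ t ^ 60 := one_le_pow₀ ht1
      rw [add_mul, one_mul, div_mul_eq_mul_div]
      linarith
    calc _ ≤ ((t ^ 10 : ℕ) : ℝ) * (2 * (2 * ((2 * m + 1 : ℕ) : ℝ) * (2 ^ 100 * t ^ 100) *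
        (2 / ((t : ℝ) ^ 60) ^ 2)) + (4 * m + 801) * t *
        ((2 / s + 1) * t ^ 60) * (4 * (1 / t ^ 95))) := by gcongr
      _ = 2 * (2 * ((2 * m + 1 : ℕ) : ℝ) * 2 ^ 100 * 2) / (t : ℝ) ^ 10 +
          (4 * m + 801) * (2 / s + 1) * 4 / (t : ℝ) ^ 24 := by
          push_cast
          field_simp
      _ ≤ _ := by
          rw [add_div]
          exact add_le_add (hpow (by positivity) 10 (by norm_num))
            (hpow (by positivity) 24 (by norm_num))
  have b4 : ((t ^ 10 : ℕ) : ℝ) * ((m * ((t ^ 10) ^ 4 + 1) : ℕ) *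
      (4 * √(((t ^ 10 : ℕ) : ℝ) / n))) ≤ m * 2 * 4 / t := by
    have h40 : ((m * ((t ^ 10) ^ 4 + 1) : ℕ) : ℝ) ≤ m * 2 * t ^ 40 := by
      have : (1 : ℝ) ≤ t ^ 40 := one_le_pow₀ ht1
      push_cast
      rw [← pow_mul, mul_assoc]
      gcongr
      norm_num
      linarith
    calc _ ≤ ((t ^ 10 : ℕ) : ℝ) * (m * 2 * t ^ 40 * (4 * (1 / t ^ 95))) := by gcongr
      _ = m * 2 * 4 / (t : ℝ) ^ 45 := by
          push_cast
          field_simp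
      _ ≤ _ := hpow (by positivity) 45 (by norm_num)
  have b5 : (20 * (2 * ((2 * m + 4 : ℕ) : ℝ))) ^ 4 * 8 / ((t ^ 10 : ℕ) : ℝ) ≤
      (20 * (2 * ((2 * m + 4 : ℕ) : ℝ))) ^ 4 * 8 / t := by
    rw [Nat.cast_pow]
    exact hpow (by positivity) 10 (by norm_num)
  unfold failureBound fastBound
  simp only [add_div] at b3 ⊢
  linarith

/-- The two hundredth root of `n`, rounded down. -/
noncomputable def root (n : ℕ) : ℕ := ⌊(n : ℝ) ^ (1 / 200 : ℝ)⌋₊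

theorem tendsto_root : Tendsto root atTop atTop :=
  tendsto_nat_floor_atTop.comp ((tendsto_rpow_atTop (by norm_num)).comp
    tendsto_natCast_atTop_atTop)

theorem root_pow_le (n : ℕ) : root n ^ 200 ≤ n := by
  have h1 : (root n : ℝ) ≤ (n : ℝ) ^ (1 / 200 : ℝ) := Nat.floor_le (by positivity)
  have h2 := pow_le_pow_left₀ (Nat.cast_nonneg _) h1 200
  rw [← Real.rpow_natCast ((n : ℝ) ^ _), ← Real.rpow_mul (Nat.cast_nonneg _)] at h2
  norm_num at h2
  exact_mod_cast h2

theorem le_two_mul_root_pow {n : ℕ} (hn : 1 ≤ root n) : n ≤ (2 * root n) ^ 200 := by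
  have h1 : (n : ℝ) ^ (1 / 200 : ℝ) ≤ 2 * root n := by
    have := (Nat.lt_floor_add_one ((n : ℝ) ^ (1 / 200 : ℝ))).le
    have h : (1 : ℝ) ≤ root n := by exact_mod_cast hn
    unfold root at h ⊢
    linarith
  have h2 := pow_le_pow_left₀ (by positivity) h1 200
  rw [← Real.rpow_natCast ((n : ℝ) ^ _), ← Real.rpow_mul (Nat.cast_nonneg _)] at h2
  norm_num at h2
  exact_mod_cast h2

/-- A number of iterations which suffices to reach all nodes. -/
theorem depth_suffices (n : ℕ) : n * 100 ^ (200 * (n.sqrt + 1)) ≤ 101 ^ (200 * (n.sqrt + 1)) := by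
  have h1 : ∀ j : ℕ, (1 : ℝ) + j * (1 / 100) ≤ (101 / 100 : ℝ) ^ j := by
    intro j
    have := one_add_mul_le_pow (a := (1 / 100 : ℝ)) (by norm_num) j
    norm_num at this ⊢
    exact this
  -- Bernoulli's inequality at exponent `100 r`, with `r = n.sqrt + 1`, gives at least `r`, and the
  -- square of `r` exceeds `n`. The true order is logarithmic, but this form is easily compared with
  -- `n^(3/4)`.
  have h2 := h1 (100 * (n.sqrt + 1))
  push_cast at h2
  have h3 : ((n.sqrt : ℝ) + 1) ^ 2 ≤ (101 / 100 : ℝ) ^ (200 * (n.sqrt + 1)) := by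
    rw [show 200 * (n.sqrt + 1) = 100 * (n.sqrt + 1) * 2 by ring, pow_mul]
    gcongr
    linarith
  have h4 : (n : ℝ) ≤ ((n.sqrt : ℝ) + 1) ^ 2 := by
    have := (Nat.lt_succ_sqrt n).le
    rw [pow_two]
    exact_mod_cast this
  have h5 := h4.trans h3
  rw [div_pow, le_div_iff₀ (by positivity)] at h5
  exact_mod_cast h5

/-- In terms of `x = n^(1/4)` it suffices that `200 (x^2 + 1) < x^3`. -/
theorem eventually_depth_lt :
    ∀ᶠ n : ℕ in atTop, ((200 * (n.sqrt + 1) : ℕ) : ℝ) < (n : ℝ) ^ (3 / 4 : ℝ) := by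
  have h1 : Tendsto (fun n : ℕ => (n : ℝ) ^ (1 / 4 : ℝ)) atTop atTop :=
    (tendsto_rpow_atTop (by norm_num)).comp tendsto_natCast_atTop_atTop
  filter_upwards [h1.eventually_ge_atTop 400] with n hn
  set x : ℝ := (n : ℝ) ^ (1 / 4 : ℝ) with hx
  have h3 : (n : ℝ) ^ (3 / 4 : ℝ) = x ^ 3 := by
    rw [hx, ← Real.rpow_natCast, ← Real.rpow_mul (Nat.cast_nonneg _)]
    norm_num
  have h4 : (n : ℝ) = x ^ 4 := by
    rw [hx, ← Real.rpow_natCast, ← Real.rpow_mul (Nat.cast_nonneg _)]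
    norm_num
  have h5 : (n.sqrt : ℝ) ≤ x ^ 2 := by
    refine abs_le_of_sq_le_sq' ?_ (by positivity) |>.2
    rw [← pow_mul, ← h4]
    exact_mod_cast Nat.sqrt_le' n
  rw [h3]
  push_cast
  nlinarith [mul_self_nonneg x]

theorem tendsto_measure_one {p : ℕ → ℝ≥0∞} {e : ℕ → ℝ} (hp : ∀ n, p n ≤ 1)
    (he : Tendsto e atTop (𝓝 0)) (h : ∀ᶠ n in atTop, 1 ≤ p n + ENNReal.ofReal (e n)) :
    Tendsto p atTop (𝓝 1) := by
  have h1 : Tendsto (fun n => 1 - ENNReal.ofReal (e n)) atTop (𝓝 1) := by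
    have := ENNReal.Tendsto.sub (tendsto_const_nhds (x := (1 : ℝ≥0∞)))
      (ENNReal.tendsto_ofReal he) (Or.inl ENNReal.one_ne_top)
    simpa using this
  refine tendsto_of_tendsto_of_tendsto_of_le_of_le' h1 tendsto_const_nhds ?_
    (Eventually.of_forall hp)
  filter_upwards [h] with n hn
  exact tsub_le_iff_right.2 hn

theorem toOuterMeasure_le_one {α : Type} (μ : PMF α) (s : Set α) : μ.toOuterMeasure s ≤ 1 := by
  rw [toOuterMeasure_eq_Ex]
  exact Ex_le_const fun a _ => Set.indicator_le_self' (fun _ _ => zero_le) a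

end UserMatching

/-! ### Conclusion: choice of parameters and limit -/

theorem mainTheorem1 (m : ℕ) (s l : unitInterval) (hl : 0 < l)
    (hms : 22 ≤ (m : ℝ) * (s : ℝ) ^ 2) :
    Tendsto
      (fun n : ℕ => (UserMatching.randomInstance m n s l).toOuterMeasure
        {x | (∀ k : ℕ, ∀ p ∈ UserMatching.userMatching 9 k x, p.1 = p.2) ∧
          (∀ k : ℕ, (n : ℝ) ^ (3 / 4 : ℝ) ≤ (k : ℝ) →
            (97 / 100 : ℝ) * (n : ℝ) ≤
              ((UserMatching.identified (UserMatching.userMatching 9 k x)).card : ℝ))})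
      atTop (𝓝 1) := by
  open UserMatching in
  have hs0 : 0 < (s : ℝ) := by
    rcases s.2.1.eq_or_lt with h | h
    · rw [← h] at hms
      norm_num at hms
    · exact h
  have hs1 := s.2.2
  have hl0 : 0 < (l : ℝ) := hl
  have hl1 := l.2.2
  have hm : 1 ≤ m := by
    rcases Nat.eq_zero_or_pos m with rfl | h
    · norm_num at hms
    · exact h
  obtain ⟨C, hC⟩ := exists_failureBound_le m (l := l) hs0 hm
  have hroot : Tendsto (fun n => root n ^ 10) atTop atTop :=
    (tendsto_pow_atTop (by norm_num)).comp tendsto_root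
  have hpos : 0 < (s : ℝ) ^ 2 * (l / 2) := by positivity
  have herr : Tendsto (fun n => C / (root n : ℝ) +
      fastBound (1 - (s : ℝ) ^ 2 * (l / 2)) (root n ^ 10)) atTop (𝓝 0) := by
    have h1 := (tendsto_natCast_atTop_atTop.comp tendsto_root).const_div_atTop C
    have h2 := (tendsto_fastBound (q := 1 - (s : ℝ) ^ 2 * (l / 2)) (by nlinarith)
      (by linarith)).comp hroot
    simpa using h1.add h2
  refine tendsto_measure_one (fun n => toOuterMeasure_le_one _ _) herr ?_
  filter_upwards [tendsto_root.eventually_ge_atTop 1, hroot.eventually_ge_atTop 1000,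
    eventually_depth_lt] with n h1 h2 h3
  have hn1 := root_pow_le n
  -- The threshold is `U = root n ^ 10`, about `n^(1/20)`. The depth is `200 (n.sqrt + 1)`, for
  -- which `depth_suffices` holds even without the factor `U`.
  refine (one_le_success_add (w := (root n ^ 10) ^ 3) (N := (root n ^ 10) ^ 4)
    (y := (root n : ℝ) ^ 60) hms h2 ?_ ?_ ?_ ?_ h3).trans
      (add_le_add le_rfl (ENNReal.ofReal_le_ofReal (hC _ _ h1 hn1 (le_two_mul_root_pow h1))))
  · exact (Nat.pow_le_pow_right h1 (by norm_num)).trans hn1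
  · exact Nat.one_le_pow _ _ (by omega)
  · have : (1 : ℝ) ≤ root n := by exact_mod_cast h1
    positivity
  · exact (depth_suffices n).trans (Nat.le_mul_of_pos_right _ (by omega))
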